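/- **Proposition 3.3.** Let $T$ be an oriented one-holed torus, let $\mathrm{Diff}^+(T,\partial T)$ denote the group of orientation-preserving diffeomorphisms of $T$ that restrict to the identity on $\partial T$, considered modulo isotopies fixing $\partial T$ pointwise, where $\phi\psi$ means $\phi$ followed by $\psi$. Let $x,y\in \mathrm{Diff}^+(T,\partial T)$ be right-handed Dehn twists along two simple closed curves in $T$ that intersect transversely in exactly one point, and let $\mathrm{Dehn}^+(T,\partial T)\subseteq \mathrm{Diff}^+(T,\partial T)$ be the monoid of all finite products (including the empty product $\mathrm{id}_T$) of right-handed Dehn twists along simple closed curves in $T$. For an $N$-tuple of integers $c=(c_1,\dots,c_N)$, write $$c=(a_1+2,\underbrace{2,\dots,2}_{b_1-1},\dots,a_n+2,\underbrace{2,\dots,2}_{b_n-1}),\qquad a_i\in\mathbb Z,\ b_i\ge 1,$$ and put $h(c)=(xy)^3x^{a_1}y^{-b_1}\cdots x^{a_n}y^{-b_n}\in \mathrm{Diff}^+(T,\partial T)$; this element does not depend on the way in which $c$ is so written. For $k\ge 2$, a blowup of a $k$-tuple $(n_1,\dots,n_k)$ of non-negative integers is any of the $(k+1)$-tuples $$(1,n_1+1,n_2,\dots,n_{k-1},n_k+1),\qquad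 (n_1,\dots,n_i+1,1,n_{i+1}+1,\dots,n_k)\ (1\le i<k),\qquad (n_1+1,n_2,\dots,n_{k-1},n_k+1,1).$$ Suppose that $(s_1,\dots,s_N)$ is obtained from $(0,0)$ by a finite (possibly empty) sequence of successive blowups and that $(c_1,\dots,c_N)$ is an $N$-tuple of integers with $c_i\ge s_i$ for $i=1,\dots,N$. Then $h(c_1,\dots,c_N)\in \mathrm{Dehn}^+(T,\partial T)$. -/

import Mathlib

open scoped Manifold ContDiff

noncomputable section

/-! ## Oriented surfaces -/

/-- The Euclidean plane, with coordinates `x 0`, `x 1`. -/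
abbrev Plane : Type := EuclideanSpace ℝ (Fin 2)

/-- The atlas of a smooth surface with boundary is oriented: all coordinate changes have positive
Jacobian determinant (on the whole overlap, boundary points included). -/
class OrientedAtlas (T : Type*) [TopologicalSpace T] [ChartedSpace (EuclideanHalfSpace 2) T] :
    Prop where
  det_pos : ∀ e ∈ atlas (EuclideanHalfSpace 2) T, ∀ e' ∈ atlas (EuclideanHalfSpace 2) T,
    ∀ p ∈ e.source ∩ e'.source,
      0 < (fderivWithin ℝ (e'.extend (𝓡∂ 2) ∘ (e.extend (𝓡∂ 2)).symm) (Set.range (𝓡∂ 2))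
        (e.extend (𝓡∂ 2) p)).det

/-- `f` preserves orientation at `p`: its differential has positive determinant. A tangent space
is identified with the plane by the preferred chart at its base point, so for
surfaces with an oriented atlas (such as the plane) this is the usual notion. -/
def OrientationPreservingAt {H H' M N : Type*} [TopologicalSpace H] [TopologicalSpace H']
    [TopologicalSpace M] [ChartedSpace H M] [TopologicalSpace N] [ChartedSpace H' N]
    (I : ModelWithCorners ℝ Plane H) (J : ModelWithCorners ℝ Plane H')
    (f : M → N) (p : M) : Prop :=
  0 < (show Plane →L[ℝ] Plane from mfderiv I J f p).det

/-- `T` is a one-holed torus: it is diffeomorphic, through a smooth embedding into the torus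
`S¹ × S¹`, to the complement `{(e^{iα}, e^{iβ}) | cos α + cos β ≤ 1}` of the open disc
`{cos α + cos β > 1}` around `(1, 1)`. -/
def IsOneHoledTorus (T : Type*) [TopologicalSpace T] [ChartedSpace (EuclideanHalfSpace 2) T] :
    Prop :=
  ∃ ι : T → Circle × Circle, Manifold.IsSmoothEmbedding (𝓡∂ 2) ((𝓡 1).prod (𝓡 1)) ∞ ι ∧
    Set.range ι = {q | (q.1 : ℂ).re + (q.2 : ℂ).re ≤ 1}

/-! ## The group of orientation-preserving diffeomorphisms rel boundary, up to isotopy -/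

/-- `Diff⁺(T, ∂T)`: orientation-preserving diffeomorphisms that fix the boundary pointwise. -/
structure DiffPlus (T : Type*) [TopologicalSpace T] [ChartedSpace (EuclideanHalfSpace 2) T] where
  /-- the underlying diffeomorphism -/
  toDiffeo : T ≃ₘ⟮𝓡∂ 2, 𝓡∂ 2⟯ T
  orientation : ∀ p, OrientationPreservingAt (𝓡∂ 2) (𝓡∂ 2) toDiffeo p
  fix_boundary : ∀ p ∈ (𝓡∂ 2).boundary T, toDiffeo p = p

namespace DiffPlus

variable {T : Type*} [TopologicalSpace T] [ChartedSpace (EuclideanHalfSpace 2) T]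

theorem ext' {f g : DiffPlus T} (h : ∀ p, f.toDiffeo p = g.toDiffeo p) : f = g := by
  cases f; cases g
  congr
  exact Diffeomorph.ext h

theorem orientation_comp {f g : T ≃ₘ⟮𝓡∂ 2, 𝓡∂ 2⟯ T} {p : T}
    (hf : OrientationPreservingAt (𝓡∂ 2) (𝓡∂ 2) f p)
    (hg : OrientationPreservingAt (𝓡∂ 2) (𝓡∂ 2) g (f p)) :
    OrientationPreservingAt (𝓡∂ 2) (𝓡∂ 2) (f.trans g) p := by
  unfold OrientationPreservingAt at *
  have h := mfderiv_comp (I := 𝓡∂ 2) (I' := 𝓡∂ 2) (I'' := 𝓡∂ 2) p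
    (g.mdifferentiable (by simp) (f p)) (f.mdifferentiable (by simp) p)
  rw [Diffeomorph.coe_trans, h]
  have := mul_pos hg hf
  rw [ContinuousLinearMap.det, ContinuousLinearMap.det, ← LinearMap.det_comp] at this
  exact this

theorem orientation_refl (p : T) :
    OrientationPreservingAt (𝓡∂ 2) (𝓡∂ 2) (Diffeomorph.refl (𝓡∂ 2) T ∞) p := by
  unfold OrientationPreservingAt
  rw [Diffeomorph.coe_refl, mfderiv_id]
  have : (0 : ℝ) < (ContinuousLinearMap.id ℝ Plane).det := by simp [ContinuousLinearMap.det]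
  exact this

theorem orientation_symm {f : T ≃ₘ⟮𝓡∂ 2, 𝓡∂ 2⟯ T}
    (hf : ∀ p, OrientationPreservingAt (𝓡∂ 2) (𝓡∂ 2) f p) (p : T) :
    OrientationPreservingAt (𝓡∂ 2) (𝓡∂ 2) f.symm p := by
  have h1 := hf (f.symm p)
  have h2 := orientation_refl p
  rw [← Diffeomorph.symm_trans_self f] at h2
  unfold OrientationPreservingAt at *
  have h := mfderiv_comp (I := 𝓡∂ 2) (I' := 𝓡∂ 2) (I'' := 𝓡∂ 2) p
    (f.mdifferentiable (by simp) (f.symm p)) (f.symm.mdifferentiable (by simp) p)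
  rw [Diffeomorph.coe_trans, h] at h2
  refine pos_of_mul_pos_right (a := (show Plane →L[ℝ] Plane from
    mfderiv (𝓡∂ 2) (𝓡∂ 2) f (f.symm p)).det) ?_ h1.le
  rw [ContinuousLinearMap.det, ContinuousLinearMap.det, ← LinearMap.det_comp]
  exact h2

/-- The product `f * g` is `f` *followed by* `g`. -/
instance : Mul (DiffPlus T) where
  mul f g :=
    { toDiffeo := f.toDiffeo.trans g.toDiffeo
      orientation := fun p => orientation_comp (f.orientation p) (g.orientation _)
      fix_boundary := fun p hp => by
        simp [f.fix_boundary p hp, g.fix_boundary p hp] }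

instance : One (DiffPlus T) where
  one :=
    { toDiffeo := Diffeomorph.refl (𝓡∂ 2) T ∞
      orientation := orientation_refl
      fix_boundary := fun _ _ => rfl }

instance : Inv (DiffPlus T) where
  inv f :=
    { toDiffeo := f.toDiffeo.symm
      orientation := orientation_symm f.orientation
      fix_boundary := fun p hp => by
        conv_lhs => rw [← f.fix_boundary p hp]
        simp }

theorem mul_apply (f g : DiffPlus T) (p : T) :
    (f * g).toDiffeo p = g.toDiffeo (f.toDiffeo p) := rfl

theorem one_apply (p : T) : (1 : DiffPlus T).toDiffeo p = p := rfl

theorem inv_apply (f : DiffPlus T) (p : T) : (f⁻¹).toDiffeo p = f.toDiffeo.symm p := rfl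

instance : Group (DiffPlus T) :=
  Group.ofLeftAxioms (fun _ _ _ => rfl) (fun _ => ext' fun _ => rfl)
    (fun f => ext' fun p => by
      rw [mul_apply, inv_apply, one_apply, Diffeomorph.apply_symm_apply])

/-- `f` is isotopic to the identity through diffeomorphisms that fix the boundary pointwise: there
is a smooth one-parameter family `F t` of diffeomorphisms, with inverses `G t` that depend
smoothly on the parameter as well, from `F 0 = id` to `F 1 = f`. -/
def IsotopicToId (f : DiffPlus T) : Prop :=
  ∃ F G : ℝ × T → T,
    ContMDiff (𝓘(ℝ, ℝ).prod (𝓡∂ 2)) (𝓡∂ 2) ∞ F ∧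
    ContMDiff (𝓘(ℝ, ℝ).prod (𝓡∂ 2)) (𝓡∂ 2) ∞ G ∧
    (∀ t p, G (t, F (t, p)) = p) ∧
    (∀ t p, F (t, G (t, p)) = p) ∧
    (∀ t, ∀ p ∈ (𝓡∂ 2).boundary T, F (t, p) = p) ∧
    (∀ p, F (0, p) = p) ∧
    (∀ p, F (1, p) = f.toDiffeo p)

variable (T) in
/-- The normal subgroup of diffeomorphisms isotopic to the identity rel boundary. -/
def isotopicToIdSubgroup : Subgroup (DiffPlus T) where
  carrier := {f | f.IsotopicToId}
  one_mem' := ⟨Prod.snd, Prod.snd, contMDiff_snd, contMDiff_snd, fun _ _ => rfl, fun _ _ => rfl,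
    fun _ _ _ => rfl, fun _ => rfl, fun _ => rfl⟩
  mul_mem' := by
    rintro f g ⟨F, F', hF, hF', h1, h2, h3, h4, h5⟩ ⟨G, G', hG, hG', k1, k2, k3, k4, k5⟩
    refine ⟨fun q => G (q.1, F q), fun q => F' (q.1, G' q), hG.comp (contMDiff_fst.prodMk hF),
      hF'.comp (contMDiff_fst.prodMk hG'), ?_, ?_, ?_, ?_, ?_⟩
    · intro t p; simp [k1, h1]
    · intro t p; simp [k2, h2]
    · intro t p hp; simp [h3 t p hp, k3 t p hp]
    · intro p; simp [h4, k4]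
    · intro p; simp [h5, k5, mul_apply]
  inv_mem' := by
    rintro f ⟨F, F', hF, hF', h1, h2, h3, h4, h5⟩
    refine ⟨F', F, hF', hF, h2, h1, ?_, ?_, ?_⟩
    · intro t p hp
      conv_lhs => rw [← h3 t p hp]
      exact h1 t p
    · intro p
      conv_lhs => rw [← h4 p]
      exact h1 0 p
    · intro p
      have := h1 1 (f.toDiffeo.symm p)
      rw [h5, Diffeomorph.apply_symm_apply] at this
      rw [this, inv_apply]

instance : (isotopicToIdSubgroup T).Normal where
  conj_mem := by
    rintro f ⟨F, F', hF, hF', h1, h2, h3, h4, h5⟩ g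
    have hg := g.toDiffeo.contMDiff
    have hg' := g.toDiffeo.symm.contMDiff
    refine ⟨fun q => g.toDiffeo.symm (F (q.1, g.toDiffeo q.2)),
      fun q => g.toDiffeo.symm (F' (q.1, g.toDiffeo q.2)),
      hg'.comp (hF.comp (contMDiff_fst.prodMk (hg.comp contMDiff_snd))),
      hg'.comp (hF'.comp (contMDiff_fst.prodMk (hg.comp contMDiff_snd))), ?_, ?_, ?_, ?_, ?_⟩
    · intro t p; simp [h1]
    · intro t p; simp [h2]
    · intro t p hp
      have := (g⁻¹).fix_boundary p hp
      rw [inv_apply] at this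
      simp [g.fix_boundary p hp, h3 t p hp, this]
    · intro p; simp [h4]
    · intro p; simp [h5, mul_apply, inv_apply]

end DiffPlus

/-- `Diff⁺(T, ∂T)` modulo isotopies that fix `∂T` pointwise. -/
abbrev MappingClassGroup (T : Type*) [TopologicalSpace T]
    [ChartedSpace (EuclideanHalfSpace 2) T] : Type _ :=
  DiffPlus T ⧸ DiffPlus.isotopicToIdSubgroup T

/-! ## Simple closed curves and Dehn twists -/

section Curves

variable {T : Type*} [TopologicalSpace T] [ChartedSpace (EuclideanHalfSpace 2) T]

variable (T) in
/-- A smoothly embedded circle `ℝ/ℤ → T`, given as a `1`-periodic map on `ℝ`. -/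
structure SimpleClosedCurve where
  /-- the parametrization -/
  toFun : ℝ → T
  smooth : ContMDiff 𝓘(ℝ, ℝ) (𝓡∂ 2) ∞ toFun
  eq_iff : ∀ s t, toFun s = toFun t ↔ ∃ n : ℤ, s = t + n
  immersed : ∀ t, mfderiv 𝓘(ℝ, ℝ) (𝓡∂ 2) toFun t ≠ 0

/-- The velocity vector of a curve, read in the preferred chart at the current point. -/
def SimpleClosedCurve.velocity (α : SimpleClosedCurve T) (t : ℝ) : Plane :=
  (show ℝ →L[ℝ] Plane from mfderiv 𝓘(ℝ, ℝ) (𝓡∂ 2) α.toFun t) 1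

/-- The two curves have exactly one common point and cross transversely there. -/
def MeetTransverselyOnce (α β : SimpleClosedCurve T) : Prop :=
  ∃ s t : ℝ, α.toFun s = β.toFun t ∧
    Set.range α.toFun ∩ Set.range β.toFun = {α.toFun s} ∧
    LinearIndependent ℝ ![α.velocity s, β.velocity t]

/-- `φ` is an orientation-preserving diffeomorphism of the open annulus `ℝ/ℤ × ℝ`, with
coordinates `(θ, t)` and the orientation `dθ ∧ dt`, onto an open subset of the interior of `T`. It
is given as a map of the plane that is `1`-periodic in `θ`. -/
structure IsAnnulus (φ : Plane → T) : Prop where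
  localDiffeo : IsLocalDiffeomorph 𝓘(ℝ, Plane) (𝓡∂ 2) ∞ φ
  orientation : ∀ u, OrientationPreservingAt 𝓘(ℝ, Plane) (𝓡∂ 2) φ u
  interior : ∀ u, φ u ∈ (𝓡∂ 2).interior T
  eq_iff : ∀ θ t θ' t', φ !₂[θ, t] = φ !₂[θ', t'] ↔ t = t' ∧ ∃ n : ℤ, θ = θ' + n

/-- `f` is a right-handed Dehn twist along `α`: in an annular neighbourhood of `α` with core
`α`, it is `(θ, t) ↦ (θ + ρ(t), t)` where `ρ` goes from `0` to `1` across the annulus, and it is the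
identity elsewhere. An arc that crosses `α` (say in the direction of growing `t`) is
turned to its right (the direction of growing `θ`). -/
def IsRightHandedDehnTwist (f : DiffPlus T) (α : SimpleClosedCurve T) : Prop :=
  ∃ (φ : Plane → T) (ρ : ℝ → ℝ), IsAnnulus φ ∧ (∀ θ, φ !₂[θ, 0] = α.toFun θ) ∧
    ContDiff ℝ ∞ ρ ∧ (∀ t ≤ -1, ρ t = 0) ∧ (∀ t ≥ 1, ρ t = 1) ∧
    (∀ θ t, f.toDiffeo (φ !₂[θ, t]) = φ !₂[θ + ρ t, t]) ∧
    (∀ p ∉ Set.range φ, f.toDiffeo p = p)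

/-- The mapping class `x` is the right-handed Dehn twist along `α`. -/
def IsDehnTwistClass (x : MappingClassGroup T) (α : SimpleClosedCurve T) : Prop :=
  ∃ f : DiffPlus T, IsRightHandedDehnTwist f α ∧ (f : MappingClassGroup T) = x

variable (T) in
/-- `Dehn⁺(T, ∂T)`: the monoid of all products (the empty one included) of right-handed Dehn
twists along simple closed curves. -/
def DehnPlus : Submonoid (MappingClassGroup T) :=
  Submonoid.closure {x | ∃ α : SimpleClosedCurve T, IsDehnTwistClass x α}

end Curves

/-! ## Strings, blowups and the word `h` -/

/-- `BlowUp z z'` : the string `z'` is a blowup of the string `z` (of length at least `2`). -/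
inductive BlowUp : List ℕ → List ℕ → Prop
  | first (a b : ℕ) (l : List ℕ) : BlowUp (a :: (l ++ [b])) (1 :: (a + 1) :: (l ++ [b + 1]))
  | middle (l r : List ℕ) (a b : ℕ) :
      BlowUp (l ++ a :: b :: r) (l ++ (a + 1) :: 1 :: (b + 1) :: r)
  | last (a b : ℕ) (l : List ℕ) : BlowUp (a :: (l ++ [b])) ((a + 1) :: (l ++ [b + 1, 1]))

/-- The string `(a₁+2, 2, …, 2, …, aₙ+2, 2, …, 2)` in which `aᵢ+2` is followed by `bᵢ-1` twos. -/
def blockString (ab : List (ℤ × ℕ)) : List ℤ :=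
  ab.flatMap fun p => (p.1 + 2) :: List.replicate (p.2 - 1) 2

/-- The product `(xy)³ x^{a₁} y^{-b₁} ⋯ x^{aₙ} y^{-bₙ}`. -/
def blockWord {G : Type*} [Group G] (x y : G) (ab : List (ℤ × ℕ)) : G :=
  (x * y) ^ 3 * (ab.map fun p => x ^ p.1 * y ^ (-(p.2 : ℤ))).prod

/-- `h(c₁, …, c_N)`, computed from the presentation of `c` with `aᵢ = cᵢ - 2` and all `bᵢ = 1`. By
`hWord_blockString`, every presentation of `c` as a block string gives the same value. -/
def hWord {G : Type*} [Group G] (x y : G) (c : List ℤ) : G :=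
  blockWord x y (c.map fun k => (k - 2, 1))

theorem blockString_singletons (c : List ℤ) :
    blockString (c.map fun k => (k - 2, 1)) = c := by
  induction c with
  | nil => rfl
  | cons k c ih => simpa [blockString] using ih

theorem hWord_blockString {G : Type*} [Group G] (x y : G) (ab : List (ℤ × ℕ))
    (hb : ∀ p ∈ ab, 1 ≤ p.2) : hWord x y (blockString ab) = blockWord x y ab := by
  unfold hWord blockWord
  congr 1
  induction ab with
  | nil => rfl
  | cons p ab ih =>
    have ih' := ih fun q hq => hb q (List.mem_cons_of_mem _ hq)
    have hp : 1 ≤ p.2 := hb p List.mem_cons_self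
    have hs : blockString (p :: ab) =
        ((p.1 + 2) :: List.replicate (p.2 - 1) 2) ++ blockString ab := rfl
    rw [hs, List.map_append, List.map_append, List.prod_append, ih', List.map_cons (l := ab),
      List.prod_cons]
    congr 1
    obtain ⟨b, hb'⟩ : ∃ b, p.2 = b + 1 := ⟨p.2 - 1, by omega⟩
    rw [hb']
    simp [mul_assoc]
    group

end

/-! Algebra. All that is used about `x` and `y` is the braid relation `x * y * x = y * x * y` and
the fact that `DehnPlus T` contains every conjugate of `x`. By the braid relation `(x * y) ^ 3`
commutes with `x` and `y`, and h(0,0) = 1. An interior blowup does not change the word ∏ x^(cᵢ-2)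
y⁻¹, and a blowup at an end conjugates it by a word in `x` and `y`, which commutes with `(x * y) ^
3`. Hence h(s) = 1 for every `s` obtained by blowups (`hWord_blowUp`). Raising a letter by n ≥ 0
inserts xⁿ, so h(c) = h(c) h(s)⁻¹ is a product of conjugates of non-negative powers of `x`
(`tailWord_mono`, `hWord_mem`).

Geometry. A conjugate of a right-handed twist is the right-handed twist along the image curve
(`IsDehnTwistClass.conj_mem`). The braid relation says that x⁻¹yx = yxy⁻¹, where the left side
twists along the image of β under `x` and the right side along the image of α under `y⁻¹`. It
therefore suffices to join these images by an isotopy of annuli.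

Twists along a smooth family of embedded strips are isotopic (`stripDiffPlus_class_eq`), and the
class of a twist depends only on the germ of its strip along the core (`HasTwist.class_eq`,
`HasTwist.congr`). By compactness, a family of maps that is embedded along its core is embedded on a
thin strip (`CoreFamily.hasTwist`), so isotopies need to be controlled only along cores. This is
used first to put two annuli whose cores cross once into a normal form, in which they meet in one
square and differ there by a quarter turn (`exists_isPlumbing`).

The plumbing so obtained is the quotient by ℤ² of a neighbourhood of the integral grid lines in the
plane. Up there, both twisted cores are smoothed staircases invariant under (1, 1) that turn at the
same grid corners. With the sum of the two coordinates as parameter, linear interpolation of the sum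
and of the height is an isotopy between them (`isotopyMap`). It stays near the grid, and its core
remains embedded modulo ℤ²: the sum is strictly monotone, and over a unit of the sum the height
rises by strictly less than 1 and more than 0. This yields `IsPlumbing.braid`. -/

noncomputable section

open Set Filter Topology

/-! ## The algebra of the word `h` -/

section Algebra

variable {G : Type*} [Group G]

/-- The unnormalised word `x^{c₁-2} y⁻¹ ⋯ x^{c_N-2} y⁻¹`. -/
def tailWord (x y : G) (c : List ℤ) : G :=
  (c.map fun k => x ^ (k - 2) * y⁻¹).prod

theorem hWord_eq (x y : G) (c : List ℤ) : hWord x y c = (x * y) ^ 3 * tailWord x y c := by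
  simp [hWord, blockWord, tailWord, Function.comp_def]

theorem tailWord_append (x y : G) (l r : List ℤ) :
    tailWord x y (l ++ r) = tailWord x y l * tailWord x y r := by
  simp [tailWord]

theorem tailWord_cons (x y : G) (a : ℤ) (r : List ℤ) :
    tailWord x y (a :: r) = x ^ (a - 2) * y⁻¹ * tailWord x y r := by
  simp [tailWord]

theorem tailWord_nil (x y : G) : tailWord x y [] = 1 := rfl

variable {x y : G} (hb : x * y * x = y * x * y)
include hb

/-- With Δ = xyx = yxy one has (xy)³ = Δ², and conjugation by Δ exchanges `x` and `y`, so its square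
fixes both. -/
theorem garside_comm_left : (x * y) ^ 3 * x = x * (x * y) ^ 3 := by
  have e : (x * y) ^ 3 = (x * y * x) * (y * x * y) := by simp only [pow_succ, pow_zero, one_mul, mul_assoc]
  rw [e]
  calc (x * y * x) * (y * x * y) * x = x * y * x * y * (x * y * x) := by group
    _ = x * y * x * y * (y * x * y) := by rw [hb]
    _ = x * (y * x * y) * (y * x * y) := by group
    _ = x * (x * y * x) * (y * x * y) := by rw [hb]
    _ = _ := by group

theorem garside_comm_right : (x * y) ^ 3 * y = y * (x * y) ^ 3 := by
  calc (x * y) ^ 3 * y = x * y * x * y * (x * y) * y := by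
        simp only [pow_succ, pow_zero, one_mul, mul_assoc]
    _ = (x * y * x) * y * x * y * y := by group
    _ = (y * x * y) * y * x * y * y := by rw [hb]
    _ = y * x * y * (y * x * y) * y := by group
    _ = y * x * y * (x * y * x) * y := by rw [hb]
    _ = _ := by simp only [pow_succ, pow_zero, one_mul, mul_assoc]

/-- The letter 1 contributes x⁻¹ and creates y⁻¹x⁻¹y⁻¹ = x⁻¹y⁻¹x⁻¹, whose outer letters undo the
raising of the two neighbours. -/
theorem tailWord_middle (a b : ℤ) :
    tailWord x y [a + 1, 1, b + 1] = tailWord x y [a, b] := by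
  have h : y⁻¹ * x⁻¹ * y⁻¹ = x⁻¹ * y⁻¹ * x⁻¹ := by
    rw [← inv_inj]; simpa [mul_assoc] using hb.symm
  simp only [tailWord_cons, tailWord_nil]
  calc _ = x ^ (a - 1) * (y⁻¹ * x⁻¹ * y⁻¹) * x ^ (b - 1) * y⁻¹ := by
        rw [show a + 1 - 2 = a - 1 by ring, show b + 1 - 2 = b - 1 by ring,
          show (1 : ℤ) - 2 = -1 by ring, zpow_neg_one]
        group
    _ = _ := by
        rw [h]
        group

/-- Moving the last letter of a string to the front, after a blowup at the ends. -/
theorem tailWord_end_conj (a b : ℤ) (l : List ℤ) :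
    tailWord x y (1 :: (a + 1) :: (l ++ [b + 1])) =
      (x⁻¹ * y⁻¹ * x) * tailWord x y (a :: (l ++ [b])) * (x⁻¹ * y⁻¹ * x)⁻¹ := by
  have h : y * x * y⁻¹ = x⁻¹ * y * x := by
    rw [mul_inv_eq_iff_eq_mul, ← mul_right_inj x]
    simpa [mul_assoc] using hb
  -- In this form the right conjugator cancels the final y⁻¹ and raises the last exponent, while
  -- x⁻¹y⁻¹x on the left supplies the letter 1 and raises the first exponent.
  have e : (x⁻¹ * y⁻¹ * x)⁻¹ = y * x * y⁻¹ := by rw [h]; group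
  rw [e]
  simp only [tailWord_cons, tailWord_append, tailWord_nil]
  group

/-- The trailing y⁻¹x⁻¹y⁻¹ becomes x⁻¹y⁻¹x⁻¹: its first letter lowers the exponent before it, and
its last letter pairs with the extra `x` in front. -/
theorem tailWord_end_conj' (a b : ℤ) (l : List ℤ) :
    tailWord x y ((a + 1) :: (l ++ [b + 1, 1])) =
      x * tailWord x y (a :: (l ++ [b])) * x⁻¹ := by
  have h : y⁻¹ * x⁻¹ * y⁻¹ = x⁻¹ * y⁻¹ * x⁻¹ := by
    rw [← inv_inj]; simpa [mul_assoc] using hb.symm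
  simp only [tailWord_cons, tailWord_append, tailWord_nil]
  calc _ = x ^ (a - 1) * y⁻¹ * (tailWord x y l) * x ^ (b - 1) * (y⁻¹ * x⁻¹ * y⁻¹) := by
        rw [show a + 1 - 2 = a - 1 by ring, show b + 1 - 2 = b - 1 by ring,
          show (1 : ℤ) - 2 = -1 by ring, zpow_neg_one]
        group
    _ = _ := by
        rw [h]
        group

/-- The braid relation rewrites (xy)³ as y x² y x², the inverse of the unnormalised word of (0, 0).
-/
theorem hWord_zero_zero : hWord x y [0, 0] = 1 := by
  rw [hWord_eq]
  have e : tailWord x y [0, 0] = (y * x ^ 2 * y * x ^ 2)⁻¹ := by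
    simp only [tailWord_cons, tailWord_nil]
    group
  rw [e, mul_inv_eq_one]
  calc (x * y) ^ 3 = x * y * x * y * (x * y) := by
        simp only [pow_succ, pow_zero, one_mul, mul_assoc]
    _ = (x * y * x) * (y * x * y) := by group
    _ = (y * x * y) * (x * y * x) := by rw [hb]
    _ = y * x * (y * x * y) * x := by group
    _ = y * x * (x * y * x) * x := by rw [hb]
    _ = _ := by simp only [pow_succ, pow_zero, one_mul, mul_assoc]

omit hb in
theorem hWord_conj {u : G} {c c' : List ℤ} (hu : (x * y) ^ 3 * u = u * (x * y) ^ 3)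
    (h : tailWord x y c' = u * tailWord x y c * u⁻¹) (hc : hWord x y c = 1) :
    hWord x y c' = 1 := by
  rw [hWord_eq] at hc ⊢
  rw [h, ← mul_assoc, ← mul_assoc, hu, mul_assoc u, hc]
  group

theorem hWord_blowUp {s : List ℕ} (hs : Relation.ReflTransGen BlowUp [0, 0] s) :
    hWord x y (s.map fun k : ℕ => (k : ℤ)) = 1 := by
  have c1 : Commute ((x * y) ^ 3) x := garside_comm_left hb
  have c2 : Commute ((x * y) ^ 3) y := garside_comm_right hb
  induction hs with
  | refl => simpa using hWord_zero_zero hb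
  | tail _ h ih =>
    cases h with
    | first a b l =>
      refine hWord_conj (u := x⁻¹ * y⁻¹ * x) ?_ ?_ ih
      · exact ((c1.inv_right.mul_right c2.inv_right).mul_right c1).eq
      · simpa using tailWord_end_conj hb (a : ℤ) b (l.map fun k : ℕ => (k : ℤ))
    | middle l r a b =>
      rw [hWord_eq] at ih ⊢
      have := tailWord_middle hb (a : ℤ) b
      simp only [tailWord_cons, tailWord_nil, mul_one] at this
      rw [← ih]
      simp only [List.map_append, List.map_cons, tailWord_append, tailWord_cons, Nat.cast_add,
        Nat.cast_one]
      congr 2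
      simp only [← mul_assoc] at this ⊢
      rw [this]
    | last a b l =>
      refine hWord_conj (u := x) c1.eq ?_ ih
      simpa using tailWord_end_conj' hb (a : ℤ) b (l.map fun k : ℕ => (k : ℤ))

omit hb in
-- Raising a letter by n inserts xⁿ after the prefix `g` read so far, which multiplies the quotient
-- by g xⁿ g⁻¹. The statement is for all prefixes `g` because the induction on the string moves
-- letters into `g`.
theorem tailWord_mono {M : Submonoid G} (hM : ∀ g, g * x * g⁻¹ ∈ M)
    {s : List ℕ} {c : List ℤ}
    (hc : List.Forall₂ (fun (si : ℕ) (ci : ℤ) => (si : ℤ) ≤ ci) s c) :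
    ∀ g, g * tailWord x y c * (g * tailWord x y (s.map fun k : ℕ => (k : ℤ)))⁻¹ ∈ M := by
  induction hc with
  | nil => intro g; simp
  | @cons a b l r hab _ ih =>
    intro g
    obtain ⟨n, rfl⟩ := Int.le.dest hab
    have hn : g * x ^ n * g⁻¹ ∈ M := by
      rw [← conj_pow]
      exact M.pow_mem (hM g) n
    have := M.mul_mem hn (ih (g * (x ^ ((a : ℤ) - 2) * y⁻¹)))
    rw [List.map_cons, tailWord_cons, tailWord_cons]
    have e : x ^ ((a : ℤ) + n - 2) = x ^ n * x ^ ((a : ℤ) - 2) := by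
      rw [← zpow_natCast, ← zpow_add]; congr 1; ring
    convert this using 1
    rw [e]
    group

theorem hWord_mem {M : Submonoid G} (hM : ∀ g, g * x * g⁻¹ ∈ M) {s : List ℕ} {c : List ℤ}
    (hs : Relation.ReflTransGen BlowUp [0, 0] s)
    (hc : List.Forall₂ (fun (si : ℕ) (ci : ℤ) => (si : ℤ) ≤ ci) s c) : hWord x y c ∈ M := by
  have h1 := hWord_blowUp hb hs
  -- With the prefix (xy)³ the quotient is h(c) h(s)⁻¹.
  have h2 := tailWord_mono (y := y) hM hc ((x * y) ^ 3)
  rw [← hWord_eq, ← hWord_eq, h1] at h2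
  simpa using h2

end Algebra

/-! ## Orientation and conjugation of twists -/

section Orientation

variable {H H' H'' M N P : Type*} [TopologicalSpace H] [TopologicalSpace H'] [TopologicalSpace H'']
  [TopologicalSpace M] [ChartedSpace H M] [TopologicalSpace N] [ChartedSpace H' N]
  [TopologicalSpace P] [ChartedSpace H'' P]
  {I : ModelWithCorners ℝ Plane H} {J : ModelWithCorners ℝ Plane H'}
  {K : ModelWithCorners ℝ Plane H''}

variable (I J) in
/-- The determinant of the differential of a map between surfaces, in the preferred charts. -/
def orientDet (f : M → N) (p : M) : ℝ :=
  (show Plane →L[ℝ] Plane from mfderiv I J f p).det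

theorem orientDet_comp {f : M → N} {g : N → P} {p : M} (hg : MDifferentiableAt J K g (f p))
    (hf : MDifferentiableAt I J f p) :
    orientDet I K (g ∘ f) p = orientDet J K g (f p) * orientDet I J f p := by
  unfold orientDet
  rw [mfderiv_comp p hg hf]
  rw [ContinuousLinearMap.det, ContinuousLinearMap.det, ContinuousLinearMap.det,
    ← LinearMap.det_comp]
  rfl

theorem orientDet_congr {f g : M → N} {p : M} (h : f =ᶠ[𝓝 p] g) :
    orientDet I J f p = orientDet I J g p := by
  unfold orientDet
  rw [h.mfderiv_eq]

theorem orientDet_id (p : M) : orientDet I I (id : M → M) p = 1 := by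
  unfold orientDet
  rw [mfderiv_id]
  have : (ContinuousLinearMap.id ℝ Plane).det = 1 := by simp [ContinuousLinearMap.det]
  exact this

theorem orientDet_plane (k : Plane → Plane) (u : Plane) :
    orientDet 𝓘(ℝ, Plane) 𝓘(ℝ, Plane) k u = (fderiv ℝ k u).det := by
  unfold orientDet
  rw [mfderiv_eq_fderiv]

theorem orientationPreservingAt_iff {f : M → N} {p : M} :
    OrientationPreservingAt I J f p ↔ 0 < orientDet I J f p := Iff.rfl

theorem OrientationPreservingAt.comp {f : M → N} {g : N → P} {p : M}
    (hg' : OrientationPreservingAt J K g (f p)) (hf' : OrientationPreservingAt I J f p)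
    (hg : MDifferentiableAt J K g (f p)) (hf : MDifferentiableAt I J f p) :
    OrientationPreservingAt I K (g ∘ f) p := by
  rw [orientationPreservingAt_iff] at *
  rw [orientDet_comp hg hf]
  exact mul_pos hg' hf'

theorem OrientationPreservingAt.congr {f g : M → N} {p : M} (hf : OrientationPreservingAt I J f p)
    (h : f =ᶠ[𝓝 p] g) : OrientationPreservingAt I J g p := by
  rw [orientationPreservingAt_iff] at *
  rwa [← orientDet_congr h]

end Orientation

/-! ### Conjugates of right-handed twists. -/

section Conjugation

variable {T : Type*} [TopologicalSpace T] [ChartedSpace (EuclideanHalfSpace 2) T]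

theorem DiffPlus.apply_inj (h : DiffPlus T) {p q : T} :
    h.toDiffeo p = h.toDiffeo q ↔ p = q :=
  h.toDiffeo.injective.eq_iff

theorem DiffPlus.exists_apply_eq (h : DiffPlus T) (p : T) : ∃ q, h.toDiffeo q = p :=
  h.toDiffeo.surjective p

/-- An image point on the boundary would be fixed, hence equal to its preimage by injectivity. -/
theorem DiffPlus.map_interior (h : DiffPlus T) {p : T} (hp : p ∈ (𝓡∂ 2).interior T) :
    h.toDiffeo p ∈ (𝓡∂ 2).interior T := by
  by_contra hq
  have hq' : h.toDiffeo p ∈ (𝓡∂ 2).boundary T := by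
    rw [← ModelWithCorners.compl_interior]; exact hq
  have := h.fix_boundary _ hq'
  rw [h.toDiffeo.injective this] at hq
  exact hq hp

theorem DiffPlus.mdifferentiableAt (h : DiffPlus T) (p : T) :
    MDifferentiableAt (𝓡∂ 2) (𝓡∂ 2) h.toDiffeo p :=
  h.toDiffeo.mdifferentiable (by simp) p

/-- The image of a curve under a diffeomorphism. -/
def SimpleClosedCurve.map (α : SimpleClosedCurve T) (h : DiffPlus T) : SimpleClosedCurve T where
  toFun t := h.toDiffeo (α.toFun t)
  smooth := h.toDiffeo.contMDiff.comp α.smooth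
  eq_iff s t := by rw [h.apply_inj, α.eq_iff]
  immersed t := by
    intro h0
    have e := mfderiv_comp (I := 𝓘(ℝ, ℝ)) (I' := 𝓡∂ 2) (I'' := 𝓡∂ 2) t
      (h.mdifferentiableAt (α.toFun t)) ((α.smooth.mdifferentiable (by simp)) t)
    have e2 : mfderiv 𝓘(ℝ, ℝ) (𝓡∂ 2) (h.toDiffeo ∘ α.toFun) t = 0 := h0
    rw [e2] at e
    apply α.immersed t
    ext
    have inj : Function.Injective (mfderiv (𝓡∂ 2) (𝓡∂ 2) h.toDiffeo (α.toFun t)) := by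
      have := (h.toDiffeo.mfderivToContinuousLinearEquiv (by simp) (α.toFun t)).injective
      rwa [← Diffeomorph.mfderivToContinuousLinearEquiv_coe h.toDiffeo (by simp)]
    refine inj (Eq.trans ?_ (map_zero _).symm)
    exact (DFunLike.congr_fun e 1).symm

theorem IsAnnulus.map {φ : Plane → T} (hφ : IsAnnulus φ) (h : DiffPlus T) :
    IsAnnulus (fun u => h.toDiffeo (φ u)) where
  localDiffeo u := IsLocalDiffeomorphAt.comp (K := 𝓡∂ 2) (P := T) (hf := hφ.localDiffeo u)
    (hg := h.toDiffeo.isLocalDiffeomorph _)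
  orientation u := (h.orientation _).comp (hφ.orientation u) (h.mdifferentiableAt _)
    ((hφ.localDiffeo u).mdifferentiableAt (by simp))
  interior u := h.map_interior (hφ.interior u)
  eq_iff θ t θ' t' := by rw [h.apply_inj, hφ.eq_iff]

/-- Products are read from left to right, so `h⁻¹ * f * h` is `f` transported by `h`; in particular
it twists along the image of the curve under `h`. -/
theorem DiffPlus.conj_apply (f h : DiffPlus T) (p : T) :
    (h⁻¹ * f * h).toDiffeo (h.toDiffeo p) = h.toDiffeo (f.toDiffeo p) := by
  simp [DiffPlus.mul_apply, DiffPlus.inv_apply]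

theorem IsRightHandedDehnTwist.conj {f : DiffPlus T} {α : SimpleClosedCurve T}
    (hf : IsRightHandedDehnTwist f α) (h : DiffPlus T) :
    IsRightHandedDehnTwist (h⁻¹ * f * h) (α.map h) := by
  obtain ⟨φ, ρ, hφ, hα, hρ, h0, h1, hin, hout⟩ := hf
  refine ⟨_, ρ, hφ.map h, fun θ => congrArg h.toDiffeo (hα θ), hρ, h0, h1, fun θ t => ?_,
    fun p hp => ?_⟩
  · rw [DiffPlus.conj_apply, hin]
  · obtain ⟨q, rfl⟩ := h.exists_apply_eq p
    rw [DiffPlus.conj_apply, hout q]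
    rintro ⟨u, rfl⟩
    exact hp ⟨u, rfl⟩

theorem IsDehnTwistClass.conj_mem {x : MappingClassGroup T} {α : SimpleClosedCurve T}
    (hx : IsDehnTwistClass x α) (g : MappingClassGroup T) : g * x * g⁻¹ ∈ DehnPlus T := by
  obtain ⟨f, hf, rfl⟩ := hx
  obtain ⟨k, rfl⟩ := QuotientGroup.mk_surjective g
  -- Conjugation in the form `h⁻¹ * f * h` gives g x g⁻¹ for `h = k⁻¹`.
  refine Submonoid.subset_closure ⟨α.map k⁻¹, _, hf.conj k⁻¹, ?_⟩
  rw [inv_inv]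
  rfl

end Conjugation

/-! ## Families of embedded strips and the twists along them -/

theorem plane_eta (u : Plane) : !₂[u 0, u 1] = u := by
  ext i; fin_cases i <;> rfl

theorem continuous_vec2 {X : Type*} [TopologicalSpace X] {f g : X → ℝ} (hf : Continuous f)
    (hg : Continuous g) : Continuous fun x => (!₂[f x, g x] : Plane) := by
  fun_prop

theorem contDiffAt_vec2 {E : Type*} [NormedAddCommGroup E] [NormedSpace ℝ E] {n : WithTop ℕ∞}
    {f g : E → ℝ} {x : E} (hf : ContDiffAt ℝ n f x)
    (hg : ContDiffAt ℝ n g x) : ContDiffAt ℝ n (fun x => (!₂[f x, g x] : Plane)) x := by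
  rw [contDiffAt_piLp]
  intro i
  fin_cases i
  · exact hf
  · exact hg

theorem hasDerivAt_vec2 {f g : ℝ → ℝ} {f' g' x : ℝ} (hf : HasDerivAt f f' x)
    (hg : HasDerivAt g g' x) :
    HasDerivAt (fun h => (!₂[f h, g h] : Plane)) (!₂[f', g']) x := by
  rw [hasDerivAt_iff_hasFDerivAt, ← hasFDerivWithinAt_univ, hasFDerivWithinAt_piLp 2]
  intro i
  fin_cases i
  · exact hf.hasFDerivAt.hasFDerivWithinAt
  · exact hg.hasFDerivAt.hasFDerivWithinAt

theorem contDiffAt_coord {n : WithTop ℕ∞} (i : Fin 2) (u : Plane) :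
    ContDiffAt ℝ n (fun v : Plane => v i) u :=
  (EuclideanSpace.proj (𝕜 := ℝ) i).contDiff.contDiffAt

section StripTwist

variable {T : Type*} [TopologicalSpace T] [ChartedSpace (EuclideanHalfSpace 2) T]

/-- `Φ s`, for each real `s`, is an orientation-preserving embedding of the strip `|t| < r` modulo
`θ ↦ θ + 1` into the interior of `T`, and the family depends smoothly on `s`. -/
structure StripFamily (Φ : ℝ × Plane → T) (r : ℝ) : Prop where
  smooth : ∀ s (u : Plane), |u 1| < r → ContMDiffAt 𝓘(ℝ, ℝ × Plane) (𝓡∂ 2) ∞ Φ (s, u)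
  exists_section : ∀ s (u : Plane), |u 1| < r → ∃ Q : ℝ × T → Plane,
    ContMDiffAt (𝓘(ℝ, ℝ).prod (𝓡∂ 2)) 𝓘(ℝ, Plane) ∞ Q (s, Φ (s, u)) ∧ Q (s, Φ (s, u)) = u ∧
      ∀ᶠ z in 𝓝 (s, Φ (s, u)), Φ (z.1, Q z) = z.2
  orientation : ∀ s (u : Plane), |u 1| < r →
    OrientationPreservingAt 𝓘(ℝ, Plane) (𝓡∂ 2) (fun v => Φ (s, v)) u
  interior : ∀ s (u : Plane), |u 1| < r → Φ (s, u) ∈ (𝓡∂ 2).interior T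
  eq_iff : ∀ s (u v : Plane), |u 1| < r → |v 1| < r →
    (Φ (s, u) = Φ (s, v) ↔ u 1 = v 1 ∧ ∃ n : ℤ, u 0 = v 0 + n)

/-- `ρ` is a smooth family of functions that go from `0` to `n` across `[-ε, ε]`. -/
structure IsProfile (ρ : ℝ × ℝ → ℝ) (ε : ℝ) (n : ℤ) : Prop where
  smooth : ContDiff ℝ ∞ ρ
  left : ∀ s, ∀ t ≤ -ε, ρ (s, t) = 0
  right : ∀ s, ∀ t ≥ ε, ρ (s, t) = n

theorem IsProfile.neg {ρ : ℝ × ℝ → ℝ} {ε : ℝ} {n : ℤ} (h : IsProfile ρ ε n) :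
    IsProfile (-ρ) ε (-n) where
  smooth := h.smooth.neg
  left s t ht := by simp [h.left s t ht]
  right s t ht := by simp [h.right s t ht]

/-- The shear of the plane with profile `ρ`. -/
def shear (ρ : ℝ × ℝ → ℝ) (z : ℝ × Plane) : Plane := !₂[z.2 0 + ρ (z.1, z.2 1), z.2 1]

@[simp] theorem shear_zero (ρ : ℝ × ℝ → ℝ) (z : ℝ × Plane) :
    shear ρ z 0 = z.2 0 + ρ (z.1, z.2 1) := rfl

@[simp] theorem shear_one (ρ : ℝ × ℝ → ℝ) (z : ℝ × Plane) : shear ρ z 1 = z.2 1 := rfl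

theorem contDiff_shear {ρ : ℝ × ℝ → ℝ} (h : ContDiff ℝ ∞ ρ) : ContDiff ℝ ∞ (shear ρ) := by
  have h0 (i : Fin 2) : ContDiff ℝ ∞ fun z : ℝ × Plane => z.2 i :=
    (EuclideanSpace.proj (𝕜 := ℝ) i).contDiff.comp contDiff_snd
  rw [contDiff_iff_contDiffAt]
  exact fun z => contDiffAt_vec2
    ((h0 0).add (h.comp (contDiff_fst.prodMk (h0 1)))).contDiffAt (h0 1).contDiffAt

theorem shear_neg_shear (ρ : ℝ × ℝ → ℝ) (s : ℝ) (u : Plane) :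
    shear (-ρ) (s, shear ρ (s, u)) = u := by
  rw [← plane_eta u]
  simp [shear]

/-- A map of the plane with given partial derivatives. -/
theorem det_fderiv_plane {k : Plane → Plane} {u : Plane} (hk : DifferentiableAt ℝ k u)
    {a b : Plane} (ha : HasDerivAt (fun h => k !₂[h, u 1]) a (u 0))
    (hb : HasDerivAt (fun h => k !₂[u 0, h]) b (u 1)) :
    (fderiv ℝ k u).det = a 0 * b 1 - b 0 * a 1 := by
  have l0 : HasDerivAt (fun h : ℝ => (!₂[h, u 1] : Plane)) (!₂[1, 0]) (u 0) := 
    hasDerivAt_vec2 (hasDerivAt_id _) (hasDerivAt_const _ _)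
  have l1 : HasDerivAt (fun h : ℝ => (!₂[u 0, h] : Plane)) (!₂[0, 1]) (u 1) := 
    hasDerivAt_vec2 (hasDerivAt_const _ _) (hasDerivAt_id _)
  have hk' : HasFDerivAt k (fderiv ℝ k u) !₂[u 0, u 1] := by
    rw [plane_eta]; exact hk.hasFDerivAt
  have e0 := (hk'.comp_hasDerivAt (u 0) l0).unique ha
  have e1 := (hk'.comp_hasDerivAt (u 1) l1).unique hb
  rw [ContinuousLinearMap.det, ← LinearMap.det_toMatrix (EuclideanSpace.basisFun (Fin 2) ℝ).toBasis,
    Matrix.det_fin_two]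
  have b0 : (EuclideanSpace.basisFun (Fin 2) ℝ) 0 = !₂[1, 0] := by
    ext i; fin_cases i <;> simp
  have b1 : (EuclideanSpace.basisFun (Fin 2) ℝ) 1 = !₂[0, 1] := by
    ext i; fin_cases i <;> simp
  simp only [LinearMap.toMatrix_apply, OrthonormalBasis.coe_toBasis, b0, b1,
    ContinuousLinearMap.coe_coe, OrthonormalBasis.coe_toBasis_repr_apply,
    EuclideanSpace.basisFun_repr, e0, e1]

theorem det_fderiv_shear {ρ : ℝ × ℝ → ℝ} (h : ContDiff ℝ ∞ ρ) (s : ℝ) (u : Plane) :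
    (fderiv ℝ (fun v => shear ρ (s, v)) u).det = 1 := by
  have hd : DifferentiableAt ℝ (fun v => shear ρ (s, v)) u :=
    ((contDiff_shear h).comp (contDiff_const.prodMk contDiff_id)).differentiable (by simp) u
  have ha : HasDerivAt (fun h => shear ρ (s, !₂[h, u 1])) !₂[1, 0] (u 0) := 
    hasDerivAt_vec2 (f := fun h => h + ρ (s, u 1)) ((hasDerivAt_id _).add_const _)
      (hasDerivAt_const _ _)
  have hρ : DifferentiableAt ℝ (fun t => ρ (s, t)) (u 1) :=
    (h.comp (contDiff_const.prodMk contDiff_id)).differentiable (by simp) _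
  have hb : HasDerivAt (fun h => shear ρ (s, !₂[u 0, h]))
      !₂[deriv (fun t => ρ (s, t)) (u 1), 1] (u 1) := 
    hasDerivAt_vec2 (hρ.hasDerivAt.const_add _) (hasDerivAt_id _)
  rw [det_fderiv_plane hd ha hb]
  simp

open Classical in
/-- The family of twists along a family of strips: the shear with profile `ρ` in the strips, and
the identity elsewhere. -/
def stripTwist (Φ : ℝ × Plane → T) (r : ℝ) (ρ : ℝ × ℝ → ℝ) (z : ℝ × T) : T :=
  if h : ∃ u : Plane, |u 1| < r ∧ Φ (z.1, u) = z.2 then Φ (z.1, shear ρ (z.1, h.choose)) else z.2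

variable {Φ : ℝ × Plane → T} {r ε : ℝ} {ρ : ℝ × ℝ → ℝ} {n : ℤ}

/-- The chosen preimage is immaterial: two preimages differ by an integer in θ, and the shear
commutes with that translation. -/
theorem stripTwist_apply (hΦ : StripFamily Φ r) (ρ : ℝ × ℝ → ℝ) (s : ℝ) {u : Plane}
    (hu : |u 1| < r) : stripTwist Φ r ρ (s, Φ (s, u)) = Φ (s, shear ρ (s, u)) := by
  have h : ∃ v : Plane, |v 1| < r ∧ Φ (s, v) = Φ (s, u) := ⟨u, hu, rfl⟩
  obtain ⟨h1, h2⟩ := h.choose_spec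
  obtain ⟨h3, m, h4⟩ := (hΦ.eq_iff s _ _ h1 hu).1 h2
  rw [stripTwist, dif_pos h]
  refine (hΦ.eq_iff s (shear ρ (s, _)) (shear ρ (s, u)) h1 hu).2 ⟨h3, m, ?_⟩
  rw [shear_zero, shear_zero]
  simp only
  rw [h4, h3]
  ring

/-- Beyond height ε the profile is one of the integers 0 and `n`, so the shear is a translation that
`Φ` does not see. -/
theorem stripTwist_eq_self (hΦ : StripFamily Φ r) (hρ : IsProfile ρ ε n) (s : ℝ) {p : T}
    (hp : ∀ u : Plane, |u 1| ≤ ε → Φ (s, u) ≠ p) : stripTwist Φ r ρ (s, p) = p := by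
  by_cases h : ∃ u : Plane, |u 1| < r ∧ Φ (s, u) = p
  · obtain ⟨u, hu, rfl⟩ := h
    rw [stripTwist_apply hΦ ρ s hu]
    refine (hΦ.eq_iff s (shear ρ (s, u)) _ hu hu).2 ⟨rfl, ?_⟩
    have hε : ε < |u 1| := not_le.1 fun h => hp u h rfl
    rcases lt_abs.1 hε with h | h
    · exact ⟨n, by simp [hρ.right s _ h.le]⟩
    · exact ⟨0, by simp [hρ.left s (u 1) (by linarith)]⟩
  · rw [stripTwist, dif_neg h]

theorem stripTwist_neg_stripTwist (hΦ : StripFamily Φ r) (ρ : ℝ × ℝ → ℝ) (s : ℝ)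
    (p : T) : stripTwist Φ r (-ρ) (s, stripTwist Φ r ρ (s, p)) = p := by
  by_cases h : ∃ u : Plane, |u 1| < r ∧ Φ (s, u) = p
  · obtain ⟨u, hu, rfl⟩ := h
    rw [stripTwist_apply hΦ ρ s hu, stripTwist_apply hΦ _ s (by simpa using hu), shear_neg_shear]
  · rw [stripTwist, stripTwist, dif_neg h, dif_neg h]

theorem stripTwist_fix_boundary (hΦ : StripFamily Φ r) (ρ : ℝ × ℝ → ℝ) (s : ℝ)
    {p : T} (hp : p ∈ (𝓡∂ 2).boundary T) : stripTwist Φ r ρ (s, p) = p := by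
  rw [stripTwist, dif_neg]
  rintro ⟨u, hu, h⟩
  rw [← ModelWithCorners.compl_interior, ← show Φ (s, u) = p from h] at hp
  exact hp (hΦ.interior s u hu)

/-- Taking fractional parts confines θ to [0, 1], so the set is the projection, along a compact
factor, of a coincidence set that is closed because `T` is Hausdorff. -/
theorem StripFamily.isClosed_image [T2Space T] (hΦ : StripFamily Φ r) (hε : ε < r) :
    IsClosed {z : ℝ × T | ∃ u : Plane, |u 1| ≤ ε ∧ Φ (z.1, u) = z.2} := by
  have hc : Continuous fun q : (Icc (0 : ℝ) 1 × Icc (-ε) ε) × (ℝ × T) => Φ (q.2.1, !₂[(q.1.1 : ℝ), (q.1.2 : ℝ)]) := by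
    rw [continuous_iff_continuousAt]
    intro q
    have h1 : ContinuousAt Φ (q.2.1, !₂[(q.1.1 : ℝ), (q.1.2 : ℝ)]) :=
      (hΦ.smooth _ _ (lt_of_le_of_lt (show |(q.1.2 : ℝ)| ≤ ε from abs_le.2 q.1.2.2) hε)).continuousAt
    have h2 : Continuous fun q : (Icc (0 : ℝ) 1 × Icc (-ε) ε) × (ℝ × T) =>
        ((q.2.1, !₂[(q.1.1 : ℝ), (q.1.2 : ℝ)]) : ℝ × Plane) :=
      (by fun_prop : Continuous fun q : (Icc (0 : ℝ) 1 × Icc (-ε) ε) × (ℝ × T) => q.2.1).prodMk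
        (continuous_vec2 (by fun_prop) (by fun_prop))
    exact ContinuousAt.comp (f := fun q : (Icc (0 : ℝ) 1 × Icc (-ε) ε) × (ℝ × T) =>
        ((q.2.1, !₂[(q.1.1 : ℝ), (q.1.2 : ℝ)]) : ℝ × Plane)) h1 h2.continuousAt
  have hcl : IsClosed {q : (Icc (0 : ℝ) 1 × Icc (-ε) ε) × (ℝ × T) | Φ (q.2.1, !₂[(q.1.1 : ℝ), (q.1.2 : ℝ)]) = q.2.2} :=
    isClosed_eq hc (by fun_prop)
  have := isClosedMap_snd_of_compactSpace _ hcl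
  convert this using 1
  ext z
  constructor
  · rintro ⟨u, hu, he⟩
    refine ⟨((⟨Int.fract (u 0), Int.fract_nonneg _, (Int.fract_lt_one _).le⟩,
      ⟨u 1, abs_le.1 hu⟩), z), ?_, rfl⟩
    rw [mem_ofPred_eq, ← he]
    have hu' := lt_of_le_of_lt hu hε
    refine (hΦ.eq_iff _ _ _ (by simpa using hu') hu').2 ⟨by simp, -⌊u 0⌋, ?_⟩
    simp [Int.fract, sub_eq_add_neg]
  · rintro ⟨⟨q, z'⟩, he, rfl⟩
    exact ⟨_, by simpa using abs_le.2 q.2.2, he⟩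

/-- A point is either in the open strip, or has a neighbourhood that the twists fix. -/
theorem StripFamily.dichotomy [T2Space T] (hΦ : StripFamily Φ r) (hε : ε < r)
    (hρ : IsProfile ρ ε n) (z : ℝ × T) :
    (∃ u : Plane, |u 1| < r ∧ Φ (z.1, u) = z.2) ∨
      ∀ᶠ z' in 𝓝 z, stripTwist Φ r ρ z' = z'.2 := by
  by_cases h : ∃ u : Plane, |u 1| ≤ ε ∧ Φ (z.1, u) = z.2
  · obtain ⟨u, hu, h⟩ := h
    exact Or.inl ⟨u, hu.trans_lt hε, h⟩
  · refine Or.inr ?_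
    filter_upwards [(hΦ.isClosed_image hε).isOpen_compl.mem_nhds h] with z' hz'
    refine stripTwist_eq_self hΦ hρ z'.1 fun u hu he => hz' ⟨u, hu, he⟩

/-- Inside the strips the twist is locally section, then shear, then `Φ`; every other point has a
neighbourhood on which it is the identity. -/
theorem contMDiff_stripTwist [T2Space T] (hΦ : StripFamily Φ r) (hε : ε < r)
    (hρ : IsProfile ρ ε n) :
    ContMDiff (𝓘(ℝ, ℝ).prod (𝓡∂ 2)) (𝓡∂ 2) ∞ (stripTwist Φ r ρ) := by
  intro z
  rcases hΦ.dichotomy hε hρ z with ⟨u, hu, h⟩ | h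
  · obtain ⟨s, p⟩ := z
    simp only at h
    subst h
    obtain ⟨Q, hQ, hQu, hQe⟩ := hΦ.exists_section s u hu
    have e : stripTwist Φ r ρ =ᶠ[𝓝 (s, Φ (s, u))]
        Φ ∘ fun z => (z.1, shear ρ (z.1, Q z)) := by
      have hc : ContinuousAt (fun z => |Q z 1|) (s, Φ (s, u)) := by
        have := (EuclideanSpace.proj (𝕜 := ℝ) (1 : Fin 2)).continuous.continuousAt.comp
          hQ.continuousAt
        exact this.abs
      have hlt : ∀ᶠ z in 𝓝 (s, Φ (s, u)), |Q z 1| < r := by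
        refine hc.eventually_lt continuousAt_const ?_
        simpa [hQu] using hu
      filter_upwards [hQe, hlt] with z h1 h2
      have := stripTwist_apply hΦ ρ z.1 h2
      rwa [h1] at this
    refine ContMDiffAt.congr_of_eventuallyEq ?_ e
    have hst : ContMDiffAt (𝓘(ℝ, ℝ).prod (𝓡∂ 2)) 𝓘(ℝ, ℝ) ∞ (Prod.fst : ℝ × T → ℝ) (s, Φ (s, u)) :=
      contMDiffAt_fst
    have h1 : ContMDiffAt (𝓘(ℝ, ℝ).prod (𝓡∂ 2)) 𝓘(ℝ, Plane) ∞
        (shear ρ ∘ fun z : ℝ × T => (z.1, Q z)) (s, Φ (s, u)) :=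
      (contDiff_shear hρ.smooth).contMDiff.contMDiffAt.comp _ (hst.prodMk_space hQ)
    refine ContMDiffAt.comp _ ?_ (hst.prodMk_space h1)
    exact hΦ.smooth _ _ (by simpa [hQu] using hu)
  · exact contMDiffAt_snd.congr_of_eventuallyEq h

theorem contMDiff_slice {n : WithTop ℕ∞} (s : ℝ) :
    ContMDiff (𝓡∂ 2) (𝓘(ℝ, ℝ).prod (𝓡∂ 2)) n (fun p : T => (s, p)) :=
  contMDiff_const.prodMk contMDiff_id

/-- The twist along the strip with parameter `s`. -/
def stripDiffeo [T2Space T] (hΦ : StripFamily Φ r) (hε : ε < r) (hρ : IsProfile ρ ε n) (s : ℝ) :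
    T ≃ₘ⟮𝓡∂ 2, 𝓡∂ 2⟯ T where
  toFun p := stripTwist Φ r ρ (s, p)
  invFun p := stripTwist Φ r (-ρ) (s, p)
  left_inv p := stripTwist_neg_stripTwist hΦ ρ s p
  right_inv p := by simpa using stripTwist_neg_stripTwist hΦ (-ρ) s p
  contMDiff_toFun := (contMDiff_stripTwist hΦ hε hρ).comp (contMDiff_slice s)
  contMDiff_invFun := (contMDiff_stripTwist hΦ hε hρ.neg).comp (contMDiff_slice s)

/-- In the strip, twist ∘ Φ = Φ ∘ shear, where the shear has determinant 1 and `Φ` preserves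
orientation on both sides. -/
theorem stripTwist_orientation [T2Space T] (hΦ : StripFamily Φ r) (hε : ε < r)
    (hρ : IsProfile ρ ε n) (s : ℝ) (p : T) :
    OrientationPreservingAt (𝓡∂ 2) (𝓡∂ 2) (stripDiffeo hΦ hε hρ s) p := by
  rw [orientationPreservingAt_iff]
  rcases hΦ.dichotomy hε hρ (s, p) with ⟨u, hu, h⟩ | h
  · simp only at h
    subst h
    have hsm (v : Plane) (hv : |v 1| < r) :
        MDifferentiableAt 𝓘(ℝ, Plane) (𝓡∂ 2) (fun v => Φ (s, v)) v := by
      refine ContMDiffAt.mdifferentiableAt (n := ∞) ?_ (by simp)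
      exact ContMDiffAt.comp (I' := 𝓘(ℝ, ℝ × Plane)) v (hΦ.smooth s v hv)
        (contMDiffAt_const.prodMk_space contMDiffAt_id)
    have hsh : MDifferentiableAt 𝓘(ℝ, Plane) 𝓘(ℝ, Plane) (fun v => shear ρ (s, v)) u :=
      (((contDiff_shear hρ.smooth).comp (contDiff_const.prodMk contDiff_id)).differentiable
        (by simp) u).mdifferentiableAt
    have e : (stripDiffeo hΦ hε hρ s ∘ fun v => Φ (s, v)) =ᶠ[𝓝 u]
        ((fun v => Φ (s, v)) ∘ fun v => shear ρ (s, v)) := by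
      have : ∀ᶠ v : Plane in 𝓝 u, |v 1| < r :=
        ((EuclideanSpace.proj (𝕜 := ℝ) (1 : Fin 2)).continuous.abs.continuousAt).eventually_lt
          continuousAt_const hu
      filter_upwards [this] with v hv
      exact stripTwist_apply hΦ ρ s hv
    have h1 := orientDet_comp (I := 𝓘(ℝ, Plane)) (f := fun v => Φ (s, v))
      ((stripDiffeo hΦ hε hρ s).mdifferentiable (by simp) (Φ (s, u))) (hsm u hu)
    rw [orientDet_congr e, orientDet_comp (hsm _ (by simpa using hu)) hsh, orientDet_plane,
      det_fderiv_shear hρ.smooth, mul_one] at h1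
    have h2 := hΦ.orientation s (shear ρ (s, u)) (by simpa using hu)
    have h3 := hΦ.orientation s u hu
    rw [orientationPreservingAt_iff] at h2 h3
    rw [h1] at h2
    exact pos_of_mul_pos_left h2 h3.le
  · have e : (stripDiffeo hΦ hε hρ s : T → T) =ᶠ[𝓝 p] id := by
      have hc : ContinuousAt (fun q : T => (s, q)) p := by fun_prop
      exact hc.eventually h
    rw [orientDet_congr e, orientDet_id]
    exact one_pos

/-- The twist along the strip with parameter `s`, as an element of `Diff⁺(T, ∂T)`. -/
def stripDiffPlus [T2Space T] (hΦ : StripFamily Φ r) (hε : ε < r) (hρ : IsProfile ρ ε n) (s : ℝ) :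
    DiffPlus T where
  toDiffeo := stripDiffeo hΦ hε hρ s
  orientation := stripTwist_orientation hΦ hε hρ s
  fix_boundary _ hp := stripTwist_fix_boundary hΦ ρ s hp

theorem stripDiffPlus_apply [T2Space T] (hΦ : StripFamily Φ r) (hε : ε < r)
    (hρ : IsProfile ρ ε n) (s : ℝ) (p : T) :
    (stripDiffPlus hΦ hε hρ s).toDiffeo p = stripTwist Φ r ρ (s, p) := rfl

theorem stripDiffPlus_inv_apply [T2Space T] (hΦ : StripFamily Φ r) (hε : ε < r)
    (hρ : IsProfile ρ ε n) (s : ℝ) (p : T) :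
    (stripDiffPlus hΦ hε hρ s)⁻¹.toDiffeo p = stripTwist Φ r (-ρ) (s, p) := rfl

/-- The isotopy is the inverse of the twist at parameter 0 followed by the twist at parameter t;
inverses are again strip twists, with the opposite profile. -/
theorem stripDiffPlus_class_eq [T2Space T] (hΦ : StripFamily Φ r) (hε : ε < r)
    (hρ : IsProfile ρ ε n) :
    (stripDiffPlus hΦ hε hρ 0 : MappingClassGroup T) = stripDiffPlus hΦ hε hρ 1 := by
  rw [QuotientGroup.eq]
  have hsm := contMDiff_stripTwist hΦ hε hρ
  have hsm' := contMDiff_stripTwist hΦ hε hρ.neg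
  have hp0 : ContMDiff (𝓘(ℝ, ℝ).prod (𝓡∂ 2)) (𝓘(ℝ, ℝ).prod (𝓡∂ 2)) ∞
      (fun z : ℝ × T => ((0 : ℝ), z.2)) := contMDiff_const.prodMk contMDiff_snd
  refine ⟨fun z => stripTwist Φ r ρ (z.1, stripTwist Φ r (-ρ) (0, z.2)),
    fun z => stripTwist Φ r ρ (0, stripTwist Φ r (-ρ) z), ?_, ?_, ?_, ?_, ?_, ?_, ?_⟩
  · exact hsm.comp (contMDiff_fst.prodMk (hsm'.comp hp0))
  · exact hsm.comp (contMDiff_const.prodMk hsm')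
  · intro t p
    simp only
    rw [stripTwist_neg_stripTwist hΦ]
    simpa using stripTwist_neg_stripTwist hΦ (-ρ) 0 p
  · intro t p
    simp only
    rw [stripTwist_neg_stripTwist hΦ]
    simpa using stripTwist_neg_stripTwist hΦ (-ρ) t p
  · intro t p hp
    simp only
    rw [stripTwist_fix_boundary hΦ _ 0 hp, stripTwist_fix_boundary hΦ _ t hp]
  · intro p
    simpa using stripTwist_neg_stripTwist hΦ (-ρ) 0 p
  · intro p
    rw [DiffPlus.mul_apply, stripDiffPlus_apply, stripDiffPlus_inv_apply]

end StripTwist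

/-! ## Twists along a single strip -/

section SingleStrip

variable {T : Type*} [TopologicalSpace T] [ChartedSpace (EuclideanHalfSpace 2) T]

theorem eventually_abs_coord_lt {u : Plane} {r : ℝ} (hu : |u 1| < r) :
    ∀ᶠ v : Plane in 𝓝 u, |v 1| < r :=
  ((EuclideanSpace.proj (𝕜 := ℝ) (1 : Fin 2)).continuous.abs.continuousAt).eventually_lt
    continuousAt_const hu

/-- `φ` is an orientation-preserving embedding of the strip `|t| < r` modulo `θ ↦ θ + 1`. -/
def IsStrip (φ : Plane → T) (r : ℝ) : Prop := StripFamily (fun z => φ z.2) r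

theorem IsStrip.eq_iff {φ : Plane → T} {r : ℝ} (h : IsStrip φ r) {u v : Plane} (hu : |u 1| < r)
    (hv : |v 1| < r) : φ u = φ v ↔ u 1 = v 1 ∧ ∃ n : ℤ, u 0 = v 0 + n :=
  StripFamily.eq_iff h 0 u v hu hv

theorem IsStrip.interior {φ : Plane → T} {r : ℝ} (h : IsStrip φ r) {u : Plane} (hu : |u 1| < r) :
    φ u ∈ (𝓡∂ 2).interior T :=
  StripFamily.interior h 0 u hu

theorem IsStrip.orientation {φ : Plane → T} {r : ℝ} (h : IsStrip φ r) {u : Plane}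
    (hu : |u 1| < r) : OrientationPreservingAt 𝓘(ℝ, Plane) (𝓡∂ 2) φ u :=
  StripFamily.orientation h 0 u hu

theorem IsStrip.contMDiffAt {φ : Plane → T} {r : ℝ} (h : IsStrip φ r) {u : Plane}
    (hu : |u 1| < r) : ContMDiffAt 𝓘(ℝ, Plane) (𝓡∂ 2) ∞ φ u :=
  ContMDiffAt.comp (I' := 𝓘(ℝ, ℝ × Plane)) (f := fun v : Plane => ((0 : ℝ), v)) u
    (StripFamily.smooth h 0 u hu) (contMDiffAt_const.prodMk_space contMDiffAt_id)

theorem IsStrip.exists_section {φ : Plane → T} {r : ℝ} (h : IsStrip φ r) {u : Plane}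
    (hu : |u 1| < r) : ∃ Q : T → Plane, ContMDiffAt (𝓡∂ 2) 𝓘(ℝ, Plane) ∞ Q (φ u) ∧
      Q (φ u) = u ∧ ∀ᶠ q in 𝓝 (φ u), φ (Q q) = q := by
  obtain ⟨Q, h1, h2, h3⟩ := StripFamily.exists_section h 0 u hu
  refine ⟨fun q => Q (0, q), ContMDiffAt.comp (φ u) h1 (contMDiff_slice 0).contMDiffAt, h2, ?_⟩
  have hc : ContinuousAt (fun q : T => ((0 : ℝ), q)) (φ u) := by fun_prop
  exact hc.eventually h3

theorem isStrip_of {φ : Plane → T} {r : ℝ}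
    (smooth : ∀ u : Plane, |u 1| < r → ContMDiffAt 𝓘(ℝ, Plane) (𝓡∂ 2) ∞ φ u)
    (exists_section : ∀ u : Plane, |u 1| < r → ∃ Q : T → Plane,
      ContMDiffAt (𝓡∂ 2) 𝓘(ℝ, Plane) ∞ Q (φ u) ∧ Q (φ u) = u ∧ ∀ᶠ q in 𝓝 (φ u), φ (Q q) = q)
    (orientation : ∀ u : Plane, |u 1| < r → OrientationPreservingAt 𝓘(ℝ, Plane) (𝓡∂ 2) φ u)
    (interior : ∀ u : Plane, |u 1| < r → φ u ∈ (𝓡∂ 2).interior T)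
    (eq_iff : ∀ u v : Plane, |u 1| < r → |v 1| < r →
      (φ u = φ v ↔ u 1 = v 1 ∧ ∃ n : ℤ, u 0 = v 0 + n)) : IsStrip φ r where
  smooth s u hu := (smooth u hu).comp (I' := 𝓘(ℝ, Plane)) (s, u)
    (contDiff_snd (𝕜 := ℝ) (E := ℝ) (F := Plane)).contMDiff.contMDiffAt
  exists_section s u hu := by
    obtain ⟨Q, h1, h2, h3⟩ := exists_section u hu
    refine ⟨fun z => Q z.2, ContMDiffAt.comp (s, φ u) h1 contMDiffAt_snd, h2, ?_⟩
    exact (continuousAt_snd (p := (s, φ u))).eventually h3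
  orientation _ := orientation
  interior _ := interior
  eq_iff _ := eq_iff

theorem StripFamily.slice {Φ : ℝ × Plane → T} {r : ℝ} (h : StripFamily Φ r) (s : ℝ) :
    IsStrip (fun u => Φ (s, u)) r := by
  refine isStrip_of (fun u hu => ?_) (fun u hu => ?_) (h.orientation s) (h.interior s) (h.eq_iff s)
  · exact ContMDiffAt.comp (I' := 𝓘(ℝ, ℝ × Plane)) (f := fun v : Plane => (s, v)) u
      (h.smooth s u hu) (contMDiffAt_const.prodMk_space contMDiffAt_id)
  · obtain ⟨Q, h1, h2, h3⟩ := h.exists_section s u hu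
    refine ⟨fun q => Q (s, q), ContMDiffAt.comp _ h1 (contMDiff_slice s).contMDiffAt, h2, ?_⟩
    have hc : ContinuousAt (fun q : T => (s, q)) (Φ (s, u)) := by fun_prop
    exact hc.eventually h3

theorem IsStrip.mono {φ : Plane → T} {r r' : ℝ} (h : IsStrip φ r) (hr : r' ≤ r) :
    IsStrip φ r' :=
  isStrip_of (fun _ hu => h.contMDiffAt (hu.trans_le hr))
    (fun _ hu => h.exists_section (hu.trans_le hr))
    (fun _ hu => h.orientation (hu.trans_le hr)) (fun _ hu => h.interior (hu.trans_le hr))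
    (fun _ _ hu hv => h.eq_iff (hu.trans_le hr) (hv.trans_le hr))

theorem IsStrip.congr {φ φ' : Plane → T} {r : ℝ} (h : IsStrip φ r)
    (e : ∀ u : Plane, |u 1| < r → φ u = φ' u) : IsStrip φ' r := by
  have e' (u : Plane) (hu : |u 1| < r) : φ =ᶠ[𝓝 u] φ' := by
    filter_upwards [eventually_abs_coord_lt hu] with v hv using e v hv
  refine isStrip_of (fun u hu => ?_) (fun u hu => ?_) (fun u hu => ?_) (fun u hu => ?_)
    (fun u v hu hv => ?_)
  · exact (h.contMDiffAt hu).congr_of_eventuallyEq (e' u hu).symm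
  · obtain ⟨Q, h1, h2, h3⟩ := h.exists_section hu
    rw [← e u hu]
    refine ⟨Q, h1, h2, ?_⟩
    have hc : ∀ᶠ q in 𝓝 (φ u), φ (Q q) = φ' (Q q) := by
      have := h1.continuousAt.eventually (p := fun v => φ v = φ' v) (by rw [h2]; exact e' u hu)
      exact this
    filter_upwards [h3, hc] with q h4 h5
    rw [← h5, h4]
  · exact (h.orientation hu).congr (e' u hu)
  · rw [← e u hu]; exact h.interior hu
  · rw [← e u hu, ← e v hv]; exact h.eq_iff hu hv

theorem IsStrip.map {φ : Plane → T} {r : ℝ} (hφ : IsStrip φ r) (h : DiffPlus T) :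
    IsStrip (fun u => h.toDiffeo (φ u)) r := by
  refine isStrip_of (fun u hu => ?_) (fun u hu => ?_) (fun u hu => ?_) (fun u hu => ?_)
    (fun u v hu hv => ?_)
  · exact ContMDiffAt.comp (I' := 𝓡∂ 2) u h.toDiffeo.contMDiff.contMDiffAt (hφ.contMDiffAt hu)
  · obtain ⟨Q, h1, h2, h3⟩ := hφ.exists_section hu
    have e : h.toDiffeo.symm (h.toDiffeo (φ u)) = φ u := by simp
    refine ⟨fun q => Q (h.toDiffeo.symm q), ?_, ?_, ?_⟩
    · refine ContMDiffAt.comp (I' := 𝓡∂ 2) _ ?_ h.toDiffeo.symm.contMDiff.contMDiffAt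
      rwa [e]
    · exact (congrArg Q e).trans h2
    · have hc : ContinuousAt h.toDiffeo.symm (h.toDiffeo (φ u)) :=
        h.toDiffeo.symm.contMDiff.continuous.continuousAt
      have := hc.eventually (p := fun q => φ (Q q) = q) (by rwa [e])
      filter_upwards [this] with q hq
      rw [hq]; simp
  · exact (h.orientation _).comp (hφ.orientation hu) (h.mdifferentiableAt _)
      ((hφ.contMDiffAt hu).mdifferentiableAt (by simp))
  · exact h.map_interior (hφ.interior hu)
  · rw [h.apply_inj]; exact hφ.eq_iff hu hv

/-- `ρ` is a smooth function that goes from `0` to `1` across `[-ε, ε]`. -/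
structure IsStep (ρ : ℝ → ℝ) (ε : ℝ) : Prop where
  smooth : ContDiff ℝ ∞ ρ
  left : ∀ t ≤ -ε, ρ t = 0
  right : ∀ t ≥ ε, ρ t = 1

theorem IsStep.isProfile {ρ : ℝ → ℝ} {ε : ℝ} (h : IsStep ρ ε) :
    IsProfile (fun z => ρ z.2) ε 1 where
  smooth := h.smooth.comp contDiff_snd
  left _ := h.left
  right _ t ht := by simpa using h.right t ht

theorem IsStep.mono {ρ : ℝ → ℝ} {ε ε' : ℝ} (h : IsStep ρ ε) (hε : ε ≤ ε') : IsStep ρ ε' where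
  smooth := h.smooth
  left t ht := h.left t (by linarith)
  right t ht := h.right t (by linarith)

theorem isStep_smoothTransition {ε : ℝ} (hε : 0 < ε) :
    IsStep (fun t => Real.smoothTransition ((t + ε) / (2 * ε))) ε where
  smooth := Real.smoothTransition.contDiff.comp ((contDiff_id.add contDiff_const).div_const _)
  left t ht := Real.smoothTransition.zero_of_nonpos
    (div_nonpos_of_nonpos_of_nonneg (by linarith) (by linarith))
  right t ht := Real.smoothTransition.one_of_one_le (by rw [le_div_iff₀ (by linarith)]; linarith)

/-- `f` is the twist with profile `ρ` along the strip `φ`. -/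
structure IsStripTwist (φ : Plane → T) (r ε : ℝ) (ρ : ℝ → ℝ) (f : DiffPlus T) : Prop where
  lt : ε < r
  step : IsStep ρ ε
  apply : ∀ u : Plane, |u 1| < r → f.toDiffeo (φ u) = φ !₂[u 0 + ρ (u 1), u 1]
  eq_self : ∀ p, (∀ u : Plane, |u 1| < r → φ u ≠ p) → f.toDiffeo p = p

variable {φ : Plane → T} {r r' ε ε' : ℝ} {ρ ρ' : ℝ → ℝ} {f f' : DiffPlus T}

theorem IsStripTwist.unique (h : IsStripTwist φ r ε ρ f) (h' : IsStripTwist φ r ε' ρ f') :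
    f = f' := by
  refine DiffPlus.ext' fun p => ?_
  by_cases hp : ∃ u : Plane, |u 1| < r ∧ φ u = p
  · obtain ⟨u, hu, rfl⟩ := hp
    rw [h.apply u hu, h'.apply u hu]
  · push Not at hp
    rw [h.eq_self p hp, h'.eq_self p hp]

theorem IsStrip.apply_shear_of_le (hφ : IsStrip φ r) (hρ : IsStep ρ ε) {u : Plane}
    (hu : |u 1| < r) (hε : ε ≤ |u 1|) : φ !₂[u 0 + ρ (u 1), u 1] = φ u := by
  refine (hφ.eq_iff (by simpa using hu) hu).2 ⟨rfl, ?_⟩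
  rcases le_abs.1 hε with h | h
  · exact ⟨1, by simp [hρ.right _ h]⟩
  · exact ⟨0, by simp [hρ.left (u 1) (by linarith)]⟩

/-- The step ends inside the narrow strip, so on the rest of the wide strip the shear is by 0 or 1
and both sides are the identity. -/
theorem IsStripTwist.extend (hφ : IsStrip φ r) (h : IsStripTwist φ r' ε ρ f) (hr : r' ≤ r) :
    IsStripTwist φ r ε ρ f where
  lt := h.lt.trans_le hr
  step := h.step
  apply u hu := by
    by_cases hu' : |u 1| < r'
    · exact h.apply u hu'
    · push Not at hu'
      rw [hφ.apply_shear_of_le h.step hu (h.lt.le.trans hu')]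
      refine h.eq_self _ fun v hv e => ?_
      rw [((hφ.eq_iff (hv.trans_le hr) hu).1 e).1] at hv
      exact absurd hv (not_lt.2 hu')
  eq_self p hp := h.eq_self p fun u hu => hp u (hu.trans_le hr)

theorem IsStripTwist.congr {φ' : Plane → T} (h : IsStripTwist φ r ε ρ f)
    (e : ∀ u : Plane, |u 1| < r → φ u = φ' u) : IsStripTwist φ' r ε ρ f where
  lt := h.lt
  step := h.step
  apply u hu := by rw [← e u hu, h.apply u hu, e _ (by simpa using hu)]
  eq_self p hp := h.eq_self p fun u hu => e u hu ▸ hp u hu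

theorem IsStripTwist.conj (hf : IsStripTwist φ r ε ρ f) (h : DiffPlus T) :
    IsStripTwist (fun u => h.toDiffeo (φ u)) r ε ρ (h⁻¹ * f * h) where
  lt := hf.lt
  step := hf.step
  apply u hu := by rw [DiffPlus.conj_apply, hf.apply u hu]
  eq_self p hp := by
    obtain ⟨q, rfl⟩ := h.exists_apply_eq p
    rw [DiffPlus.conj_apply, hf.eq_self q]
    exact fun u hu e => hp u hu (congrArg _ e)

variable [T2Space T]

theorem isStripTwist_stripDiffPlus {Φ : ℝ × Plane → T} {ρ : ℝ × ℝ → ℝ} (hΦ : StripFamily Φ r)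
    (hε : ε < r) (hρ : IsProfile ρ ε 1) (s : ℝ) :
    IsStripTwist (fun u => Φ (s, u)) r ε (fun t => ρ (s, t)) (stripDiffPlus hΦ hε hρ s) where
  lt := hε
  step :=
    { smooth := hρ.smooth.comp (contDiff_const.prodMk contDiff_id)
      left := hρ.left s
      right t ht := by simpa using hρ.right s t ht }
  apply u hu := stripTwist_apply hΦ ρ s hu
  eq_self p hp := stripTwist_eq_self hΦ hρ s fun u hu => hp u (hu.trans_lt hε)

theorem IsStrip.exists_twist (hφ : IsStrip φ r) (hε : ε < r) (hρ : IsStep ρ ε) :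
    ∃ f, IsStripTwist φ r ε ρ f :=
  ⟨_, isStripTwist_stripDiffPlus hφ hε hρ.isProfile 0⟩

/-- The class of a twist does not depend on its profile. -/
theorem IsStripTwist.class_eq (hφ : IsStrip φ r) (h : IsStripTwist φ r ε ρ f)
    (h' : IsStripTwist φ r ε' ρ' f') : (f : MappingClassGroup T) = f' := by
  have hs := h.step.mono (le_max_left ε ε')
  have hs' := h'.step.mono (le_max_right ε ε')
  -- The affine combination of two steps equals 0 and 1 at the two ends for every real parameter, so
  -- it is a profile of the larger width.
  have hρ : IsProfile (fun z => (1 - z.1) * ρ z.2 + z.1 * ρ' z.2) (max ε ε') 1 :=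
    { smooth := ((contDiff_const.sub contDiff_fst).mul (hs.smooth.comp contDiff_snd)).add
        (contDiff_fst.mul (hs'.smooth.comp contDiff_snd))
      left s t ht := by simp [hs.left t ht, hs'.left t ht]
      right s t ht := by simp [hs.right t ht, hs'.right t ht] }
  have hε := max_lt h.lt h'.lt
  have h0 := isStripTwist_stripDiffPlus hφ hε hρ 0
  have h1 := isStripTwist_stripDiffPlus hφ hε hρ 1
  simp only [sub_zero, one_mul, zero_mul, add_zero, sub_self, zero_add] at h0 h1
  rw [h.unique h0, h'.unique h1]
  exact stripDiffPlus_class_eq hφ hε hρ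

/-- `z` is the class of the twists along the strip `φ`, which may be arbitrarily thin. -/
def HasTwist (φ : Plane → T) (z : MappingClassGroup T) : Prop :=
  ∃ r ε ρ f, 0 < r ∧ IsStrip φ r ∧ IsStripTwist φ r ε ρ f ∧ (f : MappingClassGroup T) = z

omit [T2Space T] in
theorem HasTwist.exists_strip {z : MappingClassGroup T} (h : HasTwist φ z) :
    ∃ r > 0, IsStrip φ r := by
  obtain ⟨r, _, _, _, hr, hφ, _⟩ := h
  exact ⟨r, hr, hφ⟩

/-- Both twists are compared with one supported in a strip thin enough to lie in both domains, which
extends to each of them. -/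
theorem HasTwist.class_eq {z : MappingClassGroup T} (h : HasTwist φ z) (hφ : IsStrip φ r)
    (hr : 0 < r) (hf : IsStripTwist φ r ε ρ f) : (f : MappingClassGroup T) = z := by
  obtain ⟨r₀, ε₀, ρ₀, f₀, hr₀, hφ₀, hf₀, rfl⟩ := h
  have hm : 0 < min r r₀ := lt_min hr hr₀
  obtain ⟨g, hg⟩ := (hφ.mono (min_le_left r r₀)).exists_twist (ε := min r r₀ / 2) (by linarith)
    (isStep_smoothTransition (by linarith))
  rw [hf.class_eq hφ (hg.extend hφ (min_le_left _ _)),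
    hf₀.class_eq hφ₀ (hg.extend hφ₀ (min_le_right _ _))]

theorem HasTwist.unique {z z' : MappingClassGroup T} (h : HasTwist φ z) (h' : HasTwist φ z') :
    z = z' := by
  obtain ⟨r, ε, ρ, f, hr, hφ, hf, rfl⟩ := h
  exact h'.class_eq hφ hr hf

/-- Only the germ of the parametrization along the core matters, since the twist can be supported in
an arbitrarily thin strip. -/
theorem HasTwist.congr {φ' : Plane → T} {z : MappingClassGroup T} (h : HasTwist φ z) (hr : 0 < r)
    (e : ∀ u : Plane, |u 1| < r → φ u = φ' u) : HasTwist φ' z := by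
  obtain ⟨r₀, hr₀, hφ⟩ := h.exists_strip
  have hm : 0 < min r r₀ := lt_min hr hr₀
  have hφ' := hφ.mono (min_le_right r r₀)
  obtain ⟨g, hg⟩ := hφ'.exists_twist (ε := min r r₀ / 2) (by linarith)
    (isStep_smoothTransition (by linarith))
  have e' : ∀ u : Plane, |u 1| < min r r₀ → φ u = φ' u :=
    fun u hu => e u (hu.trans_le (min_le_left _ _))
  exact ⟨_, _, _, g, hm, hφ'.congr e', hg.congr e', h.class_eq hφ' hm hg⟩

omit [T2Space T] in
theorem HasTwist.conj {z : MappingClassGroup T} (hz : HasTwist φ z) (h : DiffPlus T) :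
    HasTwist (fun u => h.toDiffeo (φ u))
      ((h : MappingClassGroup T)⁻¹ * z * (h : MappingClassGroup T)) := by
  obtain ⟨r, ε, ρ, f, hr, hφ, hf, rfl⟩ := hz
  exact ⟨r, ε, ρ, _, hr, hφ.map h, hf.conj h, rfl⟩

theorem HasTwist.of_family {Φ : ℝ × Plane → T} {z : MappingClassGroup T} (hΦ : StripFamily Φ r)
    (hr : 0 < r) (h : HasTwist (fun u => Φ (0, u)) z) : HasTwist (fun u => Φ (1, u)) z := by
  have hε : r / 2 < r := by linarith
  have hρ := (isStep_smoothTransition (ε := r / 2) (by linarith)).isProfile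
  refine ⟨r, _, _, _, hr, hΦ.slice 1, isStripTwist_stripDiffPlus hΦ hε hρ 1, ?_⟩
  rw [← stripDiffPlus_class_eq hΦ hε hρ]
  exact h.class_eq (hΦ.slice 0) hr (isStripTwist_stripDiffPlus hΦ hε hρ 0)

end SingleStrip

/-! ## Families of strips from families of maps of the plane -/

section Regular

variable {T : Type*} [TopologicalSpace T] [ChartedSpace (EuclideanHalfSpace 2) T]

/-- `Ψ` is, near `u`, an orientation-preserving diffeomorphism onto an open subset of the interior
of `T`. -/
structure RegularAt (Ψ : Plane → T) (u : Plane) : Prop where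
  smooth : ContMDiffAt 𝓘(ℝ, Plane) (𝓡∂ 2) ∞ Ψ u
  exists_section : ∃ Q : T → Plane, ContMDiffAt (𝓡∂ 2) 𝓘(ℝ, Plane) ∞ Q (Ψ u) ∧ Q (Ψ u) = u ∧
    ∀ᶠ q in 𝓝 (Ψ u), Ψ (Q q) = q
  injOn : ∃ U ∈ 𝓝 u, InjOn Ψ U
  orientation : OrientationPreservingAt 𝓘(ℝ, Plane) (𝓡∂ 2) Ψ u
  interior : Ψ u ∈ (𝓡∂ 2).interior T

theorem IsAnnulus.regularAt {φ : Plane → T} (h : IsAnnulus φ) (u : Plane) : RegularAt φ u where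
  smooth := (h.localDiffeo u).contMDiffAt
  exists_section := by
    refine ⟨(h.localDiffeo u).localInverse, (h.localDiffeo u).localInverse_contMDiffAt,
      (h.localDiffeo u).localInverse_left_inv (h.localDiffeo u).localInverse_mem_target, ?_⟩
    filter_upwards [(h.localDiffeo u).localInverse_open_source.mem_nhds
      (h.localDiffeo u).localInverse_mem_source] with q hq
    exact (h.localDiffeo u).localInverse_right_inv hq
  injOn := by
    obtain ⟨e, hu, he⟩ := h.localDiffeo u
    exact ⟨e.source, e.open_source.mem_nhds hu, he.injOn_iff.2 e.injOn⟩
  orientation := h.orientation u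
  interior := h.interior u

theorem IsStrip.regularAt {φ : Plane → T} {r : ℝ} (h : IsStrip φ r) {u : Plane}
    (hu : |u 1| < r) : RegularAt φ u where
  smooth := h.contMDiffAt hu
  exists_section := h.exists_section hu
  injOn := by
    -- Two points with θ within 1/2 of the same value differ in θ by less than 1, hence by the
    -- integer 0.
    refine ⟨{v | |v 1| < r} ∩ {v | |v 0 - u 0| < 1 / 2}, inter_mem (eventually_abs_coord_lt hu) ?_,
      fun v hv w hw e => ?_⟩
    · have : ContinuousAt (fun v : Plane => |v 0 - u 0|) u := by fun_prop
      exact this.eventually_lt continuousAt_const (by simp)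
    · obtain ⟨h1, n, h2⟩ := (h.eq_iff hv.1 hw.1).1 e
      have h3 := abs_lt.1 (show |v 0 - u 0| < 1 / 2 from hv.2)
      have h4 := abs_lt.1 (show |w 0 - u 0| < 1 / 2 from hw.2)
      have h5 : (-1 : ℝ) < n ∧ (n : ℝ) < 1 := ⟨by linarith, by linarith⟩
      have h6 : n = 0 := by
        have h7 : (-1 : ℤ) < n := by exact_mod_cast h5.1
        have h8 : n < (1 : ℤ) := by exact_mod_cast h5.2
        omega
      subst h6
      ext i
      fin_cases i
      · simpa using h2
      · exact h1
  orientation := h.orientation hu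
  interior := h.interior hu

theorem RegularAt.congr {Ψ Ψ' : Plane → T} {u : Plane} (h : RegularAt Ψ u) (e : Ψ =ᶠ[𝓝 u] Ψ') :
    RegularAt Ψ' u where
  smooth := h.smooth.congr_of_eventuallyEq e.symm
  exists_section := by
    obtain ⟨Q, h1, h2, h3⟩ := h.exists_section
    rw [← e.eq_of_nhds]
    refine ⟨Q, h1, h2, ?_⟩
    have hc : ∀ᶠ q in 𝓝 (Ψ u), Ψ (Q q) = Ψ' (Q q) :=
      h1.continuousAt.eventually (p := fun v => Ψ v = Ψ' v) (by rw [h2]; exact e)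
    filter_upwards [h3, hc] with q h4 h5
    rw [← h5, h4]
  injOn := by
    obtain ⟨U, hU, hi⟩ := h.injOn
    exact ⟨U ∩ {v | Ψ v = Ψ' v}, inter_mem hU e,
      (hi.mono inter_subset_left).congr fun v hv => hv.2⟩
  orientation := h.orientation.congr e
  interior := by rw [← e.eq_of_nhds]; exact h.interior

/-- Precomposition with an orientation-preserving affine isomorphism. -/
theorem RegularAt.comp_affine {Ψ : Plane → T} {u : Plane} (A : Plane ≃L[ℝ] Plane) (b : Plane)
    (hA : 0 < (A : Plane →L[ℝ] Plane).det) (h : RegularAt Ψ (A u + b)) :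
    RegularAt (fun v => Ψ (A v + b)) u where
  smooth := ContMDiffAt.comp (I' := 𝓘(ℝ, Plane)) (f := fun v => A v + b) u h.smooth
    (A.contDiff.add contDiff_const).contMDiff.contMDiffAt
  exists_section := by
    obtain ⟨Q, h1, h2, h3⟩ := h.exists_section
    refine ⟨fun q => A.symm (Q q - b), ?_, by simp [h2], by simpa using h3⟩
    exact ContMDiffAt.comp (I' := 𝓘(ℝ, Plane)) (g := fun w => A.symm (w - b)) _
      (A.symm.contDiff.comp (contDiff_id.sub contDiff_const)).contMDiff.contMDiffAt h1
  injOn := by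
    obtain ⟨U, hU, hi⟩ := h.injOn
    have hc : ContinuousAt (fun v => A v + b) u := by fun_prop
    refine ⟨_, hc hU, fun v hv w hw e => ?_⟩
    simpa using hi hv hw e
  orientation := by
    have hd : HasFDerivAt (fun v => A v + b) (A : Plane →L[ℝ] Plane) u :=
      A.hasFDerivAt.add_const b
    refine OrientationPreservingAt.comp (J := 𝓘(ℝ, Plane)) (f := fun v => A v + b) h.orientation ?_
      (h.smooth.mdifferentiableAt (by simp)) hd.differentiableAt.mdifferentiableAt
    rw [orientationPreservingAt_iff, orientDet_plane, hd.fderiv]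
    exact hA
  interior := h.interior

/-- Inverse function theorem for a family of maps of the plane. -/
theorem exists_family_inverse {K : ℝ × Plane → Plane} {s : ℝ} {u : Plane}
    (hK : ContDiffAt ℝ ∞ K (s, u)) (hdet : (fderiv ℝ (fun v => K (s, v)) u).det ≠ 0) :
    ∃ R : ℝ × Plane → Plane, ContDiffAt ℝ ∞ R (s, K (s, u)) ∧ R (s, K (s, u)) = u ∧
      (∀ᶠ w in 𝓝 (s, K (s, u)), K (w.1, R w) = w.2) ∧
      ∀ᶠ z in 𝓝 (s, u), R (z.1, K z) = z.2 := by
  let F : ℝ × Plane → ℝ × Plane := fun z => (z.1, K z)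
  have hF : ContDiffAt ℝ ∞ F (s, u) := contDiffAt_fst.prodMk hK
  have hd : HasFDerivAt K (fderiv ℝ K (s, u)) (s, u) :=
    (hK.differentiableAt (by simp)).hasFDerivAt
  have hslice : fderiv ℝ (fun v => K (s, v)) u =
      (fderiv ℝ K (s, u)).comp (ContinuousLinearMap.inr ℝ ℝ Plane) :=
    (hd.comp u (hasFDerivAt_prodMk_right s u)).fderiv
  -- The differential of `F` is block triangular, with the identity on the parameter and the
  -- differential of the slice on the plane, so it is invertible as soon as the slice is.
  let M : ℝ × Plane →L[ℝ] ℝ × Plane := (ContinuousLinearMap.fst ℝ ℝ Plane).prod (fderiv ℝ K (s, u))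
  have hM : Function.Injective M := by
    rw [injective_iff_map_eq_zero]
    rintro ⟨a, v⟩ h
    obtain ⟨h1, h2⟩ := Prod.ext_iff.1 h
    simp only [M, ContinuousLinearMap.prod_apply, ContinuousLinearMap.coe_fst', Prod.fst_zero,
      Prod.snd_zero] at h1 h2
    subst h1
    have h3 : fderiv ℝ (fun v => K (s, v)) u v = 0 := by rw [hslice]; exact h2
    have : v = 0 := (LinearMap.equivOfDetNeZero (fderiv ℝ (fun v => K (s, v)) u :
      Plane →ₗ[ℝ] Plane) hdet).injective (by simpa using h3)
    rw [this]; rfl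
  let e : (ℝ × Plane) ≃L[ℝ] (ℝ × Plane) :=
    (LinearEquiv.ofInjectiveEndo (M : (ℝ × Plane) →ₗ[ℝ] (ℝ × Plane)) hM).toContinuousLinearEquiv
  have he : HasFDerivAt F (e : (ℝ × Plane) →L[ℝ] ℝ × Plane) (s, u) := by
    have : (e : (ℝ × Plane) →L[ℝ] ℝ × Plane) = M := by ext <;> rfl
    rw [this]
    exact hasFDerivAt_fst.prodMk hd
  have hst := hF.hasStrictFDerivAt' he (by simp)
  have hR := hF.to_localInverse he (by simp)
  have hR0 := hF.localInverse_apply_image he (by simp)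
  refine ⟨fun w => (hF.localInverse he (by simp) w).2, contDiffAt_snd.comp _ hR, ?_, ?_, ?_⟩
  · exact congrArg Prod.snd hR0
  · filter_upwards [hst.eventually_right_inverse] with w hw
    have h1 := congrArg Prod.fst hw
    have h2 := congrArg Prod.snd hw
    simp only [F] at h1 h2
    rw [← h1]
    exact h2
  · filter_upwards [hst.eventually_left_inverse] with z hz
    exact congrArg Prod.snd hz

variable {Ψ : Plane → T} {K : ℝ × Plane → Plane}

/-- The smooth section comes from composing a local section of `Ψ` with the local inverse of the
family `K`. -/
theorem stripFamily_of_regular {r : ℝ}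
    (hΨ : ∀ s (u : Plane), |u 1| < r → RegularAt Ψ (K (s, u)))
    (hK : ∀ s (u : Plane), |u 1| < r → ContDiffAt ℝ ∞ K (s, u))
    (hdet : ∀ s (u : Plane), |u 1| < r → 0 < (fderiv ℝ (fun v => K (s, v)) u).det)
    (heq : ∀ s (u v : Plane), |u 1| < r → |v 1| < r →
      (Ψ (K (s, u)) = Ψ (K (s, v)) ↔ u 1 = v 1 ∧ ∃ n : ℤ, u 0 = v 0 + n)) :
    StripFamily (fun z => Ψ (K z)) r where
  smooth s u hu := ContMDiffAt.comp (I' := 𝓘(ℝ, Plane)) (s, u) (hΨ s u hu).smooth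
    (hK s u hu).contMDiffAt
  exists_section s u hu := by
    obtain ⟨Q, h1, h2, h3⟩ := (hΨ s u hu).exists_section
    obtain ⟨R, h4, h5, h6, -⟩ := exists_family_inverse (hK s u hu) (hdet s u hu).ne'
    have hQ : ContMDiffAt (𝓘(ℝ, ℝ).prod (𝓡∂ 2)) 𝓘(ℝ, ℝ × Plane) ∞
        (fun z : ℝ × T => (z.1, Q z.2)) (s, Ψ (K (s, u))) :=
      contMDiffAt_fst.prodMk_space (ContMDiffAt.comp (s, Ψ (K (s, u))) h1 contMDiffAt_snd)
    refine ⟨fun z => R (z.1, Q z.2), ?_, by simp [h2, h5], ?_⟩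
    · refine ContMDiffAt.comp (I' := 𝓘(ℝ, ℝ × Plane)) (f := fun z : ℝ × T => (z.1, Q z.2)) _ ?_ hQ
      change ContMDiffAt _ _ _ R (s, Q (Ψ (K (s, u))))
      rw [h2]
      exact h4.contMDiffAt
    · have h7 := hQ.continuousAt.eventually (p := fun w => K (w.1, R w) = w.2) (by simpa [h2] using h6)
      have h8 := (continuousAt_snd (p := (s, Ψ (K (s, u))))).eventually h3
      filter_upwards [h7, h8] with z h9 h10
      exact (congrArg Ψ h9).trans h10
  orientation s u hu := by
    have hd : DifferentiableAt ℝ (fun v => K (s, v)) u :=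
      ((hK s u hu).differentiableAt (by simp)).comp u
        ((differentiableAt_const s).prodMk differentiableAt_id)
    refine OrientationPreservingAt.comp (J := 𝓘(ℝ, Plane)) (f := fun v => K (s, v))
      (hΨ s u hu).orientation ?_ ((hΨ s u hu).smooth.mdifferentiableAt (by simp))
      hd.mdifferentiableAt
    rw [orientationPreservingAt_iff, orientDet_plane]
    exact hdet s u hu
  interior s u hu := (hΨ s u hu).interior
  eq_iff := heq

end Regular

/-! ## Isotopies of annuli that are embedded along their cores -/

section Isotopy

variable {T : Type*} [TopologicalSpace T] [ChartedSpace (EuclideanHalfSpace 2) T]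

/-- A family of maps to `T`, defined near the core `t = 0` of the strip, that is embedded along the
core. -/
structure CoreFamily (Ψ : Plane → T) (W : Set Plane) (K : ℝ × Plane → Plane) (v : Plane) (δ : ℝ) :
    Prop where
  isOpen : IsOpen W
  regular : ∀ w ∈ W, RegularAt Ψ w
  add_mem : ∀ w ∈ W, ∀ n : ℤ, w + (n : ℝ) • v ∈ W
  map_add : ∀ w ∈ W, ∀ n : ℤ, Ψ (w + (n : ℝ) • v) = Ψ w
  pos : 0 < δ
  smooth : ∀ s (u : Plane), |u 1| < δ → ContDiffAt ℝ ∞ K (s, u)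
  periodic : ∀ s (u : Plane) (n : ℤ), |u 1| < δ →
    K (s, u + (n : ℝ) • !₂[1, 0]) = K (s, u) + (n : ℝ) • v
  core_mem : ∀ s ∈ Icc (0 : ℝ) 1, ∀ θ : ℝ, K (s, !₂[θ, 0]) ∈ W
  core_det : ∀ s ∈ Icc (0 : ℝ) 1, ∀ θ : ℝ, 0 < (fderiv ℝ (fun w => K (s, w)) !₂[θ, 0]).det
  core_inj : ∀ s ∈ Icc (0 : ℝ) 1, ∀ θ θ' : ℝ, Ψ (K (s, !₂[θ, 0])) = Ψ (K (s, !₂[θ', 0])) →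
    ∃ n : ℤ, θ = θ' + n

variable {Ψ : Plane → T} {W : Set Plane} {K : ℝ × Plane → Plane} {v : Plane} {δ : ℝ}

theorem plane_add_smul (a b : ℝ) (x : ℝ) :
    (!₂[a, b] + x • !₂[1, 0] : Plane) = !₂[a + x, b] := by
  ext i
  fin_cases i <;> simp

/-! ### Uniform thickening of an embedded core. -/

namespace CoreFamily

variable (h : CoreFamily Ψ W K v δ)
include h

theorem fderiv_slice {s : ℝ} {u : Plane} (hu : |u 1| < δ) :
    fderiv ℝ (fun w => K (s, w)) u =
      (fderiv ℝ K (s, u)).comp (ContinuousLinearMap.inr ℝ ℝ Plane) :=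
  (((h.smooth s u hu).differentiableAt (by simp)).hasFDerivAt.comp u
    (hasFDerivAt_prodMk_right s u)).fderiv

theorem continuousAt_det {s : ℝ} {u : Plane} (hu : |u 1| < δ) :
    ContinuousAt (fun z : ℝ × Plane => (fderiv ℝ (fun w => K (z.1, w)) z.2).det) (s, u) := by
  have h1 : ContinuousAt (fderiv ℝ K) (s, u) :=
    ((h.smooth s u hu).fderiv_right (m := 0) (by simp)).continuousAt
  have h2 : ContinuousAt (fun z : ℝ × Plane =>
      ((fderiv ℝ K z).comp (ContinuousLinearMap.inr ℝ ℝ Plane)).det) (s, u) :=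
    ContinuousLinearMap.continuous_det.continuousAt.comp
      (h1.clm_comp continuousAt_const)
  refine h2.congr ?_
  have h3 : ∀ᶠ z : ℝ × Plane in 𝓝 (s, u), |z.2 1| < δ :=
    (continuousAt_snd (p := (s, u))).eventually (eventually_abs_coord_lt hu)
  filter_upwards [h3] with z hz
  rw [h.fderiv_slice hz]

theorem det_add {s : ℝ} {u : Plane} (hu : |u 1| < δ) (n : ℤ) :
    (fderiv ℝ (fun w => K (s, w)) (u + (n : ℝ) • !₂[1, 0])).det =
      (fderiv ℝ (fun w => K (s, w)) u).det := by
  rw [← fderiv_comp_add_right (f := fun w => K (s, w))]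
  have e : (fun w => K (s, w + (n : ℝ) • !₂[1, 0])) =ᶠ[𝓝 u] fun w => K (s, w) + (n : ℝ) • v := by
    filter_upwards [eventually_abs_coord_lt hu] with w hw using h.periodic s w n hw
  rw [e.fderiv_eq, fderiv_add_const]

/-- The inverse function theorem with parameter gives one inverse of `K` valid for all nearby
parameters, and `Ψ` is injective near the image point. -/
theorem eventually_injective {s θ : ℝ} (hs : s ∈ Icc (0 : ℝ) 1) :
    ∃ N ∈ 𝓝 (s, (!₂[θ, 0] : Plane)), ∀ s' u u', (s', u) ∈ N → (s', u') ∈ N →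
      Ψ (K (s', u)) = Ψ (K (s', u')) → u = u' := by
  have h0 : |(!₂[θ, 0] : Plane) 1| < δ := by simpa using h.pos
  obtain ⟨R, -, -, -, hR⟩ := exists_family_inverse (h.smooth s _ h0) (h.core_det s hs θ).ne'
  obtain ⟨U, hU, hi⟩ := (h.regular _ (h.core_mem s hs θ)).injOn
  refine ⟨_, inter_mem hR ((h.smooth s _ h0).continuousAt hU), fun s' u u' hu hu' e => ?_⟩
  have e' := hi hu.2 hu'.2 e
  have h1 : R (s', K (s', u)) = u := hu.1
  have h2 : R (s', K (s', u')) = u' := hu'.1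
  rw [← h1, ← h2, e']

theorem map_periodic {s : ℝ} {u : Plane} (hu : |u 1| < δ) (hm : K (s, u) ∈ W) (n : ℤ) :
    Ψ (K (s, u + (n : ℝ) • !₂[1, 0])) = Ψ (K (s, u)) := by
  rw [h.periodic s u n hu, h.map_add _ hm]

/-- If θ and θ' agree modulo 1, periodicity moves the second point next to the first and local
injectivity applies. Otherwise the two core points have distinct images, and these stay distinct
nearby in the Hausdorff space `T`. -/
theorem eventually_inj_at [T2Space T] {s θ θ' : ℝ} (hs : s ∈ Icc (0 : ℝ) 1) :
    ∀ᶠ z : (ℝ × ℝ) × (ℝ × ℝ × ℝ) in 𝓝 (((0 : ℝ), (0 : ℝ)), (s, θ, θ')),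
      Ψ (K (z.2.1, !₂[z.2.2.1, z.1.1])) = Ψ (K (z.2.1, !₂[z.2.2.2, z.1.2])) →
        z.1.1 = z.1.2 ∧ ∃ n : ℤ, z.2.2.1 = z.2.2.2 + n := by
  have h0 (θ : ℝ) : |(!₂[θ, 0] : Plane) 1| < δ := by simpa using h.pos
  have hc1 : ContinuousAt (fun z : (ℝ × ℝ) × (ℝ × ℝ × ℝ) =>
      (z.2.1, (!₂[z.2.2.1, z.1.1] : Plane))) (((0 : ℝ), (0 : ℝ)), (s, θ, θ')) := by fun_prop
  have hc2 (x : ℝ) : ContinuousAt (fun z : (ℝ × ℝ) × (ℝ × ℝ × ℝ) =>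
      (z.2.1, (!₂[z.2.2.2 + x, z.1.2] : Plane))) (((0 : ℝ), (0 : ℝ)), (s, θ, θ')) := by fun_prop
  have hc3 : ContinuousAt (fun z : (ℝ × ℝ) × (ℝ × ℝ × ℝ) =>
      (z.2.1, (!₂[z.2.2.2, z.1.2] : Plane))) (((0 : ℝ), (0 : ℝ)), (s, θ, θ')) := by fun_prop
  by_cases hn : ∃ n : ℤ, θ = θ' + n
  · obtain ⟨n, hn⟩ := hn
    obtain ⟨N, hN, hi⟩ := h.eventually_injective (θ := θ) hs
    have e1 := hc1.preimage_mem_nhds hN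
    have e2 := (hc2 n).preimage_mem_nhds (t := N) (by simp only; rwa [← hn])
    have e3 : ∀ᶠ z : (ℝ × ℝ) × (ℝ × ℝ × ℝ) in 𝓝 (((0 : ℝ), (0 : ℝ)), (s, θ, θ')),
        |z.1.2| < δ := by
      have : Continuous fun z : (ℝ × ℝ) × (ℝ × ℝ × ℝ) => |z.1.2| := by fun_prop
      exact this.continuousAt.eventually_lt continuousAt_const (by simpa using h.pos)
    have e4 : ∀ᶠ z : (ℝ × ℝ) × (ℝ × ℝ × ℝ) in 𝓝 (((0 : ℝ), (0 : ℝ)), (s, θ, θ')),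
        K (z.2.1, !₂[z.2.2.2, z.1.2]) ∈ W :=
      (ContinuousAt.comp (f := fun z : (ℝ × ℝ) × (ℝ × ℝ × ℝ) =>
          (z.2.1, (!₂[z.2.2.2, z.1.2] : Plane))) (g := K)
          (x := (((0 : ℝ), (0 : ℝ)), (s, θ, θ')))
          (h.smooth _ _ (h0 _)).continuousAt hc3) (h.isOpen.mem_nhds (h.core_mem s hs θ'))
    filter_upwards [e1, e2, e3, e4] with z h1 h2 h3 h4 e
    have hp := h.map_periodic (u := !₂[z.2.2.2, z.1.2]) h3 h4 n
    rw [plane_add_smul] at hp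
    have := hi _ _ _ h1 h2 (e.trans hp.symm)
    exact ⟨congrArg (fun w : Plane => w 1) this, n, congrArg (fun w : Plane => w 0) this⟩
  · have hne : Ψ (K (s, !₂[θ, 0])) ≠ Ψ (K (s, !₂[θ', 0])) := fun e => hn (h.core_inj s hs _ _ e)
    have hΨK (θ : ℝ) : ContinuousAt (fun z => Ψ (K z)) (s, !₂[θ, 0]) :=
      ContinuousAt.comp (f := K) (h.regular _ (h.core_mem s hs θ)).smooth.continuousAt
        (h.smooth s _ (h0 θ)).continuousAt
    have k1 := ContinuousAt.comp (g := fun z => Ψ (K z)) (f := fun z : (ℝ × ℝ) × (ℝ × ℝ × ℝ) =>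
      (z.2.1, (!₂[z.2.2.1, z.1.1] : Plane))) (x := (((0 : ℝ), (0 : ℝ)), (s, θ, θ'))) (hΨK θ) hc1
    have k2 := ContinuousAt.comp (g := fun z => Ψ (K z)) (f := fun z : (ℝ × ℝ) × (ℝ × ℝ × ℝ) =>
      (z.2.1, (!₂[z.2.2.2, z.1.2] : Plane))) (x := (((0 : ℝ), (0 : ℝ)), (s, θ, θ'))) (hΨK θ') hc3
    filter_upwards [Filter.Tendsto.eventually (k1.prodMk k2) (isOpen_ne_fun continuous_fst continuous_snd |>.mem_nhds hne)] with z hz e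
    exact absurd e hz

/-- The required properties hold near the core for parameters and angles in [0, 1]. Compactness
makes the thickness uniform, and periodicity extends it to all angles. -/
theorem exists_thin [T2Space T] : ∃ r > 0, r ≤ δ ∧ ∀ s ∈ Icc (0 : ℝ) 1,
    (∀ u : Plane, |u 1| < r → K (s, u) ∈ W ∧ 0 < (fderiv ℝ (fun w => K (s, w)) u).det) ∧
    ∀ u u' : Plane, |u 1| < r → |u' 1| < r → Ψ (K (s, u)) = Ψ (K (s, u')) →
      u 1 = u' 1 ∧ ∃ n : ℤ, u 0 = u' 0 + n := by
  have h0 (θ : ℝ) : |(!₂[θ, 0] : Plane) 1| < δ := by simpa using h.pos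
  have hC : IsCompact (Icc (0 : ℝ) 1 ×ˢ Icc (0 : ℝ) 1) := isCompact_Icc.prod isCompact_Icc
  have hC' : IsCompact (Icc (0 : ℝ) 1 ×ˢ Icc (0 : ℝ) 1 ×ˢ Icc (0 : ℝ) 1) :=
    isCompact_Icc.prod hC
  have A : ∀ᶠ t in 𝓝 (0 : ℝ), ∀ q ∈ Icc (0 : ℝ) 1 ×ˢ Icc (0 : ℝ) 1,
      K (q.1, !₂[q.2, t]) ∈ W ∧ 0 < (fderiv ℝ (fun w => K (q.1, w)) !₂[q.2, t]).det := by
    refine hC.eventually_forall_of_forall_eventually fun q hq => ?_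
    have hc : Continuous fun z : ℝ × (ℝ × ℝ) => (z.2.1, (!₂[z.2.2, z.1] : Plane)) := by fun_prop
    exact (hc.continuousAt (x := ((0 : ℝ), q))).eventually
      (p := fun z => K z ∈ W ∧ 0 < (fderiv ℝ (fun w => K (z.1, w)) z.2).det) <|
      Filter.Eventually.and ((h.smooth q.1 _ (h0 q.2)).continuousAt
        (h.isOpen.mem_nhds (h.core_mem _ hq.1 _)))
      (continuousAt_const.eventually_lt (h.continuousAt_det (h0 q.2)) (h.core_det _ hq.1 _))
  have B : ∀ᶠ t in 𝓝 ((0 : ℝ), (0 : ℝ)),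
      ∀ q ∈ Icc (0 : ℝ) 1 ×ˢ Icc (0 : ℝ) 1 ×ˢ Icc (0 : ℝ) 1,
      Ψ (K (q.1, !₂[q.2.1, t.1])) = Ψ (K (q.1, !₂[q.2.2, t.2])) →
        t.1 = t.2 ∧ ∃ n : ℤ, q.2.1 = q.2.2 + n :=
    hC'.eventually_forall_of_forall_eventually fun q hq => h.eventually_inj_at hq.1
  obtain ⟨r₁, hr₁, A⟩ := Metric.eventually_nhds_iff.1 A
  obtain ⟨r₂, hr₂, B⟩ := Metric.eventually_nhds_iff.1 B
  refine ⟨min δ (min r₁ r₂), lt_min h.pos (lt_min hr₁ hr₂), min_le_left _ _, fun s hs => ?_⟩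
  have hfr (u : Plane) : Int.fract (u 0) ∈ Icc (0 : ℝ) 1 :=
    ⟨Int.fract_nonneg _, (Int.fract_lt_one _).le⟩
  have hu' (u : Plane) : u = !₂[Int.fract (u 0), u 1] + ((⌊u 0⌋ : ℤ) : ℝ) • !₂[1, 0] := by
    rw [plane_add_smul, Int.fract_add_floor, plane_eta]
  have hA (u : Plane) (hu : |u 1| < min δ (min r₁ r₂)) := A (y := u 1)
    (by simpa using hu.trans_le ((min_le_right _ _).trans (min_le_left _ _)))
    (s, Int.fract (u 0)) ⟨hs, hfr u⟩
  have hm (u : Plane) (hu : |u 1| < min δ (min r₁ r₂)) :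
      Ψ (K (s, u)) = Ψ (K (s, !₂[Int.fract (u 0), u 1])) := by
    conv_lhs => rw [hu' u]
    exact h.map_periodic (u := !₂[Int.fract (u 0), u 1]) (hu.trans_le (min_le_left _ _))
      (hA u hu).1 _
  refine ⟨fun u hu => ?_, fun u u' hu hv e => ?_⟩
  · have h1 := hA u hu
    have h2 : |(!₂[Int.fract (u 0), u 1] : Plane) 1| < δ := hu.trans_le (min_le_left _ _)
    rw [hu' u, h.periodic s _ _ h2, h.det_add h2]
    exact ⟨h.add_mem _ h1.1 _, h1.2⟩
  · have hd : dist (u 1, u' 1) ((0 : ℝ), (0 : ℝ)) < r₂ := by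
      rw [Prod.dist_eq]
      simpa using ⟨hu.trans_le ((min_le_right _ _).trans (min_le_right _ _)),
        hv.trans_le ((min_le_right _ _).trans (min_le_right _ _))⟩
    rw [hm u hu, hm u' hv] at e
    obtain ⟨h1, n, h2⟩ := B hd (s, Int.fract (u 0), Int.fract (u' 0)) ⟨hs, hfr u, hfr u'⟩ e
    refine ⟨h1, n + ⌊u 0⌋ - ⌊u' 0⌋, ?_⟩
    have h3 := Int.fract_add_floor (u 0)
    have h4 := Int.fract_add_floor (u' 0)
    simp only at h2
    push_cast
    linarith

/-- An isotopy of annuli that are embedded along their cores carries twists to twists. -/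
theorem hasTwist [T2Space T] {z : MappingClassGroup T} (hz : HasTwist (fun u => Ψ (K (0, u))) z) :
    HasTwist (fun u => Ψ (K (1, u))) z := by
  obtain ⟨r, hr, hrδ, hthin⟩ := h.exists_thin
  have hσ (s : ℝ) : Real.smoothTransition s ∈ Icc (0 : ℝ) 1 :=
    ⟨Real.smoothTransition.nonneg s, Real.smoothTransition.le_one s⟩
  -- Reparametrizing by a smooth transition defines the family for all real `s` while the parameter
  -- of `K` never leaves [0, 1]; the ends 0 and 1 are kept.
  have hF : StripFamily (fun z : ℝ × Plane => Ψ (K (Real.smoothTransition z.1, z.2))) r := by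
    refine stripFamily_of_regular (Ψ := Ψ) (K := fun z => K (Real.smoothTransition z.1, z.2))
      (fun s u hu => ?_) (fun s u hu => ?_) (fun s u hu => ?_) (fun s u v hu hv => ⟨?_, ?_⟩)
    · exact h.regular _ ((hthin _ (hσ s)).1 u hu).1
    · exact (h.smooth (Real.smoothTransition s) u (hu.trans_le hrδ)).comp
        (f := fun z : ℝ × Plane => (Real.smoothTransition z.1, z.2)) (s, u)
        ((Real.smoothTransition.contDiff.comp contDiff_fst).prodMk contDiff_snd).contDiffAt
    · exact ((hthin _ (hσ s)).1 u hu).2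
    · exact (hthin _ (hσ s)).2 u v hu hv
    · rintro ⟨h1, n, h2⟩
      have e : u = v + (n : ℝ) • !₂[1, 0] := by
        rw [← plane_eta u, ← plane_eta v, plane_add_smul, h1, h2]
      simp only
      rw [e]
      exact h.map_periodic (hv.trans_le hrδ) ((hthin _ (hσ s)).1 v hv).1 n
  have := HasTwist.of_family (z := z) hF hr
  simp only [Real.smoothTransition.zero, Real.smoothTransition.one] at this
  exact this hz

end CoreFamily

end Isotopy

/-! ## Plumbing two annuli -/

theorem round_eq_of_abs_lt {θ : ℝ} {n : ℤ} (h : |θ - n| < 1 / 2) : round θ = n := by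
  rw [abs_lt] at h
  rw [round_eq, Int.floor_eq_iff]
  constructor <;> linarith

theorem eventually_round_eq {θ : ℝ} {n : ℤ} (h : |θ - n| < 1 / 2) : ∀ᶠ θ' in 𝓝 θ, round θ' = n := by
  have hc : ContinuousAt (fun θ' : ℝ => |θ' - n|) θ := by fun_prop
  filter_upwards [hc.eventually_lt continuousAt_const h] with θ' h' using round_eq_of_abs_lt h'

theorem round_add_int_sub (θ : ℝ) (n : ℤ) : θ + n - round (θ + n) = θ - round θ := by
  rw [round_add_intCast]
  push_cast
  ring

/-- The distance to the nearest integer stays large near a point where it is large. -/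
theorem eventually_lt_abs_sub_round {θ d : ℝ} (h : d < |θ - round θ|) :
    ∀ᶠ θ' : ℝ in 𝓝 θ, d < |θ' - round θ'| := by
  have hc : ContinuousAt (fun θ' : ℝ => |θ' - θ|) θ := by fun_prop
  have h0 : |θ - θ| < |θ - round θ| - d := by simpa using h
  filter_upwards [hc.eventually_lt continuousAt_const h0] with θ' h'
  have h1 := round_le θ (round θ')
  have h2 : |θ - round θ'| ≤ |θ' - θ| + |θ' - round θ'| := by
    have := abs_sub_le θ θ' (round θ')
    rwa [abs_sub_comm θ θ'] at this
  linarith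

section Plumbing

variable {T : Type*} [TopologicalSpace T] [ChartedSpace (EuclideanHalfSpace 2) T]

/-- A local diffeomorphism from the plane that is injective up to `θ ↦ θ + 1`. -/
structure IsCover (φ : Plane → T) : Prop where
  regular : ∀ u, RegularAt φ u
  eq_iff : ∀ u v, φ u = φ v ↔ u 1 = v 1 ∧ ∃ n : ℤ, u 0 = v 0 + n

/-- `κ` expresses `ψ` in the coordinates given by `φ`, near the origin. -/
structure IsTransition (φ ψ : Plane → T) (κ : Plane → Plane) : Prop where
  zero : κ 0 = 0
  eventually : ∀ᶠ u in 𝓝 (0 : Plane), ContDiffAt ℝ ∞ κ u ∧ φ (κ u) = ψ u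

/-- Two strips whose cores cross exactly once, and which meet in a square around the crossing. -/
structure IsPlumbing (φ ψ : Plane → T) (δ : ℝ) : Prop where
  pos : 0 < δ
  le_half : δ ≤ 1 / 2
  left : IsStrip φ δ
  right : IsStrip ψ δ
  agree : ∀ x y : ℝ, |x| < δ → |y| < δ → φ !₂[x, y] = ψ !₂[y, -x]
  disjoint : ∀ u v : Plane, |u 1| < δ → |v 1| < δ → φ u = ψ v →
    (∃ m : ℤ, u 0 = m - v 1) ∧ ∃ n : ℤ, v 0 = u 1 + n

variable {φ ψ : Plane → T} {κ : Plane → Plane}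

theorem IsCover.map_add (h : IsCover φ) (w : Plane) (n : ℤ) :
    φ (w + (n : ℝ) • !₂[1, 0]) = φ w := by
  rw [h.eq_iff]
  exact ⟨by simp, n, by simp⟩

/-- An isotopy that fixes the core pointwise is automatically injective there, and its determinant
along the core is the height component of the transverse derivative. -/
theorem IsCover.coreFamily (hφ : IsCover φ) {K : ℝ × Plane → Plane} {δ : ℝ} (pos : 0 < δ)
    (smooth : ∀ s (u : Plane), |u 1| < δ → ContDiffAt ℝ ∞ K (s, u))
    (periodic : ∀ s (u : Plane) (n : ℤ),
      K (s, u + (n : ℝ) • !₂[1, 0]) = K (s, u) + (n : ℝ) • !₂[1, 0])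
    (core : ∀ s θ : ℝ, K (s, !₂[θ, 0]) = !₂[θ, 0])
    (det : ∀ s ∈ Icc (0 : ℝ) 1, ∀ θ : ℝ, ∃ b : Plane,
      HasDerivAt (fun t => K (s, !₂[θ, t])) b 0 ∧ 0 < b 1) :
    CoreFamily φ univ K !₂[1, 0] δ where
  isOpen := isOpen_univ
  regular w _ := hφ.regular w
  add_mem _ _ _ := mem_univ _
  map_add w _ n := hφ.map_add w n
  pos := pos
  smooth := smooth
  periodic s u n _ := periodic s u n
  core_mem _ _ _ := mem_univ _
  core_det s hs θ := by
    obtain ⟨b, hb, hb1⟩ := det s hs θ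
    have hd : DifferentiableAt ℝ (fun w => K (s, w)) !₂[θ, 0] :=
      ((smooth s !₂[θ, 0] (by simpa using pos)).differentiableAt (by simp)).comp _
        ((differentiableAt_const s).prodMk differentiableAt_id)
    have ha : HasDerivAt (fun h => K (s, !₂[h, 0])) !₂[1, 0] θ := by
      simp only [core]
      exact hasDerivAt_vec2 (hasDerivAt_id _) (hasDerivAt_const _ _)
    rw [det_fderiv_plane (u := !₂[θ, 0]) hd ha hb]
    simpa using hb1
  core_inj s _ θ θ' e := by
    rw [core, core, hφ.eq_iff] at e
    exact e.2

theorem hasDerivAt_coord {c : ℝ → Plane} {c' : Plane} {t : ℝ} (h : HasDerivAt c c' t) (i : Fin 2) :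
    HasDerivAt (fun t => c t i) (c' i) t :=
  (EuclideanSpace.proj (𝕜 := ℝ) i).hasFDerivAt.comp_hasDerivAt t h

theorem vec2_zero : (!₂[(0 : ℝ), (0 : ℝ)] : Plane) = 0 := by ext i; fin_cases i <;> rfl

theorem eventually_box {p : Plane → Prop} (h : ∀ᶠ u in 𝓝 (0 : Plane), p u) :
    ∃ d > 0, ∀ x y : ℝ, |x| < d → |y| < d → p !₂[x, y] := by
  have hc : ContinuousAt (fun z : ℝ × ℝ => (!₂[z.1, z.2] : Plane)) ((0 : ℝ), (0 : ℝ)) := by fun_prop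
  have h' := hc.eventually (p := p) (by simp only; rwa [vec2_zero])
  obtain ⟨d, hd, H⟩ := Metric.eventually_nhds_iff.1 h'
  refine ⟨d, hd, fun x y hx hy => H (y := (x, y)) ?_⟩
  rw [Prod.dist_eq]
  simpa using ⟨hx, hy⟩

/-- The annulus `φ` can be changed so that its fibre through the origin lies on the core of `ψ`. -/
theorem exists_straightened [T2Space T] (hφ : IsCover φ) (hκ : IsTransition φ ψ κ) {b' : Plane}
    (hb : HasDerivAt (fun t => κ !₂[t, 0]) b' 0) (hb' : 0 < b' 1) {x : MappingClassGroup T}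
    (hx : HasTwist φ x) :
    HasTwist (fun u => φ !₂[u 0 + κ !₂[u 1, 0] 0, κ !₂[u 1, 0] 1]) x := by
  obtain ⟨d, hd, H⟩ := eventually_box hκ.eventually
  have h0 : κ !₂[0, 0] = 0 := by rw [vec2_zero, hκ.zero]
  -- Linear interpolation from the identity to the map that carries the fibre θ = 0 to the core of
  -- ψ; its transverse derivative has height component 1 - s + s b'₁, which is positive.
  let K : ℝ × Plane → Plane := fun z =>
    !₂[z.2 0 + z.1 * κ !₂[z.2 1, 0] 0, z.2 1 + z.1 * (κ !₂[z.2 1, 0] 1 - z.2 1)]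
  have hK : CoreFamily φ univ K !₂[1, 0] d := by
    refine hφ.coreFamily hd (fun s u hu => ?_) (fun s u n => ?_) (fun s θ => ?_) fun s hs θ => ?_
    · have hc (i : Fin 2) : ContDiffAt ℝ ∞ (fun z : ℝ × Plane => z.2 i) (s, u) :=
        (contDiffAt_coord i u).comp (s, u) contDiffAt_snd
      have hκ' : ContDiffAt ℝ ∞ (fun z : ℝ × Plane => κ !₂[z.2 1, 0]) (s, u) :=
        ContDiffAt.comp (f := fun z : ℝ × Plane => (!₂[z.2 1, 0] : Plane)) (s, u)
          (H (u 1) 0 hu (by simpa using hd)).1 (contDiffAt_vec2 (hc 1) contDiffAt_const)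
      have hκc (i : Fin 2) : ContDiffAt ℝ ∞ (fun z : ℝ × Plane => κ !₂[z.2 1, 0] i) (s, u) :=
        (contDiffAt_coord i _).comp (s, u) hκ'
      exact contDiffAt_vec2 ((hc 0).add (contDiffAt_fst.mul (hκc 0)))
        ((hc 1).add (contDiffAt_fst.mul ((hκc 1).sub (hc 1))))
    · ext i
      fin_cases i
      · simp [K]; ring
      · simp [K]
    · ext i
      fin_cases i <;> simp [K, h0]
    · refine ⟨!₂[0 + s * b' 0, 1 + s * (b' 1 - 1)], hasDerivAt_vec2
        ((hasDerivAt_const _ _).add ((hasDerivAt_coord hb 0).const_mul s))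
        ((hasDerivAt_id _).add (((hasDerivAt_coord hb 1).sub (hasDerivAt_id _)).const_mul s)), ?_⟩
      have h1 : 0 ≤ 1 - s := by linarith [hs.2]
      have h2 := mul_nonneg hs.1 hb'.le
      simp only [Matrix.cons_val_one, Matrix.cons_val_fin_one]
      rcases eq_or_lt_of_le hs.1 with h | h
      · rw [← h]; simp
      · nlinarith [mul_pos h hb']
  have := hK.hasTwist (z := x) (hx.congr one_pos fun u _ => by simp [K, plane_eta])
  refine this.congr one_pos fun u _ => ?_
  simp [K]

/-- An annulus can be changed near the point `θ = 0` of its core, to agree there with a given local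
diffeomorphism that has the same core. -/
theorem exists_modified [T2Space T] (hψ : IsCover ψ) {L₀ : Plane → Plane} {d : ℝ} (hd : 0 < d)
    (hd' : d ≤ 1 / 2)
    (hsm : ∀ θ t : ℝ, |θ| < d → |t| < d → ContDiffAt ℝ ∞ L₀ !₂[θ, t])
    (hcore : ∀ θ : ℝ, |θ| < d → L₀ !₂[θ, 0] = !₂[θ, 0])
    (hdet : ∀ θ : ℝ, |θ| < d → 0 < (fderiv ℝ L₀ !₂[θ, 0]).det)
    {y : MappingClassGroup T} (hy : HasTwist ψ y) :
    ∃ ψ' : Plane → T, HasTwist ψ' y ∧ (∀ θ : ℝ, ψ' !₂[θ, 0] = ψ !₂[θ, 0]) ∧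
      ∀ θ t : ℝ, |θ| < d / 3 → |t| < d → ψ' !₂[θ, t] = ψ (L₀ !₂[θ, t]) := by
  let χ : ContDiffBump (0 : ℝ) := ⟨d / 3, 2 * d / 3, by linarith, by linarith⟩
  have hχ1 {θ : ℝ} (h : |θ| < d / 3) : χ θ = 1 :=
    χ.one_of_mem_closedBall (by simpa using h.le)
  have hχ0 {θ : ℝ} (h : 2 * d / 3 ≤ |θ|) : χ θ = 0 :=
    χ.zero_of_le_dist (by simpa using h)
  let η : Plane → Plane := fun u => χ (u 0) • (L₀ u - u)
  -- Subtracting the nearest integer makes the modification periodic. The jumps of `round` do no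
  -- harm: the bump vanishes once the distance to the integers is at least 2d/3, which is less than
  -- 1/2.
  let K : ℝ × Plane → Plane := fun z => z.2 + z.1 • η !₂[z.2 0 - round (z.2 0), z.2 1]
  have hη0 (θ : ℝ) : η !₂[θ, 0] = 0 := by
    by_cases h : |θ| < d
    · simp [η, hcore θ h]
    · have : χ θ = 0 := hχ0 (by linarith [not_lt.1 h])
      simp [η, this]
  have hK : CoreFamily ψ univ K !₂[1, 0] d := by
    refine hψ.coreFamily hd (fun s u hu => ?_) (fun s u n => ?_) (fun s θ => ?_) fun s hs θ => ?_
    · have hper : ContDiffAt ℝ ∞ (fun u : Plane => η !₂[u 0 - round (u 0), u 1]) u := by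
        by_cases h : |u 0 - round (u 0)| < d
        · have e : (fun v : Plane => η !₂[v 0 - round (v 0), v 1]) =ᶠ[𝓝 u]
              fun v => η !₂[v 0 - round (u 0), v 1] := by
            filter_upwards [(contDiffAt_coord (n := 0) 0 u).continuousAt.eventually
              (eventually_round_eq (h.trans_le hd'))] with v hv
            rw [hv]
          refine ContDiffAt.congr_of_eventuallyEq ?_ e
          refine ContDiffAt.comp (g := η) (f := fun v : Plane => (!₂[v 0 - round (u 0), v 1] : Plane))
            u ?_ (contDiffAt_vec2 ((contDiffAt_coord 0 u).sub contDiffAt_const)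
              (contDiffAt_coord 1 u))
          exact (χ.contDiff.contDiffAt.comp _ (contDiffAt_coord 0 _)).smul
            ((hsm _ _ h hu).sub contDiffAt_id)
        · have h' : 2 * d / 3 < |u 0 - round (u 0)| := by linarith [not_lt.1 h]
          have e : (fun v : Plane => η !₂[v 0 - round (v 0), v 1]) =ᶠ[𝓝 u] fun _ => 0 := by
            filter_upwards [(contDiffAt_coord (n := 0) 0 u).continuousAt.eventually
              (eventually_lt_abs_sub_round h')] with v hv
            have : χ (v 0 - round (v 0)) = 0 := hχ0 hv.le
            simp [η, this]
          exact contDiffAt_const.congr_of_eventuallyEq e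
      exact contDiffAt_snd.add (contDiffAt_fst.smul (ContDiffAt.comp
        (g := fun u : Plane => η !₂[u 0 - round (u 0), u 1]) (s, u) hper contDiffAt_snd))
    · have e := round_add_int_sub (u 0) n
      simp only [K, PiLp.add_apply, PiLp.smul_apply, smul_eq_mul,
        Matrix.cons_val_zero, Matrix.cons_val_one, Matrix.cons_val_fin_one, mul_one, mul_zero,
        add_zero]
      rw [e]
      abel
    · simp [K, hη0]
    · set θ' := θ - round θ with hθ'
      by_cases h : |θ'| < d
      · have hL := ((hsm θ' 0 h (by simpa using hd)).differentiableAt (by simp)).hasFDerivAt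
        have l1 : HasDerivAt (fun t : ℝ => (!₂[θ', t] : Plane)) (!₂[0, 1]) 0 :=
          hasDerivAt_vec2 (hasDerivAt_const _ _) (hasDerivAt_id _)
        have hb := hL.comp_hasDerivAt (0 : ℝ) l1
        have ha : HasDerivAt (fun h => L₀ !₂[h, 0]) !₂[1, 0] θ' := by
          have e : (fun h => L₀ !₂[h, 0]) =ᶠ[𝓝 θ'] fun h => !₂[h, 0] := by
            filter_upwards [continuous_abs.continuousAt.eventually_lt continuousAt_const h]
              with t ht using hcore t ht
          exact (hasDerivAt_vec2 (hasDerivAt_id _) (hasDerivAt_const _ _)).congr_of_eventuallyEq e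
        have hpos := hdet θ' h
        rw [det_fderiv_plane (u := !₂[θ', 0]) hL.differentiableAt ha hb] at hpos
        set b := fderiv ℝ L₀ !₂[θ', 0] !₂[0, 1] with hbdef
        have l2 : HasDerivAt (fun t : ℝ => (!₂[θ, t] : Plane)) (!₂[0, 1]) 0 :=
          hasDerivAt_vec2 (hasDerivAt_const _ _) (hasDerivAt_id _)
        refine ⟨!₂[0, 1] + s • χ θ' • (b - !₂[0, 1]),
          l2.add (((hb.sub l1).const_smul (χ θ')).const_smul s), ?_⟩
        have hb1 : 0 < b 1 := by simpa using hpos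
        have h1 : 0 ≤ s * χ θ' := mul_nonneg hs.1 χ.nonneg
        have h2 : s * χ θ' ≤ 1 := mul_le_one₀ hs.2 χ.nonneg χ.le_one
        -- The height component is a convex combination of 1 and the positive number `b 1`.
        have : (!₂[0, 1] + s • χ θ' • (b - !₂[0, 1]) : Plane) 1 = 1 + s * χ θ' * (b 1 - 1) := by
          simp [mul_assoc]
        rw [this]
        rcases eq_or_lt_of_le h1 with h | h
        · rw [← h]; simp
        · nlinarith [mul_pos h hb1]
      · have hz : χ θ' = 0 := hχ0 (by linarith [not_lt.1 h])
        refine ⟨!₂[0, 1], ?_, by simp⟩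
        have e : (fun t => K (s, !₂[θ, t])) = fun t : ℝ => (!₂[θ, t] : Plane) := by
          funext t
          simp only [K, η, Matrix.cons_val_zero, Matrix.cons_val_one,
            Matrix.cons_val_fin_one, ← hθ', hz, zero_smul, smul_zero, add_zero]
        rw [e]
        exact hasDerivAt_vec2 (hasDerivAt_const _ _) (hasDerivAt_id _)
  refine ⟨fun u => ψ (K (1, u)), hK.hasTwist (hy.congr one_pos fun u _ => by simp [K]),
    fun θ => by simp [K, hη0], fun θ t hθ ht => ?_⟩
  have hr : round θ = 0 := round_eq_of_abs_lt (by simpa using hθ.trans_le (by linarith))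
  simp only [K, η, Matrix.cons_val_zero, Matrix.cons_val_one,
    Matrix.cons_val_fin_one, hr, Int.cast_zero, sub_zero, hχ1 hθ, one_smul]
  congr 1
  abel

end Plumbing

/-! ## Construction of the plumbing -/

/-- The rotation by a right angle. -/
def quarterTurn : Plane ≃L[ℝ] Plane :=
  LinearEquiv.toContinuousLinearEquiv
    { toFun := fun u => !₂[-u 1, u 0]
      map_add' := fun u v => by ext i; fin_cases i <;> simp [add_comm]
      map_smul' := fun c u => by ext i; fin_cases i <;> simp
      invFun := fun u => !₂[u 1, -u 0]
      left_inv := fun u => by ext i; fin_cases i <;> simp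
      right_inv := fun u => by ext i; fin_cases i <;> simp }

theorem quarterTurn_apply (u : Plane) : quarterTurn u = !₂[-u 1, u 0] := rfl

theorem quarterTurn_symm_apply (u : Plane) : quarterTurn.symm u = !₂[u 1, -u 0] := rfl

theorem det_of_fderiv {A : Plane →L[ℝ] Plane} : A.det = A !₂[1, 0] 0 * A !₂[0, 1] 1 -
    A !₂[0, 1] 0 * A !₂[1, 0] 1 := by
  have h := det_fderiv_plane (k := A) (u := !₂[0, 0]) A.differentiableAt
    (A.hasFDerivAt.comp_hasDerivAt (0 : ℝ)
      (hasDerivAt_vec2 (hasDerivAt_id (0 : ℝ)) (hasDerivAt_const (0 : ℝ) (0 : ℝ))))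
    (A.hasFDerivAt.comp_hasDerivAt (0 : ℝ)
      (hasDerivAt_vec2 (hasDerivAt_const (0 : ℝ) (0 : ℝ)) (hasDerivAt_id (0 : ℝ))))
  rwa [A.fderiv] at h

theorem det_quarterTurn : (quarterTurn : Plane →L[ℝ] Plane).det = 1 := by
  rw [det_of_fderiv]
  simp [quarterTurn_apply]

theorem det_quarterTurn_symm : (quarterTurn.symm : Plane →L[ℝ] Plane).det = 1 := by
  rw [det_of_fderiv]
  simp [quarterTurn_symm_apply]

section Plumbing

variable {T : Type*} [TopologicalSpace T] [ChartedSpace (EuclideanHalfSpace 2) T]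
  {φ ψ φ' ψ' : Plane → T} {κ κi : Plane → Plane}

/-- Both `κi (κ u)` and `u` are sent by ψ to the same point, and ψ is injective near the origin. -/
theorem IsTransition.comp_eq (hψ : IsCover ψ) (hκ : IsTransition φ ψ κ)
    (hκi : IsTransition ψ φ κi) : ∀ᶠ u in 𝓝 (0 : Plane), κi (κ u) = u := by
  obtain ⟨U, hU, hi⟩ := (hψ.regular 0).injOn
  have h1 : ContinuousAt κ 0 := hκ.eventually.self_of_nhds.1.continuousAt
  have h2 : ContinuousAt κi (κ 0) := by
    rw [hκ.zero]; exact hκi.eventually.self_of_nhds.1.continuousAt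
  have h3 : ∀ᶠ u in 𝓝 (0 : Plane), κi (κ u) ∈ U :=
    (ContinuousAt.comp h2 h1) (by simpa [hκ.zero, hκi.zero] using hU)
  have h4 := h1.eventually (p := fun u => ContDiffAt ℝ ∞ κi u ∧ ψ (κi u) = φ u) (by
    rw [hκ.zero]; exact hκi.eventually)
  filter_upwards [hU, h3, h4, hκ.eventually] with u h5 h6 h7 h8
  exact hi h6 h5 (h7.2.trans h8.2)

/-- Two expressions of one map into `T` through orientation-preserving strips have determinants of
the same sign. -/
theorem IsStrip.det_pos_of_comp {r r' : ℝ} (hφ : IsStrip φ r) (hψ : IsStrip ψ r')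
    {k l : Plane → Plane} {u : Plane} (hk : DifferentiableAt ℝ k u) (hl : DifferentiableAt ℝ l u)
    (hku : |k u 1| < r) (hlu : |l u 1| < r') (e : ∀ᶠ v in 𝓝 u, φ (k v) = ψ (l v))
    (hd : 0 < (fderiv ℝ k u).det) : 0 < (fderiv ℝ l u).det := by
  have h1 := orientDet_comp (I := 𝓘(ℝ, Plane)) (J := 𝓘(ℝ, Plane)) (f := k)
    ((hφ.contMDiffAt hku).mdifferentiableAt (by simp)) hk.mdifferentiableAt
  have h2 := orientDet_comp (I := 𝓘(ℝ, Plane)) (J := 𝓘(ℝ, Plane)) (f := l)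
    ((hψ.contMDiffAt hlu).mdifferentiableAt (by simp)) hl.mdifferentiableAt
  rw [orientDet_congr (f := φ ∘ k) (g := ψ ∘ l) e, h2, orientDet_plane, orientDet_plane] at h1
  have h3 := hφ.orientation hku
  have h4 := hψ.orientation hlu
  rw [orientationPreservingAt_iff] at h3 h4
  exact pos_of_mul_pos_right (h1 ▸ mul_pos h3 hd) h4.le

/-- Two annuli whose cores meet once and which agree near the crossing form a plumbing, after
shrinking. -/
theorem exists_isPlumbing_of_agree [T2Space T] {r r' d : ℝ} (hr : 0 < r) (hr' : 0 < r')
    (hd : 0 < d) (hφ : IsStrip φ r) (hψ : IsStrip ψ r')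
    (hagree : ∀ x y : ℝ, |x| < d → |y| < d → φ !₂[x, y] = ψ !₂[y, -x])
    (hmeet : ∀ θ θ' : ℝ, φ !₂[θ, 0] = ψ !₂[θ', 0] → ∃ m : ℤ, θ = m) :
    ∃ δ, IsPlumbing φ ψ δ := by
  have hC : IsCompact (Icc (0 : ℝ) 1 ×ˢ Icc (0 : ℝ) 1) := isCompact_Icc.prod isCompact_Icc
  have hm : 0 < min d r' := lt_min hd hr'
  -- Away from the crossing the compact cores are disjoint, so thin strips can meet only at angles
  -- of φ near an integer. The bound by `r'` is there because in the agreement square this angle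
  -- becomes, up to sign, a height of ψ.
  have A : ∀ᶠ t in 𝓝 ((0 : ℝ), (0 : ℝ)), ∀ q ∈ Icc (0 : ℝ) 1 ×ˢ Icc (0 : ℝ) 1,
      φ !₂[q.1, t.1] = ψ !₂[q.2, t.2] → ∃ m : ℤ, |q.1 - m| < min d r' := by
    refine hC.eventually_forall_of_forall_eventually fun q hq => ?_
    by_cases h : φ !₂[q.1, 0] = ψ !₂[q.2, 0]
    · obtain ⟨m, hm'⟩ := hmeet _ _ h
      have hc : ContinuousAt (fun z : (ℝ × ℝ) × (ℝ × ℝ) => |z.2.1 - m|)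
          (((0 : ℝ), (0 : ℝ)), q) := by fun_prop
      have hlt : |q.1 - m| < min d r' := by rw [hm', sub_self, abs_zero]; exact hm
      filter_upwards [hc.eventually_lt continuousAt_const hlt] with z hz _
      exact ⟨m, hz⟩
    · have c1 : ContinuousAt (fun z : (ℝ × ℝ) × (ℝ × ℝ) => (!₂[z.2.1, z.1.1] : Plane))
          (((0 : ℝ), (0 : ℝ)), q) := by fun_prop
      have c2 : ContinuousAt (fun z : (ℝ × ℝ) × (ℝ × ℝ) => (!₂[z.2.2, z.1.2] : Plane))
          (((0 : ℝ), (0 : ℝ)), q) := by fun_prop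
      have k1 := ContinuousAt.comp (g := φ) (f := fun z : (ℝ × ℝ) × (ℝ × ℝ) =>
        (!₂[z.2.1, z.1.1] : Plane)) (x := (((0 : ℝ), (0 : ℝ)), q))
        (hφ.contMDiffAt (u := !₂[q.1, 0]) (by simpa using hr)).continuousAt c1
      have k2 := ContinuousAt.comp (g := ψ) (f := fun z : (ℝ × ℝ) × (ℝ × ℝ) =>
        (!₂[z.2.2, z.1.2] : Plane)) (x := (((0 : ℝ), (0 : ℝ)), q))
        (hψ.contMDiffAt (u := !₂[q.2, 0]) (by simpa using hr')).continuousAt c2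
      filter_upwards [Filter.Tendsto.eventually (k1.prodMk k2)
        ((isOpen_ne_fun continuous_fst continuous_snd).mem_nhds h)] with z hz e
      exact absurd e hz
  obtain ⟨δ, hδ, A⟩ := Metric.eventually_nhds_iff.1 A
  have hpos : 0 < min (min (1 / 2) δ) (min d (min r r')) :=
    lt_min (lt_min (by norm_num) hδ) (lt_min hd (lt_min hr hr'))
  have h1 : min (min (1 / 2) δ) (min d (min r r')) ≤ d := (min_le_right _ _).trans (min_le_left _ _)
  have h2 : min (min (1 / 2) δ) (min d (min r r')) ≤ r :=
    (min_le_right _ _).trans ((min_le_right _ _).trans (min_le_left _ _))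
  have h3 : min (min (1 / 2) δ) (min d (min r r')) ≤ r' :=
    (min_le_right _ _).trans ((min_le_right _ _).trans (min_le_right _ _))
  have h4 : min (min (1 / 2) δ) (min d (min r r')) ≤ δ := (min_le_left _ _).trans (min_le_right _ _)
  have h5 : min (min (1 / 2) δ) (min d (min r r')) ≤ 1 / 2 :=
    (min_le_left _ _).trans (min_le_left _ _)
  generalize min (min (1 / 2) δ) (min d (min r r')) = ε at hpos h1 h2 h3 h4 h5
  have hfr (u : Plane) : Int.fract (u 0) ∈ Icc (0 : ℝ) 1 :=
    ⟨Int.fract_nonneg _, (Int.fract_lt_one _).le⟩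
  refine ⟨ε, hpos, h5, hφ.mono h2, hψ.mono h3,
    fun x y hx hy => hagree x y (hx.trans_le h1) (hy.trans_le h1), fun u v hu hv e => ?_⟩
  have eu : φ u = φ !₂[Int.fract (u 0), u 1] :=
    (hφ.eq_iff (hu.trans_le h2) (by simpa using hu.trans_le h2)).2
      ⟨rfl, ⌊u 0⌋, (Int.fract_add_floor (u 0)).symm⟩
  have ev : ψ v = ψ !₂[Int.fract (v 0), v 1] :=
    (hψ.eq_iff (hv.trans_le h3) (by simpa using hv.trans_le h3)).2
      ⟨rfl, ⌊v 0⌋, (Int.fract_add_floor (v 0)).symm⟩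
  have hdist : dist (u 1, v 1) ((0 : ℝ), (0 : ℝ)) < δ := by
    rw [Prod.dist_eq]
    simpa using ⟨hu.trans_le h4, hv.trans_le h4⟩
  obtain ⟨m, hm'⟩ := A hdist (Int.fract (u 0), Int.fract (v 0)) ⟨hfr u, hfr v⟩
    (eu.symm.trans (e.trans ev))
  simp only at hm'
  have em : φ u = φ !₂[Int.fract (u 0) - m, u 1] :=
    (hφ.eq_iff (hu.trans_le h2) (by simpa using hu.trans_le h2)).2
      ⟨rfl, ⌊u 0⌋ + m, by
        have := Int.fract_add_floor (u 0)
        push_cast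
        change u 0 = Int.fract (u 0) - m + (⌊u 0⌋ + m)
        linarith⟩
  -- After the integer shift the point lies in the agreement square, so the coincidence becomes one
  -- between two points of the strip ψ.
  rw [em, hagree _ _ (hm'.trans_le (min_le_left _ _)) (hu.trans_le h1), eq_comm] at e
  obtain ⟨e1, n, e2⟩ := (hψ.eq_iff (hv.trans_le h3)
    (by simpa [abs_sub_comm] using hm'.trans_le (min_le_right _ _))).1 e
  refine ⟨⟨⌊u 0⌋ + m, ?_⟩, n, e2⟩
  have := Int.fract_add_floor (u 0)
  simp only [Matrix.cons_val_one, Matrix.cons_val_fin_one] at e1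
  push_cast
  linarith

/-- First φ is straightened so that its fibre at the crossing runs along the core of ψ. Then ψ is
modified near the crossing to equal the new φ after a quarter turn, which already has the same core
there. -/
theorem exists_isPlumbing [T2Space T] (hφ : IsCover φ) (hψ : IsCover ψ)
    (hκ : IsTransition φ ψ κ) (hκi : IsTransition ψ φ κi) {b' : Plane}
    (hb : HasDerivAt (fun t => κ !₂[t, 0]) b' 0) (hb' : 0 < b' 1)
    (hmeet : ∀ θ θ' : ℝ, φ !₂[θ, 0] = ψ !₂[θ', 0] → ∃ m : ℤ, θ = m)
    {x y : MappingClassGroup T} (hx : HasTwist φ x) (hy : HasTwist ψ y) :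
    ∃ φ' ψ' δ, IsPlumbing φ' ψ' δ ∧ HasTwist φ' x ∧ HasTwist ψ' y := by
  have hx' := exists_straightened hφ hκ hb hb' hx
  let φ' : Plane → T := fun u => φ !₂[u 0 + κ !₂[u 1, 0] 0, κ !₂[u 1, 0] 1]
  obtain ⟨r, hr, hφ'⟩ := hx'.exists_strip
  obtain ⟨r', hr', hψr⟩ := hy.exists_strip
  -- Chosen so that φ ∘ c = φ' ∘ `quarterTurn`. Thus κi ∘ c writes the turned φ' in the coordinates
  -- of ψ, and it is the identity on the core because `c` agrees with κ there.
  let c : Plane → Plane := fun u => !₂[κ !₂[u 0, 0] 0 - u 1, κ !₂[u 0, 0] 1]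
  obtain ⟨d₀, hd₀, H₀⟩ := eventually_box hκ.eventually
  have hκ0 : κ !₂[0, 0] = 0 := by rw [vec2_zero, hκ.zero]
  have hc (u : Plane) (hu : |u 0| < d₀) : ContDiffAt ℝ ∞ c u := by
    have hκ' : ContDiffAt ℝ ∞ (fun u : Plane => κ !₂[u 0, 0]) u :=
      ContDiffAt.comp (g := κ) (f := fun u : Plane => (!₂[u 0, 0] : Plane)) u
        (H₀ (u 0) 0 hu (by simpa using hd₀)).1 (contDiffAt_vec2 (contDiffAt_coord 0 u)
          contDiffAt_const)
    exact contDiffAt_vec2 (((contDiffAt_coord 0 _).comp u hκ').sub (contDiffAt_coord 1 u))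
      ((contDiffAt_coord 1 _).comp u hκ')
  have hc0 : c 0 = 0 := by
    have : κ !₂[(0 : Plane) 0, 0] = 0 := hκ0
    simp only [c, this]
    ext i; fin_cases i <;> simp
  have hcc : ContinuousAt c 0 := (hc 0 (by simpa using hd₀)).continuousAt
  have hlt (ε : ℝ) (hε : 0 < ε) (i : Fin 2) : ∀ᶠ u : Plane in 𝓝 0, |u i| < ε :=
    (contDiffAt_coord (n := 0) i 0).continuousAt.abs.eventually_lt continuousAt_const
      (by simpa using hε)
  have E1 : ∀ᶠ u in 𝓝 (0 : Plane), ContDiffAt ℝ ∞ (κi ∘ c) u := by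
    have := hcc.eventually (by rw [hc0]; exact hκi.eventually)
    filter_upwards [this, hlt d₀ hd₀ 0] with u h1 h2 using h1.1.comp u (hc u h2)
  have E2 : ∀ᶠ u in 𝓝 (0 : Plane), ψ ((κi ∘ c) u) = φ' (quarterTurn u) := by
    have := hcc.eventually (by rw [hc0]; exact hκi.eventually)
    filter_upwards [this] with u h1
    rw [Function.comp_apply, h1.2]
    simp only [φ', c, quarterTurn_apply, Matrix.cons_val_zero, Matrix.cons_val_one,
      Matrix.cons_val_fin_one]
    rw [sub_eq_neg_add]
  obtain ⟨d₁, hd₁, H₁⟩ := eventually_box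
    ((((E1.and E2.eventually_nhds).and (hκ.comp_eq hψ hκi)).and (hlt r hr 0)).and
      (hlt r' hr' 1))
  have hd : 0 < min d₁ (1 / 2) := lt_min hd₁ (by norm_num)
  have hle : min d₁ (1 / 2) ≤ d₁ := min_le_left _ _
  have hcore (θ : ℝ) (hθ : |θ| < min d₁ (1 / 2)) : (κi ∘ c) !₂[θ, 0] = !₂[θ, 0] := by
    have := (H₁ θ 0 (hθ.trans_le hle) (by simpa using hd₁)).1.1.2
    have e : c !₂[θ, 0] = κ !₂[θ, 0] := by
      ext i; fin_cases i <;> simp [c]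
    rw [Function.comp_apply, e, this]
  obtain ⟨ψ', hy', hψ', hL⟩ := exists_modified (ψ := ψ) hψ (L₀ := κi ∘ c) hd (min_le_right _ _)
    (fun θ t hθ ht => (H₁ θ t (hθ.trans_le hle) (ht.trans_le hle)).1.1.1.1) hcore
    (fun θ hθ => by
      have h1 := H₁ θ 0 (hθ.trans_le hle) (by simpa using hd₁)
      refine IsStrip.det_pos_of_comp hφ' hψr (k := quarterTurn) quarterTurn.differentiableAt
        (h1.1.1.1.1.differentiableAt (by simp)) h1.1.2 ?_ ?_ ?_
      · rw [hcore θ hθ]; simpa using hr'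
      · filter_upwards [h1.1.1.1.2] with v hv using hv.symm
      · rw [ContinuousLinearEquiv.fderiv, det_quarterTurn]; exact one_pos) hy
  obtain ⟨r'', hr'', hψ''⟩ := hy'.exists_strip
  have hφ'0 (θ : ℝ) : φ' !₂[θ, 0] = φ !₂[θ, 0] := by
    simp [φ', hκ0]
  have hagree (x y : ℝ) (hx : |x| < min d₁ (1 / 2) / 3) (hy : |y| < min d₁ (1 / 2) / 3) :
      φ' !₂[x, y] = ψ' !₂[y, -x] := by
    have hx1 : |(-x)| < min d₁ (1 / 2) := by rw [abs_neg]; linarith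
    have hy1 : |y| < min d₁ (1 / 2) := by linarith
    rw [hL y (-x) hy hx1]
    have := (H₁ y (-x) (hy1.trans_le hle) (hx1.trans_le hle)).1.1.1.2.self_of_nhds
    rw [this]
    simp [quarterTurn_apply, φ']
  obtain ⟨δ, hδ⟩ := exists_isPlumbing_of_agree hr hr'' (by linarith) hφ' hψ'' hagree
    fun θ θ' e => hmeet θ θ' (by rw [← hφ'0, ← hψ']; exact e)
  exact ⟨φ', ψ', δ, hδ, hx', hy'⟩

end Plumbing

/-! ## Staircases -/

/-- The staircase function with steps of shape `ρ` at the integers. -/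
def stair (ρ : ℝ → ℝ) (θ : ℝ) : ℝ := round θ + ρ (θ - round θ)

section Stair

variable {ρ : ℝ → ℝ} {ε : ℝ}

/-- Between consecutive integers one step has reached 1 before the next one leaves 0, so the step
centred at `n` describes the staircase beyond the half-integers. -/
theorem stair_eq (hρ : IsStep ρ ε) (hε : ε ≤ 1 / 2) {θ : ℝ} {n : ℤ} (h : |θ - n| ≤ 1 - ε) :
    stair ρ θ = n + ρ (θ - n) := by
  have h1 := abs_le.1 (abs_sub_round θ)
  have h2 := abs_le.1 h
  have hr : round θ = n ∨ round θ = n + 1 ∧ θ - n ≥ 1 / 2 ∨ round θ = n - 1 ∧ θ - n ≤ -1 / 2 := by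
    rcases lt_trichotomy (round θ) n with h3 | h3 | h3
    · have h4 : (round θ : ℝ) ≤ n - 1 := by exact_mod_cast Int.le_sub_one_of_lt h3
      -- A step of non-positive width is impossible, as it would take both values 0 and 1 at 0.
      have h5 : (n : ℝ) - 2 < round θ ∨ ε ≤ 0 := by
        by_cases h0 : ε ≤ 0
        · exact Or.inr h0
        · left; linarith [not_le.1 h0]
      rcases h5 with h5 | h5
      · have h6 : n - 2 < round θ := by exact_mod_cast h5
        exact Or.inr (Or.inr ⟨by omega, by linarith⟩)
      · exact absurd (hρ.left 0 (by linarith)) (by rw [hρ.right 0 (by linarith)]; norm_num)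
    · exact Or.inl h3
    · have h4 : (n : ℝ) + 1 ≤ round θ := by exact_mod_cast h3
      have h5 : (round θ : ℝ) < n + 2 ∨ ε ≤ 0 := by
        by_cases h0 : ε ≤ 0
        · exact Or.inr h0
        · left; linarith [not_le.1 h0]
      rcases h5 with h5 | h5
      · have h6 : round θ < n + 2 := by exact_mod_cast h5
        exact Or.inr (Or.inl ⟨by omega, by linarith⟩)
      · exact absurd (hρ.left 0 (by linarith)) (by rw [hρ.right 0 (by linarith)]; norm_num)
  unfold stair
  rcases hr with h3 | ⟨h3, h4⟩ | ⟨h3, h4⟩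
  · rw [h3]
  · rw [h3, hρ.right (θ - n) (by linarith), hρ.left _ (by push_cast; linarith)]
    push_cast; ring
  · rw [h3, hρ.left (θ - n) (by linarith), hρ.right _ (by push_cast; linarith)]
    push_cast; ring

theorem stair_add_int (ρ : ℝ → ℝ) (θ : ℝ) (n : ℤ) : stair ρ (θ + n) = stair ρ θ + n := by
  unfold stair
  rw [round_add_int_sub, round_add_intCast]
  push_cast
  ring

theorem stair_eventuallyEq (hρ : IsStep ρ ε) (hε : ε < 1 / 2) (θ : ℝ) :
    stair ρ =ᶠ[𝓝 θ] fun t => round θ + ρ (t - round θ) := by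
  have hc : ContinuousAt (fun t : ℝ => |t - round θ|) θ := by fun_prop
  filter_upwards [hc.eventually_lt continuousAt_const
    (show |θ - round θ| < 1 - ε by linarith [abs_sub_round θ])] with t ht
  exact stair_eq hρ hε.le ht.le

theorem contDiff_stair (hρ : IsStep ρ ε) (hε : ε < 1 / 2) : ContDiff ℝ ∞ (stair ρ) := by
  rw [contDiff_iff_contDiffAt]
  intro θ
  refine ContDiffAt.congr_of_eventuallyEq ?_ (stair_eventuallyEq hρ hε θ)
  exact (contDiff_const.add (hρ.smooth.comp (contDiff_id.sub contDiff_const))).contDiffAt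

theorem deriv_stair_nonneg (hρ : IsStep ρ ε) (hε : ε < 1 / 2) (hm : Monotone ρ) (θ : ℝ) :
    0 ≤ deriv (stair ρ) θ := by
  rw [(stair_eventuallyEq hρ hε θ).deriv_eq]
  refine Monotone.deriv_nonneg fun a b hab => ?_
  have := hm (sub_le_sub_right hab (round θ : ℝ))
  linarith

end Stair

/-- A monotone staircase `σ` of width `ε`, and the inverse `ξ` of `θ ↦ θ + σ θ`. -/
structure IsStaircase (σ ξ : ℝ → ℝ) (ε : ℝ) : Prop where
  smooth : ContDiff ℝ ∞ σ
  add_int : ∀ (θ : ℝ) (n : ℤ), σ (θ + n) = σ θ + n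
  deriv_nonneg : ∀ θ, 0 ≤ deriv σ θ
  left : σ (-ε) = 0
  right : σ ε = 1
  inv_smooth : ContDiff ℝ ∞ ξ
  inv_apply : ∀ θ, ξ (θ + σ θ) = θ
  apply_inv : ∀ u, ξ u + σ (ξ u) = u

/-- The map θ ↦ θ + σ(θ) has derivative at least 1 and is surjective, hence is a diffeomorphism of
the line. -/
theorem exists_isStaircase {ρ : ℝ → ℝ} {ε : ℝ} (hρ : IsStep ρ ε) (h0 : 0 < ε) (hε : ε < 1 / 2)
    (hm : Monotone ρ) : ∃ ξ, IsStaircase (stair ρ) ξ ε := by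
  have hs := contDiff_stair hρ hε
  have hd (θ : ℝ) : HasDerivAt (fun θ => θ + stair ρ θ) (1 + deriv (stair ρ) θ) θ :=
    (hasDerivAt_id θ).add (hs.differentiable (by simp) θ).hasDerivAt
  have hpos (θ : ℝ) : 0 < 1 + deriv (stair ρ) θ := by linarith [deriv_stair_nonneg hρ hε hm θ]
  have hmono : StrictMono fun θ => θ + stair ρ θ :=
    strictMono_of_deriv_pos fun θ => by rw [(hd θ).deriv]; exact hpos θ
  have hsm : Monotone (stair ρ) :=
    monotone_of_deriv_nonneg (hs.differentiable (by simp)) (deriv_stair_nonneg hρ hε hm)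
  have hcd : ContDiff ℝ ∞ fun θ => θ + stair ρ θ := contDiff_id.add hs
  have hsurj : Function.Surjective fun θ => θ + stair ρ θ := by
    refine hcd.continuous.surjective ?_ ?_
    · refine tendsto_atTop_mono' atTop ?_ (tendsto_atTop_add_const_right _ (stair ρ 0) tendsto_id)
      filter_upwards [eventually_ge_atTop 0] with θ hθ
      simpa using hsm hθ
    · refine tendsto_atBot_mono' atBot ?_ (tendsto_atBot_add_const_right _ (stair ρ 0) tendsto_id)
      filter_upwards [eventually_le_atBot 0] with θ hθ
      simpa using hsm hθ
  let e : ℝ ≃ₜ ℝ := (hmono.orderIsoOfSurjective _ hsurj).toHomeomorph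
  refine ⟨e.symm, hs, stair_add_int ρ, deriv_stair_nonneg hρ hε hm, ?_, ?_,
    e.contDiff_symm_deriv (fun θ => (hpos θ).ne') hd hcd, fun θ => e.symm_apply_apply θ,
    fun u => e.apply_symm_apply u⟩
  · rw [stair_eq hρ hε.le (n := 0) (by rw [Int.cast_zero, sub_zero, abs_neg, abs_of_pos h0]; linarith)]
    simp [hρ.left]
  · rw [stair_eq hρ hε.le (n := 0) (by rw [Int.cast_zero, sub_zero, abs_of_pos h0]; linarith)]
    simp [hρ.right]

/-! ### Estimates for the inverse ξ. -/

namespace IsStaircase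

variable {σ ξ : ℝ → ℝ} {ε : ℝ} (h : IsStaircase σ ξ ε)
include h

theorem hasDerivAt (θ : ℝ) : HasDerivAt σ (deriv σ θ) θ :=
  (h.smooth.differentiable (by simp) θ).hasDerivAt

theorem monotone : Monotone σ :=
  monotone_of_deriv_nonneg (h.smooth.differentiable (by simp)) h.deriv_nonneg

theorem inv_hasDerivAt (u : ℝ) : HasDerivAt ξ (deriv ξ u) u :=
  (h.inv_smooth.differentiable (by simp) u).hasDerivAt

/-- Differentiating ξ + σ ∘ ξ = id gives ξ' · (1 + σ'(ξ)) = 1 with σ' ≥ 0. -/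
theorem inv_deriv (u : ℝ) : 0 < deriv ξ u ∧ deriv ξ u ≤ 1 := by
  have h1 := (h.inv_hasDerivAt u).add ((h.hasDerivAt (ξ u)).comp u (h.inv_hasDerivAt u))
  have h2 : HasDerivAt (fun u => ξ u + σ (ξ u)) 1 u := by
    simp only [h.apply_inv]; exact hasDerivAt_id u
  have h3 := h1.unique h2
  have h4 := h.deriv_nonneg (ξ u)
  constructor <;> nlinarith

theorem inv_strictMono : StrictMono ξ :=
  strictMono_of_deriv_pos fun u => (h.inv_deriv u).1

theorem inv_add_int (u : ℝ) (n : ℤ) : ξ (u + 2 * n) = ξ u + n := by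
  have : u + 2 * n = (ξ u + n) + σ (ξ u + n) := by
    rw [h.add_int]
    linarith [h.apply_inv u]
  rw [this, h.inv_apply]

theorem inv_add_two (u : ℝ) : ξ (u + 2) = ξ u + 1 := by
  simpa using h.inv_add_int u 1

theorem inv_add_one (u : ℝ) : ξ u < ξ (u + 1) ∧ ξ (u + 1) < ξ u + 1 := by
  refine ⟨h.inv_strictMono (by linarith), ?_⟩
  rw [← h.inv_add_two]
  exact h.inv_strictMono (by linarith)

/-- The values of θ + σ(θ) at -ε and ε are -ε and 1 + ε, which enclose [0, 1]. -/
theorem abs_inv_le (hε : 0 < ε) {u : ℝ} (h0 : 0 ≤ u) (h1 : u ≤ 1) : |ξ u| ≤ ε := by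
  rw [abs_le]
  constructor
  · have := h.inv_strictMono.monotone (show -ε + σ (-ε) ≤ u by rw [h.left]; linarith)
    rwa [h.inv_apply] at this
  · have := h.inv_strictMono.monotone (show u ≤ ε + σ ε by rw [h.right]; linarith)
    rwa [h.inv_apply] at this

/-- Since u - ξ(u) = σ(ξ(u)) is monotone in u, only the ends matter; there it equals -ξ(0) and, by
ξ(1) = ξ(-1) + 1, also -ξ(1). -/
theorem abs_sub_inv_le (hε : 0 < ε) {u : ℝ} (h0 : -1 ≤ u) (h1 : u ≤ 0) : |u - ξ u| ≤ ε := by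
  have e (u : ℝ) : u - ξ u = σ (ξ u) := by linarith [h.apply_inv u]
  have h2 := h.monotone (h.inv_strictMono.monotone h0)
  have h3 := h.monotone (h.inv_strictMono.monotone h1)
  rw [← e, ← e] at h2 h3
  have h4 := abs_le.1 (h.abs_inv_le hε le_rfl zero_le_one)
  have h5 := abs_le.1 (h.abs_inv_le hε zero_le_one le_rfl)
  have h6 := h.inv_add_two (-1)
  norm_num at h6
  rw [abs_le]
  constructor <;> linarith

end IsStaircase

/-- The sum of the coordinates, along the core of the isotopy between the two twisted annuli. -/
def isotopySum (σ : ℝ → ℝ) (s θ : ℝ) : ℝ := (1 - s) * (θ - σ (-θ)) + s * (θ + σ θ)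

/-- The height of the core of the isotopy, as a function of the sum of the coordinates. -/
def isotopyHeight (ξ : ℝ → ℝ) (s u : ℝ) : ℝ := (1 - s) * (u + ξ (-u)) + s * ξ u

/-- The isotopy between the horizontal annulus, twisted along the vertical one, and the vertical
annulus, twisted along the horizontal one, in the universal cover of the plumbing. -/
def isotopyMap (σ ξ : ℝ → ℝ) (z : ℝ × Plane) : Plane :=
  !₂[isotopySum σ z.1 (z.2 0) - isotopyHeight ξ z.1 (isotopySum σ z.1 (z.2 0)) - z.1 * z.2 1,
    isotopyHeight ξ z.1 (isotopySum σ z.1 (z.2 0)) + (1 - z.1) * z.2 1]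

/-! ### The explicit isotopy between the two twisted annuli. -/

namespace IsStaircase

variable {σ ξ : ℝ → ℝ} {ε : ℝ} (h : IsStaircase σ ξ ε)
include h

theorem isotopyMap_zero (u : Plane) : isotopyMap σ ξ (0, u) = !₂[u 0, u 1 - σ (-u 0)] := by
  have h1 : isotopySum σ 0 (u 0) = u 0 - σ (-u 0) := by simp [isotopySum]
  have h2 : ξ (-(u 0 - σ (-u 0))) = -u 0 := by
    rw [show -(u 0 - σ (-u 0)) = -u 0 + σ (-u 0) by ring, h.inv_apply]
  have h3 : isotopyHeight ξ 0 (u 0 - σ (-u 0)) = - σ (-u 0) := by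
    simp only [isotopyHeight, h2]; ring
  simp only [isotopyMap, h1, h3]
  ext i
  fin_cases i
  · simp
  · simp; ring

theorem isotopyMap_one (u : Plane) : isotopyMap σ ξ (1, u) = !₂[σ (u 0) - u 1, u 0] := by
  have h1 : isotopySum σ 1 (u 0) = u 0 + σ (u 0) := by simp [isotopySum]
  have h3 : isotopyHeight ξ 1 (u 0 + σ (u 0)) = u 0 := by
    simp [isotopyHeight, h.inv_apply]
  simp only [isotopyMap, h1, h3]
  ext i
  fin_cases i <;> simp

theorem contDiff_isotopyMap : ContDiff ℝ ∞ (isotopyMap σ ξ) := by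
  have h1 := h.smooth
  have h2 := h.inv_smooth
  have hc (i : Fin 2) : ContDiff ℝ ∞ fun z : ℝ × Plane => z.2 i :=
    (EuclideanSpace.proj (𝕜 := ℝ) i).contDiff.comp contDiff_snd
  have hs : ContDiff ℝ ∞ fun z : ℝ × Plane => isotopySum σ z.1 (z.2 0) :=
    ((contDiff_const.sub contDiff_fst).mul ((hc 0).sub (h1.comp (hc 0).neg))).add
      (contDiff_fst.mul ((hc 0).add (h1.comp (hc 0))))
  have hh : ContDiff ℝ ∞ fun z : ℝ × Plane =>
      isotopyHeight ξ z.1 (isotopySum σ z.1 (z.2 0)) :=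
    ((contDiff_const.sub contDiff_fst).mul (hs.add (h2.comp hs.neg))).add
      (contDiff_fst.mul (h2.comp hs))
  rw [contDiff_iff_contDiffAt]
  intro z
  exact contDiffAt_vec2 ((hs.sub hh).sub (contDiff_fst.mul (hc 1))).contDiffAt
    (hh.add ((contDiff_const.sub contDiff_fst).mul (hc 1))).contDiffAt

theorem isotopySum_add_int (s θ : ℝ) (n : ℤ) :
    isotopySum σ s (θ + n) = isotopySum σ s θ + 2 * n := by
  have h1 := h.add_int (-θ) (-n)
  push_cast at h1
  have h2 : -(θ + n) = -θ + -(n : ℝ) := by ring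
  simp only [isotopySum, h.add_int, h2, h1]
  ring

theorem isotopyHeight_add_int (s u : ℝ) (n : ℤ) :
    isotopyHeight ξ s (u + 2 * n) = isotopyHeight ξ s u + n := by
  have h1 := h.inv_add_int (-u) (-n)
  push_cast at h1
  have h2 : -(u + 2 * n) = -u + 2 * -(n : ℝ) := by ring
  simp only [isotopyHeight, h.inv_add_int, h2, h1]
  ring

theorem isotopyMap_add_int (s : ℝ) (u : Plane) (n : ℤ) :
    isotopyMap σ ξ (s, u + (n : ℝ) • !₂[1, 0]) = isotopyMap σ ξ (s, u) + (n : ℝ) • !₂[1, 1] := by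
  rw [← plane_eta u, plane_add_smul]
  ext i
  fin_cases i
  · simp [isotopyMap, h.isotopySum_add_int, h.isotopyHeight_add_int]; ring
  · simp [isotopyMap, h.isotopySum_add_int, h.isotopyHeight_add_int]; ring

theorem hasDerivAt_isotopySum (s θ : ℝ) : HasDerivAt (isotopySum σ s)
    ((1 - s) * (1 + deriv σ (-θ)) + s * (1 + deriv σ θ)) θ := by
  have h1 : HasDerivAt (fun θ => σ (-θ)) (-deriv σ (-θ)) θ := 
    ((h.hasDerivAt (-θ)).comp θ (hasDerivAt_neg θ)).congr_deriv (by ring)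
  have h2 := (((hasDerivAt_id θ).sub h1).const_mul (1 - s)).add
    (((hasDerivAt_id θ).add (h.hasDerivAt θ)).const_mul s)
  exact h2.congr_deriv (by ring)

theorem deriv_isotopySum_pos {s : ℝ} (hs : s ∈ Icc (0 : ℝ) 1) (θ : ℝ) :
    0 < (1 - s) * (1 + deriv σ (-θ)) + s * (1 + deriv σ θ) := by
  have h1 := mul_nonneg (sub_nonneg.2 hs.2) (h.deriv_nonneg (-θ))
  have h2 := mul_nonneg hs.1 (h.deriv_nonneg θ)
  linarith

theorem isotopySum_strictMono {s : ℝ} (hs : s ∈ Icc (0 : ℝ) 1) : StrictMono (isotopySum σ s) :=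
  strictMono_of_deriv_pos fun θ => by
    rw [(h.hasDerivAt_isotopySum s θ).deriv]; exact h.deriv_isotopySum_pos hs θ

theorem hasDerivAt_isotopyHeight (s u : ℝ) : HasDerivAt (isotopyHeight ξ s)
    ((1 - s) * (1 - deriv ξ (-u)) + s * deriv ξ u) u := by
  have h1 : HasDerivAt (fun u => ξ (-u)) (-deriv ξ (-u)) u := 
    ((h.inv_hasDerivAt (-u)).comp u (hasDerivAt_neg u)).congr_deriv (by ring)
  have h2 := (((hasDerivAt_id u).add h1).const_mul (1 - s)).add
    ((h.inv_hasDerivAt u).const_mul s)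
  exact h2.congr_deriv (by ring)

/-- The transverse direction turns from (0, 1) to (-1, 0). With p = ξ'(-u) and q = ξ'(u) in (0, 1],
the determinant is the derivative of the sum times (1-s)²p + s(1-s)(1-q) + s(1-s)(1-p) + s²q. -/
theorem det_isotopyMap_pos {s : ℝ} (hs : s ∈ Icc (0 : ℝ) 1) (θ : ℝ) :
    0 < (fderiv ℝ (fun w => isotopyMap σ ξ (s, w)) !₂[θ, 0]).det := by
  have hd : DifferentiableAt ℝ (fun w => isotopyMap σ ξ (s, w)) !₂[θ, 0] :=
    (h.contDiff_isotopyMap.comp (contDiff_const.prodMk contDiff_id)).differentiable (by simp) _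
  have hS := h.hasDerivAt_isotopySum s θ
  have hH := (h.hasDerivAt_isotopyHeight s (isotopySum σ s θ)).comp θ hS
  have ha : HasDerivAt (fun t => isotopyMap σ ξ (s, !₂[t, 0])) _ θ :=
    hasDerivAt_vec2 ((hS.sub hH).sub_const (s * 0)) (hH.add_const ((1 - s) * 0))
  have hb : HasDerivAt (fun t => isotopyMap σ ξ (s, !₂[θ, t])) !₂[-(s * 1), (1 - s) * 1] 0 :=
    hasDerivAt_vec2
      (f := fun t => isotopySum σ s θ - isotopyHeight ξ s (isotopySum σ s θ) - s * t)
      (g := fun t => isotopyHeight ξ s (isotopySum σ s θ) + (1 - s) * t)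
      (((hasDerivAt_id (0 : ℝ)).const_mul s).const_sub _)
      (((hasDerivAt_id (0 : ℝ)).const_mul (1 - s)).const_add _)
  rw [det_fderiv_plane (u := !₂[θ, 0]) hd ha hb]
  have hpos := h.deriv_isotopySum_pos hs θ
  set a := (1 - s) * (1 + deriv σ (-θ)) + s * (1 + deriv σ θ)
  obtain ⟨p0, p1⟩ := h.inv_deriv (-(isotopySum σ s θ))
  obtain ⟨q0, q1⟩ := h.inv_deriv (isotopySum σ s θ)
  set p := deriv ξ (-(isotopySum σ s θ))
  set q := deriv ξ (isotopySum σ s θ)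
  have key : 0 < (1 - s) ^ 2 * p + s * (1 - s) * (1 - q) + s * (1 - s) * (1 - p) + s ^ 2 * q := by
    have h1 : 0 ≤ s * (1 - s) := mul_nonneg hs.1 (sub_nonneg.2 hs.2)
    have h2 := mul_nonneg h1 (sub_nonneg.2 p1)
    have h3 := mul_nonneg h1 (sub_nonneg.2 q1)
    rcases eq_or_lt_of_le hs.1 with h4 | h4
    · rw [← h4]; simpa using p0
    · have h5 := mul_pos (pow_pos h4 2) q0
      have h6 := mul_nonneg (sq_nonneg (1 - s)) p0.le
      linarith
  have := mul_pos hpos key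
  simp only [Matrix.cons_val_zero, Matrix.cons_val_one, Matrix.cons_val_fin_one, mul_one]
  linarith

/-- Since ξ is strictly increasing and rises by exactly 1 over length 2, it rises by strictly
between 0 and 1 over length 1. The same then holds for u + ξ(-u) and for the convex combination. -/
theorem isotopyHeight_add_one {s : ℝ} (hs : s ∈ Icc (0 : ℝ) 1) (u : ℝ) :
    isotopyHeight ξ s u < isotopyHeight ξ s (u + 1) ∧
      isotopyHeight ξ s (u + 1) < isotopyHeight ξ s u + 1 := by
  obtain ⟨h1, h2⟩ := h.inv_add_one u
  obtain ⟨h3, h4⟩ := h.inv_add_one (-(u + 1))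
  rw [show -(u + 1) + 1 = -u by ring] at h3 h4
  simp only [isotopyHeight]
  rcases eq_or_lt_of_le hs.1 with h5 | h5
  · rw [← h5]; constructor <;> linarith
  · have h6 := sub_nonneg.2 hs.2
    have h7 := mul_pos h5 (sub_pos.2 h1)
    have h8 := mul_pos h5 (sub_pos.2 h2)
    have h9 := mul_nonneg h6 (sub_nonneg.2 h3.le)
    have h10 := mul_nonneg h6 (sub_nonneg.2 h4.le)
    constructor <;> nlinarith

/-- The core of the isotopy stays close to the lines with integral coordinates. -/
theorem isotopyMap_core_mem (hε : 0 < ε) {s : ℝ} (hs : s ∈ Icc (0 : ℝ) 1) (θ : ℝ) :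
    (∃ n : ℤ, |isotopyMap σ ξ (s, !₂[θ, 0]) 1 - n| ≤ ε) ∨
      ∃ n : ℤ, |isotopyMap σ ξ (s, !₂[θ, 0]) 0 - n| ≤ ε := by
  set u := isotopySum σ s θ with hu
  have e1 : isotopyMap σ ξ (s, !₂[θ, 0]) 1 = isotopyHeight ξ s u := by simp [isotopyMap, hu]
  have e0 : isotopyMap σ ξ (s, !₂[θ, 0]) 0 = u - isotopyHeight ξ s u := by simp [isotopyMap, hu]
  rw [e0, e1]
  -- Translation by (n, n) reduces to a sum in [-1, 1]. For a non-negative sum the core follows a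
  -- horizontal grid line, for a non-positive one a vertical line.
  obtain ⟨n, hn⟩ : ∃ n : ℤ, |u / 2 - n| ≤ 1 / 2 := ⟨_, abs_sub_round (u / 2)⟩
  rw [abs_le] at hn
  obtain ⟨w, hw⟩ : ∃ w, u = w + 2 * n := ⟨u - 2 * n, by ring⟩
  have hw1 : -1 ≤ w := by linarith
  have hw2 : w ≤ 1 := by linarith
  rw [hw, h.isotopyHeight_add_int]
  have h1s := sub_nonneg.2 hs.2
  rcases le_total 0 w with h0 | h0
  · refine Or.inl ⟨n, ?_⟩
    have a1 := abs_le.1 (h.abs_sub_inv_le hε (u := -w) (by linarith) (by linarith))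
    have a2 := abs_le.1 (h.abs_inv_le hε h0 hw2)
    simp only [isotopyHeight]
    rw [abs_le]
    constructor <;> nlinarith [a1.1, a1.2, a2.1, a2.2, hs.1]
  · refine Or.inr ⟨n, ?_⟩
    have a1 := abs_le.1 (h.abs_sub_inv_le hε hw1 h0)
    have a2 := abs_le.1 (h.abs_inv_le hε (u := -w) (by linarith) (by linarith))
    simp only [isotopyHeight]
    rw [abs_le]
    constructor <;> nlinarith [a1.1, a1.2, a2.1, a2.2, hs.1]

/-- The sums differ by m + n. If this is even, a translation along (1, 1) makes them equal and
monotonicity of the sum concludes. If it is odd, two heights one unit of sum apart would differ by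
an integer strictly between 0 and 1. -/
theorem isotopyMap_core_inj {s : ℝ} (hs : s ∈ Icc (0 : ℝ) 1) {θ θ' : ℝ} {m n : ℤ}
    (h0 : isotopyMap σ ξ (s, !₂[θ, 0]) 0 = isotopyMap σ ξ (s, !₂[θ', 0]) 0 + m)
    (h1 : isotopyMap σ ξ (s, !₂[θ, 0]) 1 = isotopyMap σ ξ (s, !₂[θ', 0]) 1 + n) :
    ∃ k : ℤ, θ = θ' + k := by
  set u := isotopySum σ s θ with hu
  set u' := isotopySum σ s θ' with hu'
  have e1 : isotopyHeight ξ s u = isotopyHeight ξ s u' + n := by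
    simpa [isotopyMap, hu, hu'] using h1
  have e0 : u - isotopyHeight ξ s u = u' - isotopyHeight ξ s u' + m := by
    simpa [isotopyMap, hu, hu'] using h0
  have e : u = u' + m + n := by linarith
  rcases Int.even_or_odd' (m + n) with ⟨k, hk | hk⟩
  · refine ⟨k, (h.isotopySum_strictMono hs).injective ?_⟩
    have hk' : (m : ℝ) + n = 2 * k := by exact_mod_cast hk
    rw [h.isotopySum_add_int, ← hu, ← hu']
    linarith
  · have hk' : (m : ℝ) + n = 2 * k + 1 := by exact_mod_cast hk
    rw [show u = u' + 1 + 2 * k by linarith, h.isotopyHeight_add_int] at e1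
    obtain ⟨l1, l2⟩ := h.isotopyHeight_add_one hs u'
    have l3 : (k : ℝ) < n := by linarith
    have l4 : (n : ℝ) < k + 1 := by linarith
    have l5 : k < n := by exact_mod_cast l3
    have l6 : n < k + 1 := by exact_mod_cast l4
    omega

end IsStaircase

/-! ## The braid relation in a plumbing -/

section Braid

variable {T : Type*} [TopologicalSpace T] [ChartedSpace (EuclideanHalfSpace 2) T]
  {φ ψ : Plane → T} {δ : ℝ}

/-- The covering of the plumbing of `φ` and `ψ` by the neighbourhood `cross δ` of the lines with
integral coordinates. -/
def plumbMap (φ ψ : Plane → T) (δ : ℝ) (u : Plane) : T :=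
  if |u 1 - round (u 1)| < δ then φ !₂[u 0, u 1 - round (u 1)] else ψ !₂[u 1, round (u 0) - u 0]

/-- The points of the plane with a coordinate at distance less than `δ` from an integer. -/
def cross (δ : ℝ) : Set Plane := {u | (∃ n : ℤ, |u 1 - n| < δ) ∨ ∃ m : ℤ, |u 0 - m| < δ}

theorem isOpen_cross (δ : ℝ) : IsOpen (cross δ) := by
  have h (i : Fin 2) : IsOpen {u : Plane | ∃ n : ℤ, |u i - n| < δ} := by
    have e : {u : Plane | ∃ n : ℤ, |u i - n| < δ} = ⋃ n : ℤ, {u : Plane | |u i - n| < δ} := by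
      ext; simp
    rw [e]
    exact isOpen_iUnion fun n => isOpen_lt (by fun_prop) continuous_const
  exact (h 1).union (h 0)

namespace IsPlumbing

variable (h : IsPlumbing φ ψ δ)
include h

theorem plumbMap_left {u : Plane} {n : ℤ} (hu : |u 1 - n| < δ) :
    plumbMap φ ψ δ u = φ !₂[u 0, u 1 - n] := by
  have hr : round (u 1) = n := round_eq_of_abs_lt (hu.trans_le h.le_half)
  rw [plumbMap, hr, if_pos hu]

/-- On the squares around lattice points, where both formulas apply, they agree by the normal form
of the plumbing. -/
theorem plumbMap_right {u : Plane} {m : ℤ} (hu : |u 0 - m| < δ) :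
    plumbMap φ ψ δ u = ψ !₂[u 1, m - u 0] := by
  have hr : round (u 0) = m := round_eq_of_abs_lt (hu.trans_le h.le_half)
  have hu' : |(m : ℝ) - u 0| < δ := by rwa [abs_sub_comm]
  unfold plumbMap
  split_ifs with hn
  · have e1 : φ !₂[u 0, u 1 - round (u 1)] = φ !₂[u 0 - m, u 1 - round (u 1)] :=
      (h.left.eq_iff (by simpa using hn) (by simpa using hn)).2 ⟨rfl, m, by simp⟩
    rw [e1, h.agree _ _ hu hn, neg_sub]
    exact (h.right.eq_iff (by simpa using hu') (by simpa using hu')).2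
      ⟨rfl, -round (u 1), by simp [sub_eq_add_neg]⟩
  · rw [hr]

/-- Two points near parallel grid lines are compared inside one strip; a horizontal and a vertical
one can share an image only in the common square. -/
theorem plumbMap_eq {u v : Plane} (hu : u ∈ cross δ) (hv : v ∈ cross δ)
    (e : plumbMap φ ψ δ u = plumbMap φ ψ δ v) :
    (∃ m : ℤ, u 0 = v 0 + m) ∧ ∃ n : ℤ, u 1 = v 1 + n := by
  have mixed {u v : Plane} {n m : ℤ} (hn : |u 1 - n| < δ) (hm : |v 0 - m| < δ)
      (e : plumbMap φ ψ δ u = plumbMap φ ψ δ v) :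
      (∃ m : ℤ, u 0 = v 0 + m) ∧ ∃ n : ℤ, u 1 = v 1 + n := by
    rw [h.plumbMap_left hn, h.plumbMap_right hm] at e
    obtain ⟨⟨k, hk⟩, l, hl⟩ := h.disjoint _ _ (by simpa using hn)
      (by simpa [abs_sub_comm] using hm) e
    simp only [Matrix.cons_val_zero, Matrix.cons_val_one, Matrix.cons_val_fin_one] at hk hl
    exact ⟨⟨k - m, by push_cast; linarith⟩, n - l, by push_cast; linarith⟩
  rcases hu with ⟨n, hn⟩ | ⟨m, hm⟩ <;> rcases hv with ⟨n', hn'⟩ | ⟨m', hm'⟩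
  · rw [h.plumbMap_left hn, h.plumbMap_left hn'] at e
    obtain ⟨h1, k, hk⟩ := (h.left.eq_iff (by simpa using hn) (by simpa using hn')).1 e
    simp only [Matrix.cons_val_zero, Matrix.cons_val_one, Matrix.cons_val_fin_one] at h1 hk
    exact ⟨⟨k, hk⟩, n - n', by push_cast; linarith⟩
  · exact mixed hn hm' e
  · obtain ⟨⟨k, hk⟩, l, hl⟩ := mixed hn' hm e.symm
    exact ⟨⟨-k, by push_cast; linarith⟩, -l, by push_cast; linarith⟩
  · rw [h.plumbMap_right hm, h.plumbMap_right hm'] at e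
    obtain ⟨h1, k, hk⟩ := (h.right.eq_iff (by simpa [abs_sub_comm] using hm)
      (by simpa [abs_sub_comm] using hm')).1 e
    simp only [Matrix.cons_val_zero, Matrix.cons_val_one, Matrix.cons_val_fin_one] at h1 hk
    exact ⟨⟨m - m', by push_cast; linarith⟩, k, hk⟩

omit h in
theorem add_mem_cross {w : Plane} (hw : w ∈ cross δ) (n : ℤ) :
    w + (n : ℝ) • !₂[1, 1] ∈ cross δ := by
  rcases hw with ⟨k, hk⟩ | ⟨k, hk⟩
  · refine Or.inl ⟨k + n, ?_⟩
    convert hk using 2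
    simp
  · refine Or.inr ⟨k + n, ?_⟩
    convert hk using 2
    simp

theorem plumbMap_add {w : Plane} (hw : w ∈ cross δ) (n : ℤ) :
    plumbMap φ ψ δ (w + (n : ℝ) • !₂[1, 1]) = plumbMap φ ψ δ w := by
  rcases hw with ⟨k, hk⟩ | ⟨k, hk⟩
  · have hk' : |(w + (n : ℝ) • !₂[1, 1] : Plane) 1 - (k + n : ℤ)| < δ := by
      convert hk using 2
      simp
    rw [h.plumbMap_left hk, h.plumbMap_left hk']
    exact (h.left.eq_iff (by simpa using hk') (by simpa using hk)).2 ⟨by simp, n, by simp⟩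
  · have hk' : |(w + (n : ℝ) • !₂[1, 1] : Plane) 0 - (k + n : ℤ)| < δ := by
      convert hk using 2
      simp
    rw [h.plumbMap_right hk, h.plumbMap_right hk']
    rw [abs_sub_comm] at hk hk'
    exact (h.right.eq_iff (by simpa using hk') (by simpa using hk)).2 ⟨by simp, n, by simp⟩

/-- Near a grid line the map is φ after a translation, or ψ after a rotation by a right angle and a
translation. -/
theorem plumbMap_regularAt {w : Plane} (hw : w ∈ cross δ) : RegularAt (plumbMap φ ψ δ) w := by
  rcases hw with ⟨k, hk⟩ | ⟨k, hk⟩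
  · have e (v : Plane) : ContinuousLinearEquiv.refl ℝ Plane v + !₂[0, -(k : ℝ)] =
        !₂[v 0, v 1 - k] := by
      ext i; fin_cases i <;> simp [sub_eq_add_neg]
    have hr := RegularAt.comp_affine (ContinuousLinearEquiv.refl ℝ Plane) !₂[0, -(k : ℝ)]
      (by rw [det_of_fderiv]; simp) (h.left.regularAt (u := _ + _) (by rw [e]; simpa using hk))
    refine hr.congr ?_
    have hc : ContinuousAt (fun v : Plane => |v 1 - k|) w := by fun_prop
    filter_upwards [hc.eventually_lt continuousAt_const hk] with v hv
    rw [e, h.plumbMap_left hv]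
  · have e (v : Plane) : quarterTurn.symm v + !₂[0, (k : ℝ)] = !₂[v 1, k - v 0] := by
      rw [quarterTurn_symm_apply]
      ext i
      fin_cases i
      · simp
      · simp; ring
    have hr := RegularAt.comp_affine quarterTurn.symm !₂[0, (k : ℝ)]
      (by rw [det_quarterTurn_symm]; exact one_pos)
      (h.right.regularAt (u := _ + _) (by rw [e]; simpa [abs_sub_comm] using hk))
    refine hr.congr ?_
    have hc : ContinuousAt (fun v : Plane => |v 0 - k|) w := by fun_prop
    filter_upwards [hc.eventually_lt continuousAt_const hk] with v hv
    rw [e, h.plumbMap_right hv]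

theorem coreFamily {σ ξ : ℝ → ℝ} {ε : ℝ} (hσ : IsStaircase σ ξ ε) (hε : 0 < ε) (hεδ : ε < δ) :
    CoreFamily (plumbMap φ ψ δ) (cross δ) (isotopyMap σ ξ) !₂[1, 1] 1 where
  isOpen := isOpen_cross δ
  regular _ := h.plumbMap_regularAt
  add_mem _ := add_mem_cross
  map_add _ := h.plumbMap_add
  pos := one_pos
  smooth _ _ _ := hσ.contDiff_isotopyMap.contDiffAt
  periodic s u n _ := hσ.isotopyMap_add_int s u n
  core_mem s hs θ := (hσ.isotopyMap_core_mem hε hs θ).imp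
    (fun ⟨n, hn⟩ => ⟨n, hn.trans_lt hεδ⟩) (fun ⟨n, hn⟩ => ⟨n, hn.trans_lt hεδ⟩)
  core_det _ hs θ := hσ.det_isotopyMap_pos hs θ
  core_inj s hs θ θ' e := by
    have hm (θ : ℝ) : isotopyMap σ ξ (s, !₂[θ, 0]) ∈ cross δ :=
      (hσ.isotopyMap_core_mem hε hs θ).imp
        (fun ⟨n, hn⟩ => ⟨n, hn.trans_lt hεδ⟩) (fun ⟨n, hn⟩ => ⟨n, hn.trans_lt hεδ⟩)
    obtain ⟨⟨m, h0⟩, n, h1⟩ := h.plumbMap_eq (hm θ) (hm θ') e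
    exact hσ.isotopyMap_core_inj hs h0 h1

/-- The horizontal twist in the coordinates of the plumbing. -/
theorem twist_left_apply {ε : ℝ} {ρ : ℝ → ℝ} {f : DiffPlus T} (hf : IsStripTwist φ δ ε ρ f)
    {θ t : ℝ} (ht : |t| < δ) :
    f.toDiffeo (ψ !₂[θ, t]) = plumbMap φ ψ δ !₂[stair ρ θ - t, θ] := by
  have hε := hf.lt
  have hle : ε ≤ 1 / 2 := hε.le.trans h.le_half
  by_cases hθ : |θ - round θ| < δ
  · have e : ψ !₂[θ, t] = φ !₂[-t, θ - round θ] := by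
      rw [h.agree _ _ (by rwa [abs_neg]) hθ, neg_neg]
      exact (h.right.eq_iff (by simpa using ht) (by simpa using ht)).2 ⟨rfl, round θ, by simp⟩
    rw [e, hf.apply _ (by simpa using hθ), h.plumbMap_left (u := !₂[stair ρ θ - t, θ]) hθ]
    refine (h.left.eq_iff (by simpa using hθ) (by simpa using hθ)).2 ⟨rfl, -round θ, ?_⟩
    simp [stair]
    ring
  -- Outside the squares the staircase is at an integral level, and the twist fixes the point.
  · have e : ∃ k : ℤ, stair ρ θ = k := by
      rcases le_abs.1 (not_lt.1 hθ) with h1 | h1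
      · exact ⟨round θ + 1, by rw [stair, hf.step.right _ (by linarith)]; push_cast; ring⟩
      · exact ⟨round θ, by rw [stair, hf.step.left _ (by linarith)]; ring⟩
    obtain ⟨k, hk⟩ := e
    rw [hf.eq_self, h.plumbMap_right (u := !₂[stair ρ θ - t, θ]) (m := k) (by simpa [hk] using ht)]
    · simp [hk]
    · intro u hu e
      obtain ⟨-, n, hn⟩ := h.disjoint u !₂[θ, t] hu (by simpa using ht) e
      simp only [Matrix.cons_val_zero] at hn
      refine hθ ((round_le θ n).trans_lt ?_)
      rw [hn]
      simpa using hu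

/-- The vertical twist in the coordinates of the plumbing. -/
theorem twist_right_apply {ε : ℝ} {ρ : ℝ → ℝ} {g : DiffPlus T} (hg : IsStripTwist ψ δ ε ρ g)
    {θ t : ℝ} (ht : |t| < δ) :
    g.toDiffeo (plumbMap φ ψ δ !₂[θ, t - stair ρ (-θ)]) = φ !₂[θ, t] := by
  have hε := hg.lt
  have hle : ε ≤ 1 / 2 := hε.le.trans h.le_half
  have hle' : δ ≤ 1 - ε := by linarith [h.le_half]
  have e0 : φ !₂[θ, t] = plumbMap φ ψ δ !₂[θ, t] := by
    rw [h.plumbMap_left (u := !₂[θ, t]) (n := 0) (by simpa using ht)]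
    simp
  by_cases hθ : |θ - round θ| < δ
  · have hθ' : |(round θ : ℝ) - θ| < δ := by rwa [abs_sub_comm]
    have hs : stair ρ (-θ) = -round θ + ρ (round θ - θ) := by
      rw [stair_eq hg.step hle (n := -round θ)]
      · push_cast; congr 2; ring
      · push_cast
        rw [show -θ - -(round θ : ℝ) = round θ - θ by ring]
        linarith
    rw [e0, h.plumbMap_right (u := !₂[θ, t - stair ρ (-θ)]) hθ,
      h.plumbMap_right (u := !₂[θ, t]) hθ, hg.apply _ (by simpa using hθ')]
    refine (h.right.eq_iff (by simpa using hθ') (by simpa using hθ')).2 ⟨rfl, round θ, ?_⟩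
    simp [hs]
    ring
  · have e : ∃ k : ℤ, stair ρ (-θ) = k := by
      -- Since `round` need not commute with negation at half-integers, the distances to the nearest
      -- integers are compared through minimality.
      have hθ' : δ ≤ |(-θ) - round (-θ)| := by
        refine (not_lt.1 hθ).trans ((round_le θ (-round (-θ))).trans_eq ?_)
        rw [← abs_neg]
        congr 1
        push_cast
        ring
      rcases le_abs.1 hθ' with h1 | h1
      · exact ⟨round (-θ) + 1, by rw [stair, hg.step.right _ (by linarith)]; push_cast; ring⟩
      · exact ⟨round (-θ), by rw [stair, hg.step.left _ (by linarith)]; ring⟩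
    obtain ⟨k, hk⟩ := e
    rw [h.plumbMap_left (u := !₂[θ, t - stair ρ (-θ)]) (n := -k) (by simpa [hk] using ht),
      hg.eq_self]
    · simp [hk]
    · intro u hu e
      have e' : φ !₂[θ, t] = ψ u := by
        rw [e]; simp [hk]
      obtain ⟨⟨n, hn⟩, -⟩ := h.disjoint !₂[θ, t] u (by simpa using ht) hu e'
      simp only [Matrix.cons_val_zero] at hn
      refine hθ ((round_le θ n).trans_lt ?_)
      rw [hn]
      simpa using hu

/-- The braid relation for the twists along the two annuli of a plumbing. -/
theorem braid [T2Space T] {x y : MappingClassGroup T} (hx : HasTwist φ x) (hy : HasTwist ψ y) :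
    x * y * x = y * x * y := by
  have hδ := h.pos
  have hε : 0 < δ / 2 := by linarith
  have hεδ : δ / 2 < δ := by linarith
  have hhalf : δ / 2 < 1 / 2 := by linarith [h.le_half]
  set ρ : ℝ → ℝ := fun t => Real.smoothTransition ((t + δ / 2) / (2 * (δ / 2))) with hρdef
  have hρ : IsStep ρ (δ / 2) := isStep_smoothTransition hε
  have hm : Monotone ρ := fun a b hab => Real.smoothTransition.monotone
    (div_le_div_of_nonneg_right (by linarith) (by linarith))
  obtain ⟨ξ, hσ⟩ := exists_isStaircase hρ hε hhalf hm
  obtain ⟨f, hf⟩ := h.left.exists_twist hεδ hρ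
  obtain ⟨g, hg⟩ := h.right.exists_twist hεδ hρ
  have hfx := hx.class_eq h.left hδ hf
  have hgy := hy.class_eq h.right hδ hg
  -- The end s = 1 of the isotopy is the image of the annulus ψ under the twist `f`; below, the end
  -- s = 0 is the image of φ under the inverse of `g`.
  have h1 : HasTwist (fun u => plumbMap φ ψ δ (isotopyMap (stair ρ) ξ (1, u))) (x⁻¹ * y * x) := by
    have := hy.conj f
    rw [hfx] at this
    refine this.congr hδ fun u hu => ?_
    rw [hσ.isotopyMap_one, ← h.twist_left_apply hf hu, plane_eta]
  have h0 : HasTwist (fun u => plumbMap φ ψ δ (isotopyMap (stair ρ) ξ (0, u))) (y * x * y⁻¹) := by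
    have := hx.conj g⁻¹
    rw [QuotientGroup.mk_inv, hgy, inv_inv] at this
    refine this.congr hδ fun u hu => ?_
    have e := h.twist_right_apply (θ := u 0) hg hu
    rw [plane_eta] at e
    rw [hσ.isotopyMap_zero, ← e]
    exact g.toDiffeo.symm_apply_apply _
  have key := h1.unique ((h.coreFamily hσ hε hεδ).hasTwist h0)
  rw [mul_assoc, inv_mul_eq_iff_eq_mul, eq_comm, ← mul_assoc, mul_inv_eq_iff_eq_mul] at key
  rw [mul_assoc, ← key, ← mul_assoc]

end IsPlumbing

end Braid

/-! ## Dehn twists along curves that cross once -/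

section Crossing

variable {T : Type*} [TopologicalSpace T] [ChartedSpace (EuclideanHalfSpace 2) T]
variable {φ ψ : Plane → T} {κ : Plane → Plane}

theorem isStrip_of_regularAt {r : ℝ} (h : ∀ u : Plane, |u 1| < r → RegularAt φ u)
    (eq_iff : ∀ u v : Plane, |u 1| < r → |v 1| < r →
      (φ u = φ v ↔ u 1 = v 1 ∧ ∃ n : ℤ, u 0 = v 0 + n)) : IsStrip φ r :=
  isStrip_of (fun u hu => (h u hu).smooth) (fun u hu => (h u hu).exists_section)
    (fun u hu => (h u hu).orientation) (fun u hu => (h u hu).interior) eq_iff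

theorem RegularAt.comp_neg {u : Plane} (h : RegularAt φ (-u)) :
    RegularAt (fun v => φ (-v)) u := by
  have hdet : 0 < (ContinuousLinearEquiv.neg ℝ (M := Plane) : Plane →L[ℝ] Plane).det := by
    rw [det_of_fderiv]
    simp
  have := RegularAt.comp_affine (Ψ := φ) (u := u) (ContinuousLinearEquiv.neg ℝ) 0 hdet (by simpa using h)
  simpa using this

theorem RegularAt.comp_add {u a : Plane} (h : RegularAt φ (u + a)) :
    RegularAt (fun v => φ (v + a)) u :=
  RegularAt.comp_affine (Ψ := φ) (u := u) (ContinuousLinearEquiv.refl ℝ Plane) a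
    (by rw [det_of_fderiv]; simp) h

omit [TopologicalSpace T] [ChartedSpace (EuclideanHalfSpace 2) T] in
theorem comp_neg_eq_iff {u v : Plane} (h : φ (-u) = φ (-v) ↔ (-u) 1 = (-v) 1 ∧ ∃ n : ℤ, (-u) 0 = (-v) 0 + n) :
    φ (-u) = φ (-v) ↔ u 1 = v 1 ∧ ∃ n : ℤ, u 0 = v 0 + n := by
  rw [h]
  simp only [PiLp.neg_apply, neg_inj]
  refine and_congr_right fun _ => ⟨fun ⟨n, hn⟩ => ⟨-n, ?_⟩, fun ⟨n, hn⟩ => ⟨-n, ?_⟩⟩ <;>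
  · push_cast
    linarith

theorem IsCover.comp_neg (h : IsCover φ) : IsCover fun u => φ (-u) where
  regular u := (h.regular (-u)).comp_neg
  eq_iff u v := comp_neg_eq_iff (h.eq_iff (-u) (-v))

/-- Turning a strip around exchanges its two sides and does not change the twist. -/
theorem HasTwist.comp_neg {z : MappingClassGroup T} (h : HasTwist φ z) :
    HasTwist (fun u => φ (-u)) z := by
  obtain ⟨r, ε, ρ, f, hr, hφ, hf, hz⟩ := h
  have hneg (u : Plane) (hu : |u 1| < r) : |(-u) 1| < r := by simpa using hu
  -- Reversing both coordinates turns the shear by ρ(t) into one by -ρ(-t); adding the invisible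
  -- integer 1 makes it a step from 0 to 1 again.
  refine ⟨r, ε, fun t => 1 - ρ (-t), f, hr, isStrip_of_regularAt
    (fun u hu => (hφ.regularAt (hneg u hu)).comp_neg)
    (fun u v hu hv => comp_neg_eq_iff (hφ.eq_iff (hneg u hu) (hneg v hv))),
    ⟨hf.lt, ⟨?_, fun t ht => ?_, fun t ht => ?_⟩, fun u hu => ?_, fun p hp => ?_⟩, hz⟩
  · exact contDiff_const.sub (hf.step.smooth.comp contDiff_neg)
  · rw [hf.step.right (-t) (by linarith), sub_self]
  · rw [hf.step.left (-t) (by linarith), sub_zero]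
  · rw [hf.apply (-u) (hneg u hu), hφ.eq_iff (by simpa using hu) (by simpa using hu)]
    refine ⟨by simp, 1, ?_⟩
    simp only [PiLp.neg_apply, Matrix.cons_val_zero, Int.cast_one]
    ring
  · refine hf.eq_self p fun u hu => ?_
    have := hp (-u) (hneg u hu)
    rwa [neg_neg] at this

theorem IsAnnulus.isCover (h : IsAnnulus φ) (a : Plane) : IsCover fun u => φ (u + a) where
  regular u := (h.regularAt (u + a)).comp_add
  eq_iff u v := by
    have := h.eq_iff ((u + a) 0) ((u + a) 1) ((v + a) 0) ((v + a) 1)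
    rw [plane_eta, plane_eta] at this
    rw [this]
    simp only [PiLp.add_apply, add_left_inj]
    refine and_congr_right fun _ => ⟨fun ⟨n, hn⟩ => ⟨n, ?_⟩, fun ⟨n, hn⟩ => ⟨n, ?_⟩⟩ <;> linarith

/-- The shift by `s` brings a chosen point of the core to the origin. The profile of a Dehn twist
has width 1, so any strip wider than 1 serves. -/
theorem IsAnnulus.hasTwist {f : DiffPlus T} {ρ : ℝ → ℝ} (h : IsAnnulus φ) (hρ : ContDiff ℝ ∞ ρ)
    (left : ∀ t ≤ -1, ρ t = 0) (right : ∀ t ≥ 1, ρ t = 1)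
    (apply : ∀ θ t, f.toDiffeo (φ !₂[θ, t]) = φ !₂[θ + ρ t, t])
    (eq_self : ∀ p ∉ range φ, f.toDiffeo p = p) (s : ℝ) :
    HasTwist (fun u => φ (u + !₂[s, 0])) (f : MappingClassGroup T) := by
  have e (u : Plane) : u + !₂[s, 0] = !₂[u 0 + s, u 1] := by
    ext i; fin_cases i <;> simp
  have hc := h.isCover !₂[s, 0]
  refine ⟨2, 1, ρ, f, two_pos, isStrip_of_regularAt (fun u _ => hc.regular u)
    (fun u v _ _ => hc.eq_iff u v), ⟨one_lt_two, ⟨hρ, left, right⟩, fun u _ => ?_, fun p hp => ?_⟩,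
    rfl⟩
  · rw [e, e, apply]
    congr 2
    change ![u 0 + s + ρ (u 1), u 1] = ![u 0 + ρ (u 1) + s, u 1]
    rw [add_right_comm]
  · by_cases hpr : p ∈ range φ
    · obtain ⟨w, rfl⟩ := hpr
      have hw : 2 ≤ |w 1| := by
        by_contra! hlt
        exact hp (w - !₂[s, 0]) (by simpa using hlt) (by simp)
      rw [← plane_eta w, apply, h.eq_iff]
      refine ⟨rfl, ?_⟩
      rcases le_abs.1 hw with h1 | h1
      · exact ⟨1, by rw [right _ (by linarith)]; simp⟩
      · exact ⟨0, by rw [left _ (by linarith)]; simp⟩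
    · exact eq_self p hpr

theorem IsAnnulus.exists_isTransition (hφ : IsAnnulus φ) (hψ : IsAnnulus ψ) {a b : Plane}
    (hab : φ a = ψ b) : ∃ κ, IsTransition (fun u => φ (u + a)) (fun u => ψ (u + b)) κ := by
  have ha := hφ.localDiffeo a
  have hc : Continuous fun u : Plane => ψ (u + b) :=
    hψ.localDiffeo.contMDiff.continuous.comp (by fun_prop)
  have hmem : ∀ᶠ u : Plane in 𝓝 0, ψ (u + b) ∈ ha.localInverse.source := by
    refine hc.continuousAt.eventually (ha.localInverse_open_source.mem_nhds ?_)
    simp only [zero_add]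
    rw [← hab]
    exact ha.localInverse_mem_source
  refine ⟨fun u => ha.localInverse (ψ (u + b)) - a, ⟨?_, ?_⟩⟩
  · simp only [zero_add, ← hab]
    rw [ha.localInverse_left_inv ha.localInverse_mem_target, sub_self]
  · filter_upwards [hmem] with u hu
    refine ⟨contMDiffAt_iff_contDiffAt.1 ?_, ?_⟩
    · have h1 := (ha.localInverse_contMDiffOn _ hu).contMDiffAt
        (ha.localInverse_open_source.mem_nhds hu)
      have h2 : ContMDiffAt 𝓘(ℝ, Plane) (𝓡∂ 2) ∞ (fun u => ψ (u + b)) u :=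
        ((hψ.isCover b).regular u).smooth
      have h3 := ContMDiffAt.comp u h1 h2
      exact ContMDiffAt.comp (I' := 𝓘(ℝ, Plane)) (g := fun w => w - a) u
        (contDiff_id.sub contDiff_const).contMDiff.contMDiffAt h3
    · rw [sub_add_cancel]
      exact ha.localInverse_right_inv hu

omit [TopologicalSpace T] [ChartedSpace (EuclideanHalfSpace 2) T] in
theorem IsTransition.comp_neg (h : IsTransition φ ψ κ) :
    IsTransition φ (fun u => ψ (-u)) fun u => κ (-u) where
  zero := by simpa using h.zero
  eventually := by
    have hc : Tendsto (fun u : Plane => -u) (𝓝 0) (𝓝 0) := by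
      simpa using (continuous_neg (G := Plane)).tendsto 0
    filter_upwards [hc.eventually h.eventually] with u hu
    exact ⟨hu.1.comp u contDiff_neg.contDiffAt, hu.2⟩

omit [TopologicalSpace T] [ChartedSpace (EuclideanHalfSpace 2) T] in
theorem IsTransition.neg (h : IsTransition φ ψ κ) :
    IsTransition (fun u => φ (-u)) ψ fun u => -κ u where
  zero := by simp [h.zero]
  eventually := by
    filter_upwards [h.eventually] with u hu
    exact ⟨hu.1.neg, by simpa using hu.2⟩

theorem mfderiv_curve {g : ℝ → T} {c : ℝ → Plane} {c' u : Plane} {t : ℝ}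
    (hφ : MDifferentiableAt 𝓘(ℝ, Plane) (𝓡∂ 2) φ u) (hc : HasDerivAt c c' t) (hu : c t = u)
    (hg : g =ᶠ[𝓝 t] φ ∘ c) :
    (show ℝ →L[ℝ] Plane from mfderiv 𝓘(ℝ, ℝ) (𝓡∂ 2) g t) 1 =
      (show Plane →L[ℝ] Plane from mfderiv 𝓘(ℝ, Plane) (𝓡∂ 2) φ u) c' := by
  subst hu
  have h1 := hc.hasFDerivAt.hasMFDerivAt
  have h2 := (hφ.hasMFDerivAt.comp t h1).congr_of_eventuallyEq hg
  have h3 := h2.mfderiv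
  have h4 : (show ℝ →L[ℝ] Plane from mfderiv 𝓘(ℝ, ℝ) (𝓡∂ 2) g t) =
      (show Plane →L[ℝ] Plane from mfderiv 𝓘(ℝ, Plane) (𝓡∂ 2) φ (c t)).comp
        (ContinuousLinearMap.toSpanSingleton ℝ c') := h3
  rw [h4]
  change (show Plane →L[ℝ] Plane from mfderiv 𝓘(ℝ, Plane) (𝓡∂ 2) φ (c t)) ((1 : ℝ) • c') = _
  rw [one_smul]

/-- The right-handed Dehn twists along two curves that cross exactly once satisfy the braid
relation. -/
theorem IsDehnTwistClass.braid [T2Space T] {α β : SimpleClosedCurve T}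
    (hαβ : MeetTransverselyOnce α β) {x y : MappingClassGroup T} (hx : IsDehnTwistClass x α)
    (hy : IsDehnTwistClass y β) : x * y * x = y * x * y := by
  obtain ⟨f, ⟨φ, ρ, hφ, hφα, hρ, hl, hr, hf, hf'⟩, rfl⟩ := hx
  obtain ⟨g, ⟨ψ, σ, hψ, hψβ, hσ, kl, kr, hg, hg'⟩, rfl⟩ := hy
  obtain ⟨s, t, hst, hint, hind⟩ := hαβ
  have hab : φ !₂[s, 0] = ψ !₂[t, 0] := by rw [hφα, hψβ, hst]
  have hx := hφ.hasTwist hρ hl hr hf hf' s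
  have hy := hψ.hasTwist hσ kl kr hg hg' t
  have cφ := hφ.isCover !₂[s, 0]
  have cψ := hψ.isCover !₂[t, 0]
  obtain ⟨κ, hκ⟩ := hφ.exists_isTransition hψ hab
  obtain ⟨κi, hκi⟩ := hψ.exists_isTransition hφ hab.symm
  have eφ (θ : ℝ) : φ (!₂[θ, 0] + !₂[s, 0]) = α.toFun (θ + s) := by
    rw [← hφα]; congr 1; ext i; fin_cases i <;> simp
  have eψ (θ : ℝ) : ψ (!₂[θ, 0] + !₂[t, 0]) = β.toFun (θ + t) := by
    rw [← hψβ]; congr 1; ext i; fin_cases i <;> simp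
  have hmeet (θ θ' : ℝ) (h : φ (!₂[θ, 0] + !₂[s, 0]) = ψ (!₂[θ', 0] + !₂[t, 0])) :
      ∃ m : ℤ, θ = m := by
    rw [eφ, eψ] at h
    have h1 : α.toFun (θ + s) ∈ range α.toFun ∩ range β.toFun :=
      ⟨mem_range_self _, h ▸ mem_range_self _⟩
    rw [hint, mem_singleton_iff, α.eq_iff] at h1
    obtain ⟨m, hm⟩ := h1
    exact ⟨m, by linarith⟩
  have hline (a : ℝ) : HasDerivAt (fun τ : ℝ => (!₂[τ - a, 0] : Plane)) !₂[1, 0] a :=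
    hasDerivAt_vec2 ((hasDerivAt_id a).sub_const a) (hasDerivAt_const a 0)
  have hκd : HasFDerivAt κ (fderiv ℝ κ 0) 0 :=
    (hκ.eventually.self_of_nhds.1.differentiableAt (by simp)).hasFDerivAt
  -- The velocity of β at the crossing, read in the coordinates of φ, where that of α is (1, 0).
  set b' : Plane := fderiv ℝ κ 0 !₂[1, 0] with hb'
  have hκline (a : ℝ) : HasDerivAt (fun τ : ℝ => κ !₂[τ - a, 0]) b' a := by
    refine HasFDerivAt.comp_hasDerivAt (f := fun τ : ℝ => (!₂[τ - a, 0] : Plane)) a ?_ (hline a)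
    simpa [vec2_zero] using hκd
  have hφd := (cφ.regular 0).smooth.mdifferentiableAt (by simp)
  have vα : α.velocity s = _ := mfderiv_curve (g := α.toFun) hφd (hline s) (by simp [vec2_zero])
    (Eventually.of_forall fun τ => by
      change α.toFun τ = φ (!₂[τ - s, 0] + !₂[s, 0])
      rw [eφ, sub_add_cancel])
  have vβ : β.velocity t = _ := mfderiv_curve (g := β.toFun) hφd (hκline t)
    (by simp [vec2_zero, hκ.zero]) (by
      have hc : Tendsto (fun τ : ℝ => (!₂[τ - t, 0] : Plane)) (𝓝 t) (𝓝 0) := by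
        simpa [vec2_zero] using (hline t).continuousAt.tendsto
      filter_upwards [hc.eventually hκ.eventually] with τ hτ
      refine Eq.trans ?_ hτ.2.symm
      rw [eψ, sub_add_cancel])
  -- A vanishing height component would make the two velocities parallel, against transversality.
  have hb1 : b' 1 ≠ 0 := by
    intro h0
    have e : b' = b' 0 • (!₂[1, 0] : Plane) := by
      ext i; fin_cases i <;> simp [h0]
    rw [LinearIndependent.pair_iff] at hind
    have := (hind (b' 0) (-1) (by
      rw [vα, vβ]
      nth_rw 2 [e]
      rw [map_smul]
      simp)).2
    norm_num at this
  have hκ0 : HasDerivAt (fun τ : ℝ => κ !₂[τ, 0]) b' 0 := by simpa using hκline 0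
  -- If β crosses α downwards, the annulus ψ is turned around, which keeps its twist and reverses
  -- the crossing.
  rcases hb1.lt_or_gt with hneg | hpos
  · have hd : HasDerivAt (fun τ : ℝ => κ (-!₂[τ, 0])) (-b') 0 := by
      have h1 : HasDerivAt (fun τ : ℝ => κ !₂[τ, 0]) b' (-0) := by simpa using hκ0
      have h2 := h1.scomp (0 : ℝ) (hasDerivAt_neg (0 : ℝ))
      have e : (fun τ : ℝ => κ (-!₂[τ, 0])) = (fun τ : ℝ => κ !₂[τ, 0]) ∘ Neg.neg := by
        funext τ
        congr 1
        ext i; fin_cases i <;> simp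
      rw [e]
      simpa using h2
    obtain ⟨φ', ψ', δ, hp, h1, h2⟩ := exists_isPlumbing cφ cψ.comp_neg hκ.comp_neg hκi.neg hd
      (by simpa using hneg) (fun θ θ' h => hmeet θ (-θ') (by
        rw [h]; congr 2; ext i; fin_cases i <;> simp)) hx hy.comp_neg
    exact hp.braid h1 h2
  · obtain ⟨φ', ψ', δ, hp, h1, h2⟩ := exists_isPlumbing cφ cψ hκ hκi hκ0 hpos hmeet hx hy
    exact hp.braid h1 h2

end Crossing

end

/-! ### Assembly of the algebra and the geometry. -/

theorem proposition3p3 {T : Type*} [TopologicalSpace T]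
    [ChartedSpace (EuclideanHalfSpace 2) T] [IsManifold (𝓡∂ 2) ∞ T] [OrientedAtlas T]
    (hT : IsOneHoledTorus T)
    (α β : SimpleClosedCurve T) (hαβ : MeetTransverselyOnce α β)
    (x y : MappingClassGroup T) (hx : IsDehnTwistClass x α) (hy : IsDehnTwistClass y β)
    (s : List ℕ) (hs : Relation.ReflTransGen BlowUp [0, 0] s)
    (c : List ℤ) (hc : List.Forall₂ (fun (si : ℕ) (ci : ℤ) => (si : ℤ) ≤ ci) s c) :
    hWord x y c ∈ DehnPlus T := by
  obtain ⟨ι, hι, -⟩ := hT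
  -- The embedding into `Circle × Circle` makes `T` Hausdorff, as the separation and closedness
  -- arguments for strips require.
  have : T2Space T := hι.isEmbedding.t2Space
  exact hWord_mem (hx.braid hαβ hy) (fun g => hx.conj_mem g) hs hc
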